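/- Let $\mathbf k$ be a non-Archimedean local field which is neither of characteristic $2$ nor an extension of $\mathbb Q_2$ (equivalently, $2$ is a unit of the ring of integers $\mathcal O$). Let $\varpi$ be a uniformizer, $q$ the cardinality of the residue field, and $n\ge 1$ an integer. Let $dt$ be the Haar measure of $\mathbf k$ with ${\rm Vol}(\mathcal O)=1$, and let $\Psi$ be a continuous unitary character of $(\mathbf k,+)$ that is trivial on $\mathcal O$ but not on $\varpi^{-1}\mathcal O$. Put $U_n=1+\varpi^n\mathcal O\subset\mathcal O^\times$ (with the restriction of $dt$ as Haar measure), $\Gamma_n=\mathbf k/\varpi^{-n}\mathcal O$ (discrete, with the counting measure), and let $X_n$ be the locally compact group of pairs $(a,[t])\in U_n\times\Gamma_n$ with group law $(a,[t])(a',[t'])=(aa',[a'^{-1}t+t'])$ and the product Haar measure. Let $\phi(a)=a-a^{-1}$ for $a\in U_n$, let $(\lambda_g f)(x)=f(g^{-1}x)$ be the left regular representation of a group, and let $W^*(G)$ be the von Neumann algebra generated by the operators $\lambda_g$, $g\in G$, on $L^2(G)$; we identify $W^*(G)\bar\otimes W^*(G)=W^*(G\times G)$. Consider the convolution operator on $L^2(X_n\times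 X_n)$ $$F=q^{2n}\int_{X_n\times X_n}\Psi\big(\phi(a_1)t_2-\phi(a_2)t_1\big)\,\lambda_{g_1^{-1}}\otimes\lambda_{g_2^{-1}}\,dg_1\,dg_2,\qquad g_j=(a_j,[t_j]),$$ initially defined as a quadratic form on the Bruhat test functions, that is, on the locally constant compactly supported functions on $X_n\times X_n$: for all such $f,h$, $$\langle h,Ff\rangle=q^{2n}\int_{X_n\times X_n}\Psi\big(\phi(a_1)t_2-\phi(a_2)t_1\big)\,\langle h,(\lambda_{g_1^{-1}}\otimes\lambda_{g_2^{-1}})f\rangle\,dg_1\,dg_2,$$ the integrals being absolutely convergent. Then there is exactly one bounded operator $F$ on $L^2(X_n\times X_n)$ with these matrix coefficients, it is a unitary element of $W^*(X_n\times X_n)$, and it satisfies the dual $2$-cocycle relation $$(1\otimes F)\,({\rm Id}\otimes\hat\Delta)(F)=(F\otimes 1)\,(\hat\Delta\otimes{\rm Id})(F)$$ in $W^*(X_n\times X_n\times X_n)$, where $\hat\Delta:W^*(X_n)\to W^*(X_n\times X_n)$ is the coproduct of the group von Neumann algebra, i.e. the normal unital $*$-homomorphism with $\hat\Delta(\lambda_g)=\lambda_g\otimes\lambda_g$.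 -/

import Mathlib

open MeasureTheory TensorProduct
open scoped ENNReal InnerProductSpace ValuativeRel

namespace DualCocycle

noncomputable section

/-- The complex Hilbert space `L²(α, μ)`. -/
abbrev L2 {α : Type*} [MeasurableSpace α] (μ : Measure α) : Type _ := Lp ℂ 2 μ

section Tensor

set_option linter.unusedSectionVars false

variable {α β : Type*} [MeasurableSpace α] [MeasurableSpace β]
  (μ : Measure α) (ν : Measure β) [SigmaFinite μ] [SigmaFinite ν]

theorem memLp_mul {f : α → ℂ} {h : β → ℂ} (hf : MemLp f 2 μ) (hh : MemLp h 2 ν) :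
    MemLp (fun z : α × β => f z.1 * h z.2) 2 (μ.prod ν) := by
  have hm : AEStronglyMeasurable (fun z : α × β => f z.1 * h z.2) (μ.prod ν) :=
    hf.1.comp_fst.mul hh.1.comp_snd
  rw [memLp_two_iff_integrable_sq_norm hm]
  have := ((memLp_two_iff_integrable_sq_norm hf.1).1 hf).mul_prod
    ((memLp_two_iff_integrable_sq_norm hh.1).1 hh)
  refine this.congr (.of_forall fun z => ?_)
  simp [mul_pow]

/-- The elementary tensor `(f ⊗ h)(x, y) = f(x) h(y)` in `L²(μ × ν)`. -/
def tmulFun (f : L2 μ) (h : L2 ν) : L2 (μ.prod ν) :=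
  (memLp_mul μ ν (Lp.memLp f) (Lp.memLp h)).toLp _

theorem coeFn_tmulFun (f : L2 μ) (h : L2 ν) :
    tmulFun μ ν f h =ᵐ[μ.prod ν] fun z => f z.1 * h z.2 :=
  MemLp.coeFn_toLp _

theorem ae_fst {p : α → Prop} (h : ∀ᵐ x ∂μ, p x) : ∀ᵐ z ∂μ.prod ν, p z.1 :=
  Measure.quasiMeasurePreserving_fst.ae h

theorem ae_snd {p : β → Prop} (h : ∀ᵐ x ∂ν, p x) : ∀ᵐ z ∂μ.prod ν, p z.2 :=
  Measure.quasiMeasurePreserving_snd.ae h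

theorem inner_tmulFun (f f' : L2 μ) (h h' : L2 ν) :
    ⟪tmulFun μ ν f h, tmulFun μ ν f' h'⟫_ℂ = ⟪f, f'⟫_ℂ * ⟪h, h'⟫_ℂ := by
  simp only [L2.inner_def]
  rw [← integral_prod_mul]
  apply integral_congr_ae
  filter_upwards [coeFn_tmulFun μ ν f h, coeFn_tmulFun μ ν f' h'] with z h1 h2
  rw [h1, h2]
  simp
  ring

/-- The bilinear map `(f, h) ↦ f ⊗ h`. -/
def tmulBilin : L2 μ →ₗ[ℂ] L2 ν →ₗ[ℂ] L2 (μ.prod ν) :=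
  LinearMap.mk₂ ℂ (tmulFun μ ν)
    (fun f f' h => by
      apply Lp.ext
      filter_upwards [coeFn_tmulFun μ ν (f + f') h, coeFn_tmulFun μ ν f h, coeFn_tmulFun μ ν f' h,
        Lp.coeFn_add (tmulFun μ ν f h) (tmulFun μ ν f' h), ae_fst μ ν (Lp.coeFn_add f f')]
        with z h1 h2 h3 h4 h5
      simp only [h1, h4, h5, Pi.add_apply, h2, h3, add_mul])
    (fun c f h => by
      apply Lp.ext
      filter_upwards [coeFn_tmulFun μ ν (c • f) h, coeFn_tmulFun μ ν f h,
        Lp.coeFn_smul c (tmulFun μ ν f h), ae_fst μ ν (Lp.coeFn_smul c f)]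
        with z h1 h2 h4 h5
      simp only [h1, h4, h5, Pi.smul_apply, h2, smul_eq_mul, mul_assoc])
    (fun f h h' => by
      apply Lp.ext
      filter_upwards [coeFn_tmulFun μ ν f (h + h'), coeFn_tmulFun μ ν f h, coeFn_tmulFun μ ν f h',
        Lp.coeFn_add (tmulFun μ ν f h) (tmulFun μ ν f h'), ae_snd μ ν (Lp.coeFn_add h h')]
        with z h1 h2 h3 h4 h5
      simp only [h1, h4, h5, Pi.add_apply, h2, h3, mul_add])
    (fun c f h => by
      apply Lp.ext
      filter_upwards [coeFn_tmulFun μ ν f (c • h), coeFn_tmulFun μ ν f h,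
        Lp.coeFn_smul c (tmulFun μ ν f h), ae_snd μ ν (Lp.coeFn_smul c h)]
        with z h1 h2 h4 h5
      simp only [h1, h4, h5, Pi.smul_apply, h2, smul_eq_mul]
      ring)

/-- The canonical isometry of the algebraic tensor product `L²(μ) ⊗ L²(ν)` (with its Hilbert
tensor norm) into `L²(μ × ν)`. Its range is dense (`denseRange_tmulIsom`), so that `L²(μ × ν)` is
the Hilbert space tensor product. -/
def tmulIsom : L2 μ ⊗[ℂ] L2 ν →ₗᵢ[ℂ] L2 (μ.prod ν) :=
  (TensorProduct.lift (tmulBilin μ ν)).isometryOfInner (by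
    intro x y
    induction x with
    | zero => simp
    | add x x' hx hx' => simp only [map_add, inner_add_left, hx, hx']
    | tmul f h =>
      induction y with
      | zero => simp
      | add y y' hy hy' => simp only [map_add, inner_add_right, hy, hy']
      | tmul f' h' => simpa [tmulBilin] using inner_tmulFun μ ν f f' h h')

@[simp] theorem tmulIsom_tmul (f : L2 μ) (h : L2 ν) :
    tmulIsom μ ν (f ⊗ₜ h) = tmulFun μ ν f h := by
  simp [tmulIsom, tmulBilin]

theorem eq_zero_of_inner_tmulFun (g : L2 (μ.prod ν))
    (hg : ∀ f h, ⟪tmulFun μ ν f h, g⟫_ℂ = 0) : g = 0 := by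
  have hgm := Lp.memLp g
  -- integrals over measurable rectangles of finite measure vanish
  have rect : ∀ (s : Set α) (t : Set β), MeasurableSet s → MeasurableSet t → μ s ≠ ∞ → ν t ≠ ∞ →
      ∫ z in s ×ˢ t, g z ∂(μ.prod ν) = 0 := by
    intro s t hs ht hμ hν
    have h0 := hg (indicatorConstLp 2 hs hμ 1) (indicatorConstLp 2 ht hν 1)
    rw [L2.inner_def] at h0
    rw [← h0, ← integral_indicator (hs.prod ht)]
    apply integral_congr_ae
    filter_upwards [coeFn_tmulFun μ ν (indicatorConstLp 2 hs hμ 1) (indicatorConstLp 2 ht hν 1),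
      ae_fst μ ν (indicatorConstLp_coeFn (p := 2) (hs := hs) (hμs := hμ) (c := (1 : ℂ))),
      ae_snd μ ν (indicatorConstLp_coeFn (p := 2) (hs := ht) (hμs := hν) (c := (1 : ℂ)))]
      with z h1 h2 h3
    rw [h1, h2, h3]
    by_cases hz1 : z.1 ∈ s <;> by_cases hz2 : z.2 ∈ t <;>
      simp [Set.indicator, hz1, hz2, Set.mem_prod]
  -- hence all set integrals inside a fixed rectangle of finite measure vanish
  have key : ∀ (s : Set α) (t : Set β), MeasurableSet s → MeasurableSet t → μ s ≠ ∞ → ν t ≠ ∞ →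
      ∀ u : Set (α × β), MeasurableSet u → ∫ z in u ∩ s ×ˢ t, g z ∂(μ.prod ν) = 0 := by
    intro s t hs ht hμ hν
    have hfin : (μ.prod ν) (s ×ˢ t) ≠ ∞ := by
      rw [Measure.prod_prod]; exact ENNReal.mul_ne_top hμ hν
    have hint : IntegrableOn g (s ×ˢ t) (μ.prod ν) := by
      have : IsFiniteMeasure ((μ.prod ν).restrict (s ×ˢ t)) := ⟨by simpa using hfin.lt_top⟩
      exact (hgm.restrict _).integrable (by norm_num)
    intro u hu
    induction u, hu using MeasurableSpace.induction_on_inter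
      generateFrom_prod.symm isPiSystem_prod with
    | empty => simp
    | basic u hu =>
      obtain ⟨a, ha, b, hb, rfl⟩ := hu
      rw [Set.prod_inter_prod]
      exact rect _ _ (ha.inter hs) (hb.inter ht)
        (measure_ne_top_of_subset Set.inter_subset_right hμ)
        (measure_ne_top_of_subset Set.inter_subset_right hν)
    | compl u hu ih =>
      have h1 := integral_inter_add_sdiff (μ := μ.prod ν) (f := g) (s := s ×ˢ t) hu hint
      rw [Set.inter_comm, ih, zero_add, rect s t hs ht hμ hν] at h1
      rwa [Set.inter_comm, ← Set.sdiff_eq]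
    | iUnion u hd hu ih =>
      rw [Set.iUnion_inter, integral_iUnion (fun i => (hu i).inter (hs.prod ht))
        (fun i j hij => (hd hij).mono Set.inter_subset_left Set.inter_subset_left)
        (hint.mono_set (Set.iUnion_subset fun i => Set.inter_subset_right))]
      simp [ih]
  have hR : ∀ n, (g : α × β → ℂ) =ᵐ[(μ.prod ν).restrict
      (spanningSets μ n ×ˢ spanningSets ν n)] 0 := by
    intro n
    have hs := measurableSet_spanningSets μ n
    have ht := measurableSet_spanningSets ν n
    have hμ := (measure_spanningSets_lt_top μ n).ne
    have hν := (measure_spanningSets_lt_top ν n).ne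
    have hfin : (μ.prod ν) (spanningSets μ n ×ˢ spanningSets ν n) ≠ ∞ := by
      rw [Measure.prod_prod]; exact ENNReal.mul_ne_top hμ hν
    have : IsFiniteMeasure ((μ.prod ν).restrict (spanningSets μ n ×ˢ spanningSets ν n)) :=
      ⟨by simpa using hfin.lt_top⟩
    have hint := (hgm.restrict (spanningSets μ n ×ˢ spanningSets ν n)).integrable (by norm_num)
    refine hint.ae_eq_zero_of_forall_setIntegral_eq_zero fun u hu _ => ?_
    rw [Measure.restrict_restrict hu]
    exact key _ _ hs ht hμ hν u hu
  have hcov : (⋃ n, spanningSets μ n ×ˢ spanningSets ν n) = (Set.univ : Set (α × β)) := by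
    rw [Set.iUnion_prod_of_monotone (monotone_spanningSets μ) (monotone_spanningSets ν),
      iUnion_spanningSets, iUnion_spanningSets, Set.univ_prod_univ]
  have := (ae_restrict_iUnion_iff (μ := μ.prod ν)
    (fun n => spanningSets μ n ×ˢ spanningSets ν n) (fun z => g z = 0)).2 hR
  rw [hcov, Measure.restrict_univ] at this
  exact (Lp.eq_zero_iff_ae_eq_zero).2 this

theorem denseRange_tmulIsom : DenseRange (tmulIsom μ ν) := by
  have : (LinearMap.range (tmulIsom μ ν).toLinearMap).topologicalClosure = ⊤ := by
    rw [Submodule.topologicalClosure_eq_top_iff, Submodule.eq_bot_iff]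
    intro g hg
    refine eq_zero_of_inner_tmulFun μ ν g fun f h => ?_
    exact (Submodule.mem_orthogonal _ _).1 hg _ ⟨f ⊗ₜ h, by simp⟩
  rw [DenseRange, dense_iff_closure_eq]
  have h2 := congrArg (fun S : Submodule ℂ (L2 (μ.prod ν)) => (S : Set (L2 (μ.prod ν)))) this
  rw [Submodule.topologicalClosure_coe] at h2
  exact h2

theorem isUniformInducing_tmulIsom :
    IsUniformInducing (tmulIsom μ ν).toContinuousLinearMap :=
  (tmulIsom μ ν).isometry.isUniformInducing

variable {μ ν}

/-- The tensor product `S ⊗ T` of bounded operators, acting on `L²(μ × ν)`: the bounded operator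
with `(S ⊗ T)(f ⊗ h) = S f ⊗ T h`. -/
def opTensor (S : L2 μ →L[ℂ] L2 μ) (T : L2 ν →L[ℂ] L2 ν) :
    L2 (μ.prod ν) →L[ℂ] L2 (μ.prod ν) :=
  ((tmulIsom μ ν).toContinuousLinearMap ∘L TensorProduct.mapL S T).extend
    (tmulIsom μ ν).toContinuousLinearMap

@[simp] theorem opTensor_tmulFun (S : L2 μ →L[ℂ] L2 μ) (T : L2 ν →L[ℂ] L2 ν) (f : L2 μ) (h : L2 ν) :
    opTensor S T (tmulFun μ ν f h) = tmulFun μ ν (S f) (T h) := by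
  have := ContinuousLinearMap.extend_eq
    ((tmulIsom μ ν).toContinuousLinearMap ∘L TensorProduct.mapL S T)
    (e := (tmulIsom μ ν).toContinuousLinearMap)
    (denseRange_tmulIsom μ ν) (isUniformInducing_tmulIsom μ ν) (f ⊗ₜ h)
  simpa [opTensor] using this

/-- Bounded operators on `L²(μ × ν)` that agree on elementary tensors are equal. -/
theorem ext_tmulFun {E : Type*} [NormedAddCommGroup E] [NormedSpace ℂ E]
    {A B : L2 (μ.prod ν) →L[ℂ] E}
    (h : ∀ f g, A (tmulFun μ ν f g) = B (tmulFun μ ν f g)) : A = B := by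
  have : ∀ x, A (tmulIsom μ ν x) = B (tmulIsom μ ν x) := by
    intro x
    induction x with
    | zero => simp
    | add x y hx hy => simp only [map_add, hx, hy]
    | tmul f g => simpa using h f g
  ext1 x
  exact congrFun ((denseRange_tmulIsom μ ν).equalizer A.continuous B.continuous (funext this)) x

/-- The amplification `x ↦ x ⊗ 1` as a unital *-homomorphism. -/
def amplify (μ : Measure α) (ν : Measure β) [SigmaFinite μ] [SigmaFinite ν] :
    (L2 μ →L[ℂ] L2 μ) →⋆ₐ[ℂ] (L2 (μ.prod ν) →L[ℂ] L2 (μ.prod ν)) where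
  toFun x := opTensor x 1
  map_one' := ext_tmulFun (by simp)
  map_mul' x y := ext_tmulFun (by simp)
  map_zero' := ext_tmulFun fun f g => by
    have h := LinearMap.map_zero₂ (tmulBilin μ ν) g
    simp only [tmulBilin, LinearMap.mk₂_apply] at h
    simpa using h
  map_add' x y := ext_tmulFun fun f g => by
    have h := LinearMap.map_add₂ (tmulBilin μ ν) (x f) (y f) g
    simp only [tmulBilin, LinearMap.mk₂_apply] at h
    simpa using h
  commutes' c := ext_tmulFun fun f g => by
    have h := LinearMap.map_smul₂ (tmulBilin μ ν) c f g
    simp only [tmulBilin, LinearMap.mk₂_apply] at h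
    simpa [Algebra.algebraMap_eq_smul_one] using h
  map_star' x := by
    refine ext_tmulFun fun f g => ?_
    rw [← sub_eq_zero]
    refine eq_zero_of_inner_tmulFun μ ν _ fun f' g' => ?_
    rw [inner_sub_right, ContinuousLinearMap.star_eq_adjoint, ContinuousLinearMap.star_eq_adjoint,
      ContinuousLinearMap.adjoint_inner_right]
    simp [inner_tmulFun, ContinuousLinearMap.adjoint_inner_right]

@[simp] theorem amplify_apply (x : L2 μ →L[ℂ] L2 μ) : amplify μ ν x = opTensor x 1 := rfl

end Tensor

section Pull

variable {α β : Type*} [MeasurableSpace α] [MeasurableSpace β] {μ : Measure α} {ν : Measure β}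

/-- The unitary `f ↦ f ∘ e` from `L²(ν)` onto `L²(μ)` given by a measure preserving
isomorphism `e`. -/
def pull (e : α ≃ᵐ β) (he : MeasurePreserving e μ ν) : L2 ν ≃ₗᵢ[ℂ] L2 μ where
  toLinearEquiv := LinearEquiv.ofLinearMap
    (Lp.compMeasurePreservingₗ ℂ e he) (Lp.compMeasurePreservingₗ ℂ e.symm (he.symm e))
    (by
      ext1 f
      have := Lp.compMeasurePreserving_comp_apply f (he.symm e) he
      simp only [MeasurableEquiv.symm_comp_self] at this
      simpa using this.symm)
    (by
      ext1 f
      have := Lp.compMeasurePreserving_comp_apply f he (he.symm e)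
      simp only [MeasurableEquiv.self_comp_symm] at this
      simpa using this.symm)
  norm_map' f := Lp.norm_compMeasurePreserving f he

theorem coeFn_pull (e : α ≃ᵐ β) (he : MeasurePreserving e μ ν) (f : L2 ν) :
    pull e he f =ᵐ[μ] fun x => f (e x) :=
  Lp.coeFn_compMeasurePreserving f he

end Pull


section GroupAlgebra

instance {G K : Type*} [Inv G] [Inv K] [MeasurableSpace G] [MeasurableSpace K] [MeasurableInv G]
    [MeasurableInv K] : MeasurableInv (G × K) :=
  ⟨measurable_fst.inv.prodMk measurable_snd.inv⟩

instance {G K : Type*} [Mul G] [Mul K] [MeasurableSpace G] [MeasurableSpace K] [MeasurableMul₂ G]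
    [MeasurableMul₂ K] : MeasurableMul₂ (G × K) :=
  ⟨((measurable_fst.fst.mul measurable_snd.fst).prodMk (measurable_fst.snd.mul measurable_snd.snd))⟩

section Generated

variable {H : Type*} [NormedAddCommGroup H] [InnerProductSpace ℂ H] [CompleteSpace H]

/-- The von Neumann algebra generated by a set `s` of bounded operators: the double commutant of
`s ∪ s*`. -/
def generatedVN (s : Set (H →L[ℂ] H)) : VonNeumannAlgebra H where
  toStarSubalgebra := StarSubalgebra.centralizer ℂ (StarSubalgebra.centralizer ℂ s : Set (H →L[ℂ] H))
  centralizer_centralizer' := Set.centralizer_centralizer_centralizer _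

end Generated

set_option linter.unusedSectionVars false

variable {G : Type*} [Group G] [MeasurableSpace G] [MeasurableMul₂ G] [MeasurableInv G]
  (μ : Measure G) [SigmaFinite μ] [μ.IsMulLeftInvariant]

/-- The left regular representation `(λ_g f)(x) = f(g⁻¹ x)` on `L²(G)`. -/
def leftReg (g : G) : L2 μ →L[ℂ] L2 μ :=
  (pull (MeasurableEquiv.mulLeft g⁻¹) (measurePreserving_mul_left μ g⁻¹)).toLinearIsometry.toContinuousLinearMap

theorem coeFn_leftReg (g : G) (f : L2 μ) : leftReg μ g f =ᵐ[μ] fun x => f (g⁻¹ * x) :=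
  coeFn_pull _ (measurePreserving_mul_left μ g⁻¹) f

/-- The group von Neumann algebra `W*(G)`, generated by the operators `λ_g`. -/
def groupVN : VonNeumannAlgebra (L2 μ) := generatedVN (Set.range (leftReg μ))

/-- The elements of `W*(G)`, as a *-algebra. -/
abbrev W : Type _ := (groupVN μ).toStarSubalgebra

theorem leftReg_mul (g h : G) : leftReg μ (g * h) = leftReg μ g * leftReg μ h := by
  ext1 f
  apply Lp.ext
  filter_upwards [coeFn_leftReg μ (g * h) f, coeFn_leftReg μ g (leftReg μ h f),
    (measurePreserving_mul_left μ g⁻¹).quasiMeasurePreserving.ae (coeFn_leftReg μ h f)]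
    with x h1 h2 h3
  rw [h1, mul_inv_rev, mul_assoc, ← h3, ← h2]
  rfl

theorem leftReg_one : leftReg μ (1 : G) = 1 := by
  ext1 f
  apply Lp.ext
  filter_upwards [coeFn_leftReg μ 1 f] with x h1
  simp [h1]

theorem star_leftReg (g : G) : star (leftReg μ g) = leftReg μ g⁻¹ := by
  have h1 : star (leftReg μ g) * leftReg μ g = 1 :=
    (ContinuousLinearMap.norm_map_iff_adjoint_comp_self _).1
      (LinearIsometryEquiv.norm_map _)
  have h2 : leftReg μ g * leftReg μ g⁻¹ = 1 := by rw [← leftReg_mul, mul_inv_cancel, leftReg_one]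
  exact left_inv_eq_right_inv h1 h2

theorem mem_groupVN_iff {T : L2 μ →L[ℂ] L2 μ} :
    T ∈ groupVN μ ↔ ∀ S : L2 μ →L[ℂ] L2 μ, (∀ g, Commute S (leftReg μ g)) → Commute S T := by
  have hS : ∀ S, S ∈ StarSubalgebra.centralizer ℂ (Set.range (leftReg μ)) ↔
      ∀ g, Commute S (leftReg μ g) := by
    intro S
    rw [StarSubalgebra.mem_centralizer_iff]
    constructor
    · intro h g
      exact (h _ ⟨g, rfl⟩).1.symm
    · rintro h _ ⟨g, rfl⟩
      refine ⟨(h g).symm, ?_⟩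
      rw [star_leftReg]
      exact (h g⁻¹).symm
  change T ∈ StarSubalgebra.centralizer ℂ _ ↔ _
  rw [StarSubalgebra.mem_centralizer_iff]
  constructor
  · intro h S hc
    exact (h S ((hS S).2 hc)).1
  · intro h S hc
    exact ⟨h S ((hS S).1 hc), h _ ((hS _).1 (star_mem hc))⟩

theorem leftReg_mem (g : G) : leftReg μ g ∈ groupVN μ :=
  (mem_groupVN_iff μ).2 fun _ h => h g

end GroupAlgebra

section Implement

variable {α β κ : Type*} [MeasurableSpace α] [MeasurableSpace β] [MeasurableSpace κ]
  {μ : Measure α} {ν : Measure β} {ξ : Measure κ} [SigmaFinite μ] [SigmaFinite ν]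

/-- The normal unital *-homomorphism `x ↦ V (x ⊗ 1) V*` implemented by the unitary
`V f = f ∘ e`. -/
def implement (e : κ ≃ᵐ α × β) (he : MeasurePreserving e ξ (μ.prod ν)) :
    (L2 μ →L[ℂ] L2 μ) →⋆ₐ[ℂ] (L2 ξ →L[ℂ] L2 ξ) :=
  ((pull e he).conjStarAlgEquiv : (L2 (μ.prod ν) →L[ℂ] L2 (μ.prod ν)) →⋆ₐ[ℂ] _).comp (amplify μ ν)

theorem implement_pull (e : κ ≃ᵐ α × β) (he : MeasurePreserving e ξ (μ.prod ν))
    (x : L2 μ →L[ℂ] L2 μ) (v : L2 (μ.prod ν)) :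
    implement e he x (pull e he v) = pull e he (opTensor x 1 v) := by
  simp [implement]

theorem ext_pull {E : Type*} [NormedAddCommGroup E] [NormedSpace ℂ E] (e : κ ≃ᵐ α × β)
    (he : MeasurePreserving e ξ (μ.prod ν)) {A B : L2 ξ →L[ℂ] E}
    (h : ∀ f g, A (pull e he (tmulFun μ ν f g)) = B (pull e he (tmulFun μ ν f g))) : A = B := by
  have : A ∘L ((pull e he).toLinearIsometry.toContinuousLinearMap) =
      B ∘L ((pull e he).toLinearIsometry.toContinuousLinearMap) := ext_tmulFun h
  ext1 v
  obtain ⟨w, rfl⟩ := (pull e he).surjective v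
  exact congrArg (fun L => L w) this

/-- The map `f ↦ V (f ⊗ h)`. -/
def slice (e : κ ≃ᵐ α × β) (he : MeasurePreserving e ξ (μ.prod ν)) (h : L2 ν) :
    L2 μ →L[ℂ] L2 ξ :=
  ((pull e he).toLinearIsometry.toContinuousLinearMap ∘L
    (tmulIsom μ ν).toContinuousLinearMap) ∘L (TensorProduct.mkL ℂ (L2 μ) (L2 ν)).flip h

theorem slice_apply (e : κ ≃ᵐ α × β) (he : MeasurePreserving e ξ (μ.prod ν)) (h : L2 ν)
    (f : L2 μ) : slice e he h f = pull e he (tmulFun μ ν f h) := by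
  simp [slice]

theorem implement_comp_slice (e : κ ≃ᵐ α × β) (he : MeasurePreserving e ξ (μ.prod ν)) (h : L2 ν)
    (x : L2 μ →L[ℂ] L2 μ) : implement e he x ∘L slice e he h = slice e he h ∘L x := by
  ext1 f
  simp [slice_apply, implement_pull]

theorem adjoint_slice_comp (e : κ ≃ᵐ α × β) (he : MeasurePreserving e ξ (μ.prod ν)) (h : L2 ν)
    (x : L2 μ →L[ℂ] L2 μ) :
    (slice e he h).adjoint ∘L implement e he x = x ∘L (slice e he h).adjoint := by
  have h1 := congrArg ContinuousLinearMap.adjoint (implement_comp_slice e he h (star x))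
  rw [ContinuousLinearMap.adjoint_comp, ContinuousLinearMap.adjoint_comp, map_star,
    ← ContinuousLinearMap.star_eq_adjoint (star _), ← ContinuousLinearMap.star_eq_adjoint (star _),
    star_star, star_star] at h1
  exact h1

theorem eq_of_slices (e : κ ≃ᵐ α × β) (he : MeasurePreserving e ξ (μ.prod ν))
    {A B : L2 ξ →L[ℂ] L2 ξ}
    (H : ∀ h h', (slice e he h').adjoint ∘L A ∘L slice e he h =
      (slice e he h').adjoint ∘L B ∘L slice e he h) : A = B := by
  refine ext_pull e he fun f h => ?_
  rw [← sub_eq_zero, ← (pull e he).symm.map_eq_zero_iff]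
  refine eq_zero_of_inner_tmulFun μ ν _ fun f' h' => ?_
  rw [← (pull e he).inner_map_map, LinearIsometryEquiv.apply_symm_apply, ← slice_apply,
    ← slice_apply, inner_sub_right, ← ContinuousLinearMap.adjoint_inner_right,
    ← ContinuousLinearMap.adjoint_inner_right]
  have := congrArg (fun L => L f) (H h h')
  simp only [ContinuousLinearMap.comp_apply] at this
  rw [this, sub_self]

end Implement

section Restrict

set_option linter.unusedSectionVars false

variable {G β K : Type*} [Group G] [MeasurableSpace G] [MeasurableMul₂ G] [MeasurableInv G]
  [MeasurableSpace β] [Group K] [MeasurableSpace K] [MeasurableMul₂ K] [MeasurableInv K]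
  {μ : Measure G} {ν : Measure β} {ξ : Measure K} [SigmaFinite μ] [SigmaFinite ν] [SigmaFinite ξ]
  [μ.IsMulLeftInvariant] [ξ.IsMulLeftInvariant]

theorem implement_leftReg (e : K ≃ᵐ G × β) (he : MeasurePreserving e ξ (μ.prod ν)) (s : G) (k : K)
    (hk : ∀ z, e (k⁻¹ * z) = (s⁻¹ * (e z).1, (e z).2)) :
    implement e he (leftReg μ s) = leftReg ξ k := by
  refine ext_pull e he fun f h => ?_
  rw [implement_pull, opTensor_tmulFun]
  apply Lp.ext
  have hq := he.quasiMeasurePreserving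
  have hk' := (measurePreserving_mul_left ξ k⁻¹).quasiMeasurePreserving
  filter_upwards [coeFn_pull e he (tmulFun μ ν (leftReg μ s f) ((1 : L2 ν →L[ℂ] L2 ν) h)),
    hq.ae (coeFn_tmulFun μ ν (leftReg μ s f) h), hq.ae (ae_fst μ ν (coeFn_leftReg μ s f)),
    coeFn_leftReg ξ k (pull e he (tmulFun μ ν f h)),
    hk'.ae (coeFn_pull e he (tmulFun μ ν f h)),
    hk'.ae (hq.ae (coeFn_tmulFun μ ν f h))] with z h1 h2 h3 h4 h5 h6
  rw [h1, h4, h5, h6, hk]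
  simp only [one_apply_eq_self]
  rw [h2, h3]

theorem implement_mem (e : K ≃ᵐ G × β) (he : MeasurePreserving e ξ (μ.prod ν)) (k : G → K)
    (hk : ∀ s z, e ((k s)⁻¹ * z) = (s⁻¹ * (e z).1, (e z).2)) {x : L2 μ →L[ℂ] L2 μ}
    (hx : x ∈ groupVN μ) : implement e he x ∈ groupVN ξ := by
  rw [mem_groupVN_iff] at hx ⊢
  intro R hR
  refine eq_of_slices e he fun h h' => ?_
  have hR' : ∀ s, R ∘L implement e he (leftReg μ s) = implement e he (leftReg μ s) ∘L R :=
    fun s => by rw [implement_leftReg e he s (k s) (hk s)]; exact hR (k s)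
  have := hx ((slice e he h').adjoint ∘L R ∘L slice e he h) (fun s => by
    change ((slice e he h').adjoint ∘L R ∘L slice e he h) ∘L leftReg μ s =
      leftReg μ s ∘L ((slice e he h').adjoint ∘L R ∘L slice e he h)
    rw [ContinuousLinearMap.comp_assoc, ContinuousLinearMap.comp_assoc, ← implement_comp_slice,
      ← ContinuousLinearMap.comp_assoc R, hR' s, ← ContinuousLinearMap.comp_assoc (leftReg μ s),
      ← adjoint_slice_comp e he]
    rfl)
  have h2 : ((slice e he h').adjoint ∘L R ∘L slice e he h) ∘L x =
      x ∘L ((slice e he h').adjoint ∘L R ∘L slice e he h) := this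
  change (slice e he h').adjoint ∘L (R ∘L implement e he x) ∘L slice e he h =
    (slice e he h').adjoint ∘L (implement e he x ∘L R) ∘L slice e he h
  calc _ = ((slice e he h').adjoint ∘L R ∘L slice e he h) ∘L x := by
        rw [ContinuousLinearMap.comp_assoc R, implement_comp_slice]; rfl
    _ = _ := by
        rw [h2, ← ContinuousLinearMap.comp_assoc x, ← adjoint_slice_comp e he]; rfl

/-- The restriction of `implement e he` to a normal *-homomorphism `W*(G) → W*(K)`, when it maps
each generator `λ_s` to the generator `λ_{k s}`. -/
def implementVN (e : K ≃ᵐ G × β) (he : MeasurePreserving e ξ (μ.prod ν)) (k : G → K)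
    (hk : ∀ s z, e ((k s)⁻¹ * z) = (s⁻¹ * (e z).1, (e z).2)) :
    W μ →⋆ₐ[ℂ] W ξ :=
  ((implement e he).comp (groupVN μ).toStarSubalgebra.subtype).codRestrict _
    fun x => implement_mem e he k hk x.2

end Restrict

section Coproduct

set_option linter.unusedSectionVars false

variable {G : Type*} [Group G] [MeasurableSpace G] [MeasurableMul₂ G] [MeasurableInv G]
  (μ : Measure G) [SigmaFinite μ] [μ.IsMulLeftInvariant]

/-- `(x, y) ↦ (x, x⁻¹ y)`. -/
def shear (G : Type*) [Group G] [MeasurableSpace G] [MeasurableMul₂ G] [MeasurableInv G] :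
    G × G ≃ᵐ G × G := (MeasurableEquiv.shearMulRight G).symm

theorem measurePreserving_shear : MeasurePreserving (shear G) (μ.prod μ) (μ.prod μ) :=
  measurePreserving_prod_inv_mul μ μ

/-- `(x, y, z) ↦ ((x, y), z)`. -/
def equiv12 (G : Type*) [MeasurableSpace G] : G × G × G ≃ᵐ (G × G) × G :=
  MeasurableEquiv.prodAssoc.symm

/-- `(x, y, z) ↦ ((y, z), x)`. -/
def equiv23 (G : Type*) [MeasurableSpace G] : G × G × G ≃ᵐ (G × G) × G := MeasurableEquiv.prodComm

/-- `(x, y, z) ↦ ((x, y), y⁻¹ z)`. -/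
def equivIdΔ (G : Type*) [Group G] [MeasurableSpace G] [MeasurableMul₂ G] [MeasurableInv G] :
    G × G × G ≃ᵐ (G × G) × G :=
  ((MeasurableEquiv.refl G).prodCongr (shear G)).trans MeasurableEquiv.prodAssoc.symm

/-- `(x, y, z) ↦ ((x, z), x⁻¹ y)`. -/
def equivΔId (G : Type*) [Group G] [MeasurableSpace G] [MeasurableMul₂ G] [MeasurableInv G] :
    G × G × G ≃ᵐ (G × G) × G :=
  ((equiv12 G).trans ((shear G).prodCongr (MeasurableEquiv.refl G))).trans
    (MeasurableEquiv.prodAssoc.trans (((MeasurableEquiv.refl G).prodCongr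
      MeasurableEquiv.prodComm).trans MeasurableEquiv.prodAssoc.symm))

@[simp] theorem shear_apply (z : G × G) : shear G z = (z.1, z.1⁻¹ * z.2) := rfl

@[simp] theorem equiv12_apply (z : G × G × G) : equiv12 G z = ((z.1, z.2.1), z.2.2) := rfl

@[simp] theorem equiv23_apply (z : G × G × G) : equiv23 G z = ((z.2.1, z.2.2), z.1) := rfl

@[simp] theorem equivIdΔ_apply (z : G × G × G) :
    equivIdΔ G z = ((z.1, z.2.1), z.2.1⁻¹ * z.2.2) := rfl

@[simp] theorem equivΔId_apply (z : G × G × G) :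
    equivΔId G z = ((z.1, z.2.2), z.1⁻¹ * z.2.1) := rfl

theorem measurePreserving_equiv12 :
    MeasurePreserving (equiv12 G) (μ.prod (μ.prod μ)) ((μ.prod μ).prod μ) :=
  MeasurePreserving.symm MeasurableEquiv.prodAssoc
    ⟨MeasurableEquiv.prodAssoc.measurable, Measure.prodAssoc_prod⟩

theorem measurePreserving_equiv23 :
    MeasurePreserving (equiv23 G) (μ.prod (μ.prod μ)) ((μ.prod μ).prod μ) :=
  Measure.measurePreserving_swap

theorem measurePreserving_equivIdΔ :
    MeasurePreserving (equivIdΔ G) (μ.prod (μ.prod μ)) ((μ.prod μ).prod μ) :=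
  (measurePreserving_equiv12 μ).comp ((MeasurePreserving.id μ).prod (measurePreserving_shear μ))

theorem measurePreserving_equivΔId :
    MeasurePreserving (equivΔId G) (μ.prod (μ.prod μ)) ((μ.prod μ).prod μ) :=
  ((measurePreserving_equiv12 μ).comp (((MeasurePreserving.id μ).prod
    Measure.measurePreserving_swap).comp
      (⟨MeasurableEquiv.prodAssoc.measurable, Measure.prodAssoc_prod⟩ :
        MeasurePreserving MeasurableEquiv.prodAssoc ((μ.prod μ).prod μ) (μ.prod (μ.prod μ))))).comp
    (((measurePreserving_shear μ).prod (MeasurePreserving.id μ)).comp (measurePreserving_equiv12 μ))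

/-- The coproduct `Δ̂ : W*(G) → W*(G × G) = W*(G) ⊗ W*(G)`: the normal unital *-homomorphism with
`Δ̂(λ_g) = λ_g ⊗ λ_g` (`coproduct_leftReg`). It is implemented by the unitary
`(V f)(x, y) = f(x, x⁻¹ y)`, as `Δ̂(x) = V (x ⊗ 1) V*`. -/
def coproduct : W μ →⋆ₐ[ℂ] W (μ.prod μ) :=
  implementVN (shear G) (measurePreserving_shear μ) (fun s => (s, s)) fun s z => by
    ext <;> simp [mul_assoc]

/-- `F ↦ F ⊗ 1`, from `W*(G × G)` to `W*(G × G × G)`; see `tensorOne_apply`. -/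
def tensorOne :
    W (μ.prod μ) →⋆ₐ[ℂ] W (μ.prod (μ.prod μ)) :=
  implementVN (equiv12 G) (measurePreserving_equiv12 μ) (fun s => (s.1, s.2, 1)) fun s z => by
    ext <;> simp

/-- `F ↦ 1 ⊗ F`, from `W*(G × G)` to `W*(G × G × G)`; see `oneTensor_apply`. -/
def oneTensor :
    W (μ.prod μ) →⋆ₐ[ℂ] W (μ.prod (μ.prod μ)) :=
  implementVN (equiv23 G) (measurePreserving_equiv23 μ) (fun s => (1, s.1, s.2)) fun s z => by
    ext <;> simp

/-- `Id ⊗ Δ̂`, from `W*(G × G) = W*(G) ⊗ W*(G)` to `W*(G × G × G) = W*(G) ⊗ W*(G) ⊗ W*(G)`,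
the normal *-homomorphism with `x ⊗ y ↦ x ⊗ Δ̂(y)` (`idTensorCoproduct_opTensor`). -/
def idTensorCoproduct :
    W (μ.prod μ) →⋆ₐ[ℂ] W (μ.prod (μ.prod μ)) :=
  implementVN (equivIdΔ G) (measurePreserving_equivIdΔ μ) (fun s => (s.1, s.2, s.2)) fun s z => by
    ext <;> simp [mul_assoc]

/-- `Δ̂ ⊗ Id`, from `W*(G × G) = W*(G) ⊗ W*(G)` to `W*(G × G × G) = W*(G) ⊗ W*(G) ⊗ W*(G)`,
the normal *-homomorphism with `x ⊗ y ↦ Δ̂(x) ⊗ y` (`coproductTensorId_opTensor`). -/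
def coproductTensorId :
    W (μ.prod μ) →⋆ₐ[ℂ] W (μ.prod (μ.prod μ)) :=
  implementVN (equivΔId G) (measurePreserving_equivΔId μ) (fun s => (s.1, s.1, s.2)) fun s z => by
    ext <;> simp [mul_assoc]

theorem coproduct_leftReg (g : G) :
    coproduct μ ⟨leftReg μ g, leftReg_mem μ g⟩ = ⟨leftReg (μ.prod μ) (g, g), leftReg_mem _ _⟩ :=
  Subtype.ext <| implement_leftReg _ _ _ _ fun z => by ext <;> simp [mul_assoc]

theorem pull_equiv23 (w : L2 (μ.prod μ)) (k : L2 μ) :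
    pull (equiv23 G) (measurePreserving_equiv23 μ) (tmulFun (μ.prod μ) μ w k) =
      tmulFun μ (μ.prod μ) k w := by
  apply Lp.ext
  filter_upwards [coeFn_pull (equiv23 G) (measurePreserving_equiv23 μ)
      (tmulFun (μ.prod μ) μ w k), coeFn_tmulFun μ (μ.prod μ) k w,
    (measurePreserving_equiv23 μ).quasiMeasurePreserving.ae (coeFn_tmulFun (μ.prod μ) μ w k)]
    with z h1 h2 h3
  rw [h1, h2, h3]
  exact mul_comm _ _

theorem pull_equivIdΔ (f h k : L2 μ) :
    pull (equivIdΔ G) (measurePreserving_equivIdΔ μ) (tmulFun (μ.prod μ) μ (tmulFun μ μ f h) k) =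
      tmulFun μ (μ.prod μ) f (pull (shear G) (measurePreserving_shear μ) (tmulFun μ μ h k)) := by
  apply Lp.ext
  have hq := (measurePreserving_equivIdΔ μ).quasiMeasurePreserving
  filter_upwards [coeFn_pull (equivIdΔ G) (measurePreserving_equivIdΔ μ)
      (tmulFun (μ.prod μ) μ (tmulFun μ μ f h) k),
    hq.ae (coeFn_tmulFun (μ.prod μ) μ (tmulFun μ μ f h) k),
    hq.ae (ae_fst _ _ (coeFn_tmulFun μ μ f h)),
    coeFn_tmulFun μ (μ.prod μ) f (pull (shear G) (measurePreserving_shear μ) (tmulFun μ μ h k)),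
    ae_snd μ _ (coeFn_pull (shear G) (measurePreserving_shear μ) (tmulFun μ μ h k)),
    ae_snd μ _ ((measurePreserving_shear μ).quasiMeasurePreserving.ae (coeFn_tmulFun μ μ h k))]
    with z h1 h2 h3 h4 h5 h6
  rw [h1, h2, h3, h4, h5, h6]
  simp [mul_assoc]

theorem pull_equivΔId (f h k : L2 μ) :
    pull (equivΔId G) (measurePreserving_equivΔId μ) (tmulFun (μ.prod μ) μ (tmulFun μ μ f h) k) =
      pull (equiv12 G) (measurePreserving_equiv12 μ) (tmulFun (μ.prod μ) μ
        (pull (shear G) (measurePreserving_shear μ) (tmulFun μ μ f k)) h) := by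
  apply Lp.ext
  have hq := (measurePreserving_equivΔId μ).quasiMeasurePreserving
  have hq' := (measurePreserving_equiv12 μ).quasiMeasurePreserving
  filter_upwards [coeFn_pull (equivΔId G) (measurePreserving_equivΔId μ)
      (tmulFun (μ.prod μ) μ (tmulFun μ μ f h) k),
    hq.ae (coeFn_tmulFun (μ.prod μ) μ (tmulFun μ μ f h) k),
    hq.ae (ae_fst _ _ (coeFn_tmulFun μ μ f h)),
    coeFn_pull (equiv12 G) (measurePreserving_equiv12 μ) (tmulFun (μ.prod μ) μ
        (pull (shear G) (measurePreserving_shear μ) (tmulFun μ μ f k)) h),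
    hq'.ae (coeFn_tmulFun (μ.prod μ) μ
        (pull (shear G) (measurePreserving_shear μ) (tmulFun μ μ f k)) h),
    hq'.ae (ae_fst _ _ (coeFn_pull (shear G) (measurePreserving_shear μ) (tmulFun μ μ f k))),
    hq'.ae (ae_fst _ _ ((measurePreserving_shear μ).quasiMeasurePreserving.ae
      (coeFn_tmulFun μ μ f k)))]
    with z h1 h2 h3 h4 h5 h6 h7
  rw [h1, h2, h3, h4, h5, h6, h7]
  simp only [equivΔId_apply, equiv12_apply, shear_apply]
  ring

/-- `1 ⊗ F` is the operator tensor product. -/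
theorem oneTensor_apply (F : W (μ.prod μ)) :
    (oneTensor μ F : L2 (μ.prod (μ.prod μ)) →L[ℂ] _) = opTensor 1 F.1 := by
  refine ext_pull (equiv23 G) (measurePreserving_equiv23 μ) fun w k => ?_
  refine (implement_pull _ _ _ _).trans ?_
  rw [opTensor_tmulFun, pull_equiv23, pull_equiv23, opTensor_tmulFun]
  rfl

/-- `F ⊗ 1` is the operator tensor product, up to the identification
`(G × G) × G = G × (G × G)`. -/
theorem tensorOne_apply (F : W (μ.prod μ)) :
    (tensorOne μ F : L2 (μ.prod (μ.prod μ)) →L[ℂ] _) =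
      (pull (equiv12 G) (measurePreserving_equiv12 μ)).conjStarAlgEquiv (opTensor F.1 1) :=
  rfl

/-- `(Id ⊗ Δ̂)(x ⊗ y) = x ⊗ Δ̂(y)`. -/
theorem idTensorCoproduct_opTensor (x y : W μ)
    (hxy : opTensor x.1 y.1 ∈ (groupVN (μ.prod μ)).toStarSubalgebra) :
    (idTensorCoproduct μ ⟨opTensor x.1 y.1, hxy⟩ : L2 (μ.prod (μ.prod μ)) →L[ℂ] _) =
      opTensor x.1 (coproduct μ y).1 := by
  refine ext_pull (equivIdΔ G) (measurePreserving_equivIdΔ μ) fun w k => ?_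
  rw [← slice_apply, ← ContinuousLinearMap.comp_apply, ← ContinuousLinearMap.comp_apply]
  refine congrArg (fun L : L2 (μ.prod μ) →L[ℂ] L2 (μ.prod (μ.prod μ)) => L w) (ext_tmulFun fun f h => ?_)
  rw [ContinuousLinearMap.comp_apply, ContinuousLinearMap.comp_apply, slice_apply]
  refine (implement_pull _ _ _ _).trans ?_
  rw [opTensor_tmulFun]
  change pull (equivIdΔ G) _ (tmulFun _ _ (opTensor x.1 y.1 (tmulFun μ μ f h)) k) = _
  rw [opTensor_tmulFun, pull_equivIdΔ, pull_equivIdΔ, opTensor_tmulFun]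
  congr 1
  refine Eq.symm ((implement_pull _ _ _ _).trans ?_)
  rw [opTensor_tmulFun]
  rfl

/-- `(Δ̂ ⊗ Id)(x ⊗ y) = Δ̂(x) ⊗ y`. -/
theorem coproductTensorId_opTensor (x y : W μ)
    (hxy : opTensor x.1 y.1 ∈ (groupVN (μ.prod μ)).toStarSubalgebra) :
    (coproductTensorId μ ⟨opTensor x.1 y.1, hxy⟩ : L2 (μ.prod (μ.prod μ)) →L[ℂ] _) =
      (pull (equiv12 G) (measurePreserving_equiv12 μ)).conjStarAlgEquiv
        (opTensor (coproduct μ x).1 y.1) := by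
  refine ext_pull (equivΔId G) (measurePreserving_equivΔId μ) fun w k => ?_
  rw [← slice_apply, ← ContinuousLinearMap.comp_apply, ← ContinuousLinearMap.comp_apply]
  refine congrArg (fun L : L2 (μ.prod μ) →L[ℂ] L2 (μ.prod (μ.prod μ)) => L w) (ext_tmulFun fun f h => ?_)
  rw [ContinuousLinearMap.comp_apply, ContinuousLinearMap.comp_apply, slice_apply]
  refine (implement_pull _ _ _ _).trans ?_
  rw [opTensor_tmulFun]
  change pull (equivΔId G) _ (tmulFun _ _ (opTensor x.1 y.1 (tmulFun μ μ f h)) k) = _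
  rw [opTensor_tmulFun, pull_equivΔId, pull_equivΔId,
    LinearIsometryEquiv.conjStarAlgEquiv_apply_apply, LinearIsometryEquiv.symm_apply_apply,
    opTensor_tmulFun]
  congr 2
  refine Eq.symm ((implement_pull _ _ _ _).trans ?_)
  rw [opTensor_tmulFun]
  rfl

end Coproduct

section Bruhat

variable {α : Type*} [MeasurableSpace α] [TopologicalSpace α] {μ : Measure α}

/-- The class `f ∈ L²(α)` of a Bruhat test function on a totally disconnected space `α`, i.e. of
a locally constant function with compact support. -/
def IsBruhat (f : L2 μ) : Prop :=
  ∃ f₀ : α → ℂ, IsLocallyConstant f₀ ∧ HasCompactSupport f₀ ∧ f =ᵐ[μ] f₀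

end Bruhat

section LocalField

open ValuativeRel
open scoped Pointwise

set_option linter.unusedSectionVars false

variable {K : Type*} [Field K] [ValuativeRel K] [TopologicalSpace K] [IsNonarchimedeanLocalField K]

theorem isCompact_integers : IsCompact (𝒪[K] : Set K) :=
  IsNonarchimedeanLocalField.isCompact_closedBall K 1

theorem isOpen_integers : IsOpen (𝒪[K] : Set K) :=
  (Valuation.isOpen_integer : IsOpen ((valuation K).integer : Set K))

instance secondCountable_localField : SecondCountableTopology K := by
  let := IsTopologicalAddGroup.rightUniformSpace K
  have := isUniformAddGroup_of_addCommGroup (G := K)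
  let : (Valued.v (R := K)).RankOne :=
  { hom' := IsRankLeOne.nonempty.some.emb (R := K).comp MonoidWithZeroHom.ValueGroup₀.embedding
    strictMono' := IsRankLeOne.nonempty.some.strictMono.comp
        MonoidWithZeroHom.ValueGroup₀.embedding_strictMono }
  open scoped Valued in
  have : ProperSpace K := .of_nontriviallyNormedField_of_weaklyLocallyCompactSpace K
  open scoped Valued in
  exact inferInstance

instance t2_localField : T2Space K := by
  let := IsTopologicalAddGroup.rightUniformSpace K
  have := isUniformAddGroup_of_addCommGroup (G := K)
  let : (Valued.v (R := K)).RankOne :=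
  { hom' := IsRankLeOne.nonempty.some.emb (R := K).comp MonoidWithZeroHom.ValueGroup₀.embedding
    strictMono' := IsRankLeOne.nonempty.some.strictMono.comp
        MonoidWithZeroHom.ValueGroup₀.embedding_strictMono }
  open scoped Valued in
  exact inferInstance

section Haar

variable (K) [MeasurableSpace K] [BorelSpace K]

/-- The Haar measure `dt` of `K`, normalized by `Vol(𝒪) = 1`. -/
def haarK : Measure K :=
  Measure.addHaarMeasure ⟨⟨𝒪[K], isCompact_integers⟩,
    ⟨0, by
      change (0 : K) ∈ interior (𝒪[K] : Set K)
      rw [isOpen_integers.interior_eq]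
      exact zero_mem 𝒪[K]⟩⟩

instance : (haarK K).IsAddHaarMeasure := inferInstanceAs (Measure.addHaarMeasure _).IsAddHaarMeasure

instance : (haarK K).Regular := inferInstanceAs (Measure.addHaarMeasure _).Regular

end Haar

/-- The group of higher principal units `U_n = 1 + ϖⁿ 𝒪` (inside `𝒪ˣ`). -/
def U (ϖ : 𝒪[K]) (n : ℕ) : Subgroup 𝒪[K]ˣ where
  carrier := {u | ϖ ^ n ∣ (u : 𝒪[K]) - 1}
  one_mem' := by simp
  mul_mem' {u v} hu hv := by
    have : ((u * v : 𝒪[K]ˣ) : 𝒪[K]) - 1 = u * ((v : 𝒪[K]) - 1) + ((u : 𝒪[K]) - 1) := by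
      push_cast; ring
    rw [Set.mem_ofPred_eq, this]
    exact dvd_add (Dvd.dvd.mul_left hv _) hu
  inv_mem' {u} hu := by
    have : ((u⁻¹ : 𝒪[K]ˣ) : 𝒪[K]) - 1 = -((u⁻¹ : 𝒪[K]ˣ) : 𝒪[K]) * ((u : 𝒪[K]) - 1) := by
      rw [mul_sub, neg_mul, Units.inv_mul]; ring
    rw [Set.mem_ofPred_eq, this]
    exact Dvd.dvd.mul_left hu _

/-- The fractional ideal `ϖ⁻ⁿ 𝒪 = {t | ϖⁿ t ∈ 𝒪}`. -/
def fracIdeal (ϖ : 𝒪[K]) (n : ℕ) : AddSubgroup K where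
  carrier := {t | (ϖ : K) ^ n * t ∈ 𝒪[K]}
  zero_mem' := by simp
  add_mem' {s t} hs ht := by
    rw [Set.mem_ofPred_eq, mul_add]; exact add_mem hs ht
  neg_mem' {s} hs := by
    rw [Set.mem_ofPred_eq, mul_neg]; exact neg_mem hs

variable {ϖ : 𝒪[K]} {n : ℕ}

/-- The inclusion `U_n → K`. -/
def incl (a : U ϖ n) : K := ((a : 𝒪[K]ˣ) : 𝒪[K])

@[simp] theorem incl_one : incl (1 : U ϖ n) = 1 := rfl

@[simp] theorem incl_mul (a b : U ϖ n) : incl (a * b) = incl a * incl b := rfl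

theorem incl_mem (a : U ϖ n) : incl a ∈ 𝒪[K] := ((a : 𝒪[K]ˣ) : 𝒪[K]).2

theorem incl_mul_inv (a : U ϖ n) : incl a * incl a⁻¹ = 1 := by
  rw [← incl_mul, mul_inv_cancel, incl_one]

theorem incl_ne_zero (a : U ϖ n) : incl a ≠ 0 := left_ne_zero_of_mul_eq_one (incl_mul_inv a)

@[simp] theorem incl_inv (a : U ϖ n) : incl a⁻¹ = (incl a)⁻¹ :=
  eq_inv_of_mul_eq_one_right (incl_mul_inv a)

theorem incl_injective : Function.Injective (incl (ϖ := ϖ) (n := n)) := fun _ _ h =>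
  Subtype.ext (Units.ext (Subtype.ext h))

theorem smul_mem_fracIdeal (a : U ϖ n) {t : K} (ht : t ∈ fracIdeal ϖ n) :
    incl a * t ∈ fracIdeal ϖ n := by
  change (ϖ : K) ^ n * (incl a * t) ∈ 𝒪[K]
  rw [mul_left_comm]
  exact mul_mem (incl_mem a) ht

variable (ϖ n) in
/-- The discrete abelian group `Γ_n = K / ϖ⁻ⁿ 𝒪`. -/
def Γ : Type _ := K ⧸ fracIdeal ϖ n

instance : AddCommGroup (Γ ϖ n) := inferInstanceAs (AddCommGroup (K ⧸ fracIdeal ϖ n))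
instance : TopologicalSpace (Γ ϖ n) := ⊥
instance : DiscreteTopology (Γ ϖ n) := ⟨rfl⟩
instance : MeasurableSpace (Γ ϖ n) := ⊤
instance : DiscreteMeasurableSpace (Γ ϖ n) := ⟨fun _ => trivial⟩

variable (ϖ n) in
/-- The class `[t] = t + ϖ⁻ⁿ 𝒪`. -/
def Γ.mk : K →+ Γ ϖ n := QuotientAddGroup.mk' (fracIdeal ϖ n)

theorem Γ.mk_surjective : Function.Surjective (Γ.mk ϖ n) := QuotientAddGroup.mk'_surjective _

theorem Γ.mk_eq_mk {s t : K} : Γ.mk ϖ n s = Γ.mk ϖ n t ↔ s - t ∈ fracIdeal ϖ n :=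
  QuotientAddGroup.eq_iff_sub_mem

/-- A representative of a class in `Γ_n`. -/
def Γ.rep (s : Γ ϖ n) : K := (Γ.mk_surjective s).choose

@[simp] theorem Γ.mk_rep (s : Γ ϖ n) : Γ.mk ϖ n s.rep = s := (Γ.mk_surjective s).choose_spec

/-- The action of `U_n` on `Γ_n` by dilations, `a • [t] = [a t]`. -/
instance : DistribMulAction (U ϖ n) (Γ ϖ n) where
  smul a := QuotientAddGroup.map (fracIdeal ϖ n) (fracIdeal ϖ n) (AddMonoidHom.mulLeft (incl a))
    fun _ ht => smul_mem_fracIdeal a ht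
  one_smul s := by
    obtain ⟨t, rfl⟩ := Γ.mk_surjective s
    exact congrArg (Γ.mk ϖ n) (one_mul t)
  mul_smul a b s := by
    obtain ⟨t, rfl⟩ := Γ.mk_surjective s
    exact congrArg (Γ.mk ϖ n) (mul_assoc (incl a) (incl b) t)
  smul_zero a := map_zero (QuotientAddGroup.map (fracIdeal ϖ n) (fracIdeal ϖ n)
    (AddMonoidHom.mulLeft (incl a)) fun _ ht => smul_mem_fracIdeal a ht)
  smul_add a s t := map_add (QuotientAddGroup.map (fracIdeal ϖ n) (fracIdeal ϖ n)
    (AddMonoidHom.mulLeft (incl a)) fun _ ht => smul_mem_fracIdeal a ht) s t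

@[simp] theorem smul_mk (a : U ϖ n) (t : K) : a • Γ.mk ϖ n t = Γ.mk ϖ n (incl a * t) := rfl

theorem isOpen_fracIdeal : IsOpen (fracIdeal ϖ n : Set K) :=
  isOpen_integers.preimage (continuous_const_mul ((ϖ : K) ^ n))

theorem continuous_mk : Continuous (Γ.mk ϖ n) := by
  refine continuous_discrete_rng.2 fun s => ?_
  obtain ⟨t, rfl⟩ := Γ.mk_surjective s
  have : Γ.mk ϖ n ⁻¹' {Γ.mk ϖ n t} = (fun s => s - t) ⁻¹' (fracIdeal ϖ n : Set K) := by
    ext s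
    simp [Γ.mk_eq_mk]
  rw [this]
  exact isOpen_fracIdeal.preimage (continuous_id.sub continuous_const)

instance : Countable (Γ ϖ n) := by
  obtain ⟨S, hS, hd⟩ := TopologicalSpace.exists_countable_dense K
  have : Γ.mk ϖ n '' S = Set.univ :=
    dense_discrete.1 (Γ.mk_surjective.denseRange.dense_image continuous_mk hd)
  exact Set.countable_univ_iff.1 (this ▸ hS.image _)

variable (ϖ n) in
/-- The group `X_n = G_n / H_n`, of all pairs `(a, [t])` with `a ∈ U_n` and `[t] ∈ Γ_n`. -/
def X : Type _ := U ϖ n × Γ ϖ n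

/-- The element `(a, [t])` of `X_n`. -/
def X.mk (a : U ϖ n) (t : Γ ϖ n) : X ϖ n := (a, t)

/-- The group law `(a, [t]) (a', [t']) = (a a', [a'⁻¹ t + t'])`. -/
instance : Group (X ϖ n) where
  mul x y := (x.1 * y.1, y.1⁻¹ • x.2 + y.2)
  one := (1, 0)
  inv x := (x.1⁻¹, -(x.1 • x.2))
  mul_assoc x y z := Prod.ext (mul_assoc x.1 y.1 z.1) (by
    change z.1⁻¹ • (y.1⁻¹ • x.2 + y.2) + z.2 = (y.1 * z.1)⁻¹ • x.2 + (z.1⁻¹ • y.2 + z.2)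
    rw [smul_add, smul_smul, mul_inv_rev, add_assoc])
  one_mul x := Prod.ext (one_mul x.1) (by
    change x.1⁻¹ • (0 : Γ ϖ n) + x.2 = x.2
    rw [smul_zero, zero_add])
  mul_one x := Prod.ext (mul_one x.1) (by
    change (1 : U ϖ n)⁻¹ • x.2 + 0 = x.2
    rw [inv_one, one_smul, add_zero])
  inv_mul_cancel x := Prod.ext (inv_mul_cancel x.1) (by
    change x.1⁻¹ • -(x.1 • x.2) + x.2 = 0
    rw [smul_neg, inv_smul_smul, neg_add_cancel])

theorem X.mul_def (a a' : U ϖ n) (t t' : K) :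
    X.mk a (Γ.mk ϖ n t) * X.mk a' (Γ.mk ϖ n t') =
      X.mk (a * a') (Γ.mk ϖ n ((incl a')⁻¹ * t + t')) := by
  rw [map_add, ← incl_inv, ← smul_mk]
  rfl

instance : TopologicalSpace (X ϖ n) := inferInstanceAs (TopologicalSpace (U ϖ n × Γ ϖ n))

/-- `φ(a) = a - a⁻¹`. -/
def phi (a : U ϖ n) : K := incl a - (incl a)⁻¹

/-- The function `Ψ(φ(a₁) t₂ - φ(a₂) t₁)` on `X_n × X_n`. -/
def kernel (Ψ : AddChar K Circle) (z : X ϖ n × X ϖ n) : ℂ :=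
  Ψ (phi z.1.1 * z.2.2.rep - phi z.2.1 * z.1.2.rep)

theorem phi_mul_mem (a : U ϖ n) {t : K} (ht : t ∈ fracIdeal ϖ n) : phi a * t ∈ 𝒪[K] := by
  have h : ∀ b : U ϖ n, (incl b - 1) * t ∈ 𝒪[K] := by
    intro b
    obtain ⟨c, hc⟩ := b.2
    have hc' : incl b - 1 = (ϖ : K) ^ n * c := by
      have := congrArg (fun x : 𝒪[K] => (x : K)) hc
      simpa [incl] using this
    rw [hc', mul_right_comm]
    exact mul_mem ht c.2
  have : phi a * t = (incl a - 1) * t - (incl a⁻¹ - 1) * t := by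
    rw [phi, incl_inv]; ring
  rw [this]
  exact sub_mem (h a) (h a⁻¹)

/-- `kernel` does not depend on the choice of representatives. -/
theorem kernel_mk (Ψ : AddChar K Circle) (hΨ : ∀ x ∈ 𝒪[K], Ψ x = 1) (a₁ a₂ : U ϖ n) (t₁ t₂ : K) :
    kernel Ψ (X.mk a₁ (Γ.mk ϖ n t₁), X.mk a₂ (Γ.mk ϖ n t₂)) =
      Ψ (phi a₁ * t₂ - phi a₂ * t₁) := by
  have h1 : (Γ.mk ϖ n t₁).rep - t₁ ∈ fracIdeal ϖ n := Γ.mk_eq_mk.1 (Γ.mk_rep _)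
  have h2 : (Γ.mk ϖ n t₂).rep - t₂ ∈ fracIdeal ϖ n := Γ.mk_eq_mk.1 (Γ.mk_rep _)
  have h3 := hΨ _ (sub_mem (phi_mul_mem a₁ h2) (phi_mul_mem a₂ h1))
  have h4 : phi a₁ * (Γ.mk ϖ n t₂).rep - phi a₂ * (Γ.mk ϖ n t₁).rep =
      (phi a₁ * ((Γ.mk ϖ n t₂).rep - t₂) - phi a₂ * ((Γ.mk ϖ n t₁).rep - t₁)) +
        (phi a₁ * t₂ - phi a₂ * t₁) := by ring
  change ((Ψ (phi a₁ * (Γ.mk ϖ n t₂).rep - phi a₂ * (Γ.mk ϖ n t₁).rep) : Circle) : ℂ) = _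
  rw [h4, AddChar.map_add_eq_mul, h3, one_mul]

section Measure

variable [MeasurableSpace K] [BorelSpace K]

instance : MeasurableSpace (X ϖ n) := inferInstanceAs (MeasurableSpace (U ϖ n × Γ ϖ n))

theorem measurable_incl : Measurable (incl (ϖ := ϖ) (n := n)) :=
  measurable_subtype_coe.comp ((comap_measurable _).comp measurable_subtype_coe)

theorem measurable_of_incl {α : Type*} [MeasurableSpace α] {f : α → U ϖ n}
    (hf : Measurable fun x => incl (f x)) : Measurable f :=
  Measurable.subtype_mk (measurable_comap_iff.2 (Measurable.subtype_mk hf))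

theorem range_incl : Set.range (incl (ϖ := ϖ) (n := n)) =
    ((𝒪[K] : Set K) ∩ {x | x⁻¹ ∈ 𝒪[K]} ∩ {0}ᶜ) ∩ (fun y => 1 + (ϖ : K) ^ n * y) '' 𝒪[K] := by
  ext x
  constructor
  · rintro ⟨a, rfl⟩
    refine ⟨⟨⟨incl_mem a, ?_⟩, incl_ne_zero a⟩, ?_⟩
    · change (incl a)⁻¹ ∈ 𝒪[K]
      rw [← incl_inv]
      exact incl_mem _
    · obtain ⟨c, hc⟩ := a.2
      refine ⟨c, c.2, ?_⟩
      have := congrArg (fun x : 𝒪[K] => (x : K)) hc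
      have h2 : incl a - 1 = (ϖ : K) ^ n * c := by simpa [incl] using this
      change 1 + (ϖ : K) ^ n * c = incl a
      rw [← h2]
      ring
  · rintro ⟨⟨⟨h1, h2⟩, h3⟩, y, hy, hxy⟩
    have h4 : x * x⁻¹ = 1 := mul_inv_cancel₀ h3
    refine ⟨⟨⟨⟨x, h1⟩, ⟨x⁻¹, h2⟩, Subtype.ext h4, Subtype.ext (by rw [mul_comm] at h4; exact h4)⟩,
      ⟨⟨y, hy⟩, Subtype.ext ?_⟩⟩, rfl⟩
    change x - 1 = (ϖ : K) ^ n * y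
    rw [← hxy]
    ring

theorem measurableEmbedding_incl : MeasurableEmbedding (incl (ϖ := ϖ) (n := n)) where
  injective := incl_injective
  measurable := measurable_incl
  measurableSet_image' s hs := by
    have hr : MeasurableSet (Set.range (incl (ϖ := ϖ) (n := n))) := by
      rw [range_incl]
      have hO : MeasurableSet (𝒪[K] : Set K) := isOpen_integers.measurableSet
      refine ((hO.inter (measurable_inv hO)).inter (measurableSet_singleton 0).compl).inter ?_
      exact (isCompact_integers.image
        (continuous_const.add (continuous_const_mul ((ϖ : K) ^ n)))).isClosed.measurableSet
    obtain ⟨s1, ⟨s2, ⟨s3, h3, rfl⟩, rfl⟩, rfl⟩ := hs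
    have : incl '' (Subtype.val ⁻¹' (Units.val ⁻¹' (Subtype.val ⁻¹' s3)) : Set (U ϖ n)) =
        s3 ∩ Set.range (incl (ϖ := ϖ) (n := n)) := by
      rw [← Set.image_preimage_eq_inter_range]
      rfl
    rw [this]
    exact h3.inter hr

instance : MeasurableMul₂ (U ϖ n) :=
  ⟨measurable_of_incl ((measurable_incl.comp measurable_fst).mul (measurable_incl.comp measurable_snd))⟩

instance : MeasurableInv (U ϖ n) :=
  ⟨measurable_of_incl (by
    simp only [incl_inv]
    exact measurable_incl.inv)⟩

theorem measurable_smul : Measurable fun p : U ϖ n × Γ ϖ n => p.1 • p.2 := by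
  refine measurable_from_prod_countable_left fun s => ?_
  obtain ⟨t, rfl⟩ := Γ.mk_surjective s
  exact (continuous_mk (ϖ := ϖ) (n := n)).measurable.comp (measurable_incl.mul_const t)

variable (ϖ n) in
/-- The Haar measure `da` of `U_n`: the restriction to `U_n ⊆ K` of the Haar measure of `K`. -/
def haarU : Measure (U ϖ n) := (haarK K).comap incl

variable (ϖ n) in
/-- The Haar measure of `X_n`: the product of the Haar measure of `U_n` by the counting measure
on `Γ_n`. -/
def haarX : Measure (X ϖ n) := (haarU ϖ n).prod (Measure.count : Measure (Γ ϖ n))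

instance : IsFiniteMeasure (haarU ϖ n) := ⟨by
  rw [haarU, measurableEmbedding_incl.comap_apply]
  refine lt_of_le_of_lt (measure_mono (t := (𝒪[K] : Set K)) ?_) ?_
  · rintro _ ⟨a, -, rfl⟩
    exact incl_mem a
  · exact isCompact_integers.measure_lt_top⟩

theorem haarK_mul_image (a : U ϖ n) (s : Set K) : haarK K ((fun x => incl a * x) '' s) = haarK K s := by
  let g : Kˣ := Units.mk0 (incl a) (incl_ne_zero a)
  have hg : ∀ s : Set K, g • s = (fun x => incl a * x) '' s := fun s => rfl
  have hO : g • (𝒪[K] : Set K) = 𝒪[K] := by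
    rw [hg]
    ext x
    constructor
    · rintro ⟨y, hy, rfl⟩
      exact mul_mem (incl_mem a) hy
    · intro hx
      refine ⟨incl a⁻¹ * x, mul_mem (incl_mem _) hx, ?_⟩
      change incl a * (incl a⁻¹ * x) = x
      rw [← mul_assoc, incl_mul_inv, one_mul]
  have h1 : haarK K (𝒪[K] : Set K) = 1 := Measure.addHaarMeasure_self
  have hc : distribHaarChar K g = 1 := by
    refine distribHaarChar_eq_of_measure_smul_eq_mul (μ := haarK K) (s := (𝒪[K] : Set K)) ?_ ?_ ?_
    · rw [h1]; exact one_ne_zero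
    · rw [h1]; exact ENNReal.one_ne_top
    · rw [hO]; simp
  rw [← hg, ← distribHaarChar_mul, hc]
  simp

instance : (haarU ϖ n).IsMulLeftInvariant := ⟨fun a => by
  ext s hs
  rw [Measure.map_apply (measurable_const_mul a) hs, haarU, measurableEmbedding_incl.comap_apply,
    measurableEmbedding_incl.comap_apply, ← haarK_mul_image a, Set.image_image]
  congr 1
  ext x
  constructor
  · rintro ⟨b, hb, rfl⟩
    exact ⟨a * b, hb, rfl⟩
  · rintro ⟨b, hb, rfl⟩
    refine ⟨a⁻¹ * b, by simpa using hb, ?_⟩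
    change incl a * incl (a⁻¹ * b) = incl b
    rw [← incl_mul, mul_inv_cancel_left]⟩

instance : SigmaFinite (haarX ϖ n) :=
  inferInstanceAs (SigmaFinite ((haarU ϖ n).prod (Measure.count : Measure (Γ ϖ n))))

instance : MeasurableMul₂ (X ϖ n) := ⟨by
  have h1 : Measurable fun p : (U ϖ n × Γ ϖ n) × (U ϖ n × Γ ϖ n) => p.1.1 * p.2.1 :=
    measurable_fst.fst.mul measurable_snd.fst
  have h2 : Measurable fun p : (U ϖ n × Γ ϖ n) × (U ϖ n × Γ ϖ n) => p.2.1⁻¹ • p.1.2 + p.2.2 :=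
    (measurable_smul.comp (measurable_snd.fst.inv.prodMk measurable_fst.snd)).add measurable_snd.snd
  exact h1.prodMk h2⟩

instance : MeasurableInv (X ϖ n) := ⟨by
  have h1 : Measurable fun p : U ϖ n × Γ ϖ n => (p.1⁻¹, -(p.1 • p.2)) :=
    measurable_fst.inv.prodMk measurable_smul.neg
  exact h1⟩

instance : (haarX ϖ n).IsMulLeftInvariant := ⟨fun x => by
  refine MeasurePreserving.map_eq (μa := haarX ϖ n) (μb := haarX ϖ n) ?_
  exact MeasurePreserving.skew_product (measurePreserving_mul_left (haarU ϖ n) x.1)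
    (g := fun (a : U ϖ n) (s : Γ ϖ n) => a⁻¹ • x.2 + s)
    ((measurable_smul.comp (measurable_fst.inv.prodMk measurable_const)).add measurable_snd)
    (.of_forall fun a => (measurePreserving_add_left (Measure.count : Measure (Γ ϖ n)) _).map_eq)⟩

/-- The convolution operator
`F = q²ⁿ ∫ Ψ(φ(a₁) t₂ - φ(a₂) t₁) λ_{(a₁,[t₁])⁻¹} ⊗ λ_{(a₂,[t₂])⁻¹} d(a₁,[t₁]) d(a₂,[t₂])`
on `X_n × X_n`, given as a quadratic form on Bruhat test functions: a bounded operator `T` on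
`L²(X_n × X_n)` is this operator if it has the matrix coefficients
`⟪h, T f⟫ = q²ⁿ ∫ Ψ(φ(a₁) t₂ - φ(a₂) t₁) ⟪h, λ_{(g₁,g₂)⁻¹} f⟫ dg₁ dg₂` (absolutely convergent
integrals) for all test functions `f, h`. Here `q` is the cardinality of the residue field. -/
def IsTwistOperator (Ψ : AddChar K Circle)
    (T : L2 ((haarX ϖ n).prod (haarX ϖ n)) →L[ℂ] L2 ((haarX ϖ n).prod (haarX ϖ n))) : Prop :=
  ∀ f h : L2 ((haarX ϖ n).prod (haarX ϖ n)), IsBruhat f → IsBruhat h →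
    Integrable (fun z : X ϖ n × X ϖ n =>
      kernel Ψ z * ⟪h, leftReg ((haarX ϖ n).prod (haarX ϖ n)) z⁻¹ f⟫_ℂ)
      ((haarX ϖ n).prod (haarX ϖ n)) ∧
    ⟪h, T f⟫_ℂ = (Nat.card 𝓀[K] : ℂ) ^ (2 * n) * ∫ z : X ϖ n × X ϖ n,
      kernel Ψ z * ⟪h, leftReg ((haarX ϖ n).prod (haarX ϖ n)) z⁻¹ f⟫_ℂ
      ∂((haarX ϖ n).prod (haarX ϖ n))

end Measure

end LocalField

end

end DualCocycle

/-!
The proof expresses everything in terms of one family of vectors of `L²(X_n)`. For `b ∈ U_n`,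
`η ∈ ϖⁿ 𝒪` and a level `m ≥ n`, the *wave* `⟨b, η⟩` is the function `(a, [t]) ↦ Ψ(b η t)` supported on
`a ∈ b + ϖᵐ 𝒪`, `t ∈ ϖ⁻ᵐ 𝒪` (`waveFun`). By Fourier inversion the waves are total (`isTotal_waves`),
products of two waves of level `m` span all test functions of level `m` (`mem_span_of_isBruhat`), and
waves of levels `m ≤ m'` have the inner product `gram m m'` or `0`, according as their parameters are
congruent modulo `ϖᵐ` or not (`inner_wave`).

Let `G` be the operator that maps `⟨b₁, φ(α)⟩ ⊗ ⟨b₂, φ(β)⟩` to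
`⟨b₁/β, φ(α) β⟩ ⊗ ⟨α b₂, φ(β)/α⟩` for every level (`IsInverseTwist`). Since `2` is a unit, `φ` is an
isometry of `U_n` onto `ϖⁿ 𝒪` (`phi_sub_mem_iff`, and Hensel's lemma in `exists_phi_eq`), and this
substitution is a bijection of the parameters that preserves and reflects congruences
(`twist_congr_iff`, `twist_surjective`). Hence it preserves the Gram matrix of a total family, and `G`
exists and is unitary (`exists_inverseTwist`). The operator `F` is `G⁻¹`:

* On products of waves, the matrix coefficients of the regular representation are products of waves
  on the group, and the kernel `Ψ(φ(a₁) t₂ - φ(a₂) t₁)` only shifts their frequencies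
  (`kernel_mul_waveFun`). A wave integrates to the volume `q⁻ⁿ` of its support or to `0`, which
  explains the factor `q²ⁿ`. Comparison with `G` gives the formula for test functions
  (`isTwistOperator_twistOp`), and test functions are dense, so that `F` is unique.
* The functions of level `m` form a finite-dimensional space, which is preserved by `F`, `F*` and the
  translations by `(a, [t])` with `t ∈ ϖ⁻ᵐ 𝒪`, while the integrand for two vectors of level `m`
  vanishes elsewhere. With the integral restricted to `t₁, t₂ ∈ ϖ⁻ᵐ 𝒪`, the formula thus holds as
  soon as one of the two vectors has level `m` (`inner_twistOp_of_left`,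
  `inner_twistOp_of_right`). So `F` commutes with the commutant of the
  translations, and it lies in the double commutant `W*(X_n × X_n)` (`twistOp_mem_groupVN`).
* The coproduct is implemented by `(x, y) ↦ (x, x⁻¹ y)`, which maps products of waves to products of
  waves (`pull_shear_wave`). Consequently `(Id ⊗ Δ̂)(G)` and `(Δ̂ ⊗ Id)(G)` act on products of three
  waves by the same substitution as `G`, with the frequency `φ(β)` or `φ(α)` replaced by the sum of
  two frequencies. The addition law `φ(αβ) = φ(α) β + φ(β) α⁻¹` (`phi_mul`) evaluates these sums, and
  the two sides of the adjoint of the cocycle relation agree on every product of three waves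
  (`inverseTwist_cocycle`).
-/

namespace DualCocycle

noncomputable section

open ValuativeRel
open scoped Pointwise

set_option linter.unusedSectionVars false

/-! ### Congruences in `𝒪` and the map `φ` -/

section Arithmetic

variable {K : Type*} [Field K] [ValuativeRel K] [TopologicalSpace K] [IsNonarchimedeanLocalField K]
  {ϖ : 𝒪[K]} {n : ℕ}

/-- The ideal `ϖᵐ 𝒪`, as a subgroup of `K`. -/
def primePow (ϖ : 𝒪[K]) (m : ℕ) : AddSubgroup K where
  carrier := {x | ∃ c ∈ 𝒪[K], x = (ϖ : K) ^ m * c}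
  zero_mem' := ⟨0, zero_mem _, by simp⟩
  add_mem' := by
    rintro _ _ ⟨c, hc, rfl⟩ ⟨d, hd, rfl⟩
    exact ⟨c + d, add_mem hc hd, by ring⟩
  neg_mem' := by
    rintro _ ⟨c, hc, rfl⟩
    exact ⟨-c, neg_mem hc, by ring⟩

theorem mul_mem_primePow {m : ℕ} {x c : K} (hx : x ∈ primePow ϖ m) (hc : c ∈ 𝒪[K]) :
    x * c ∈ primePow ϖ m := by
  obtain ⟨d, hd, rfl⟩ := hx
  exact ⟨d * c, mul_mem hd hc, by ring⟩

theorem mem_primePow_of_dvd {m : ℕ} {x y : K} (hx : x ∈ primePow ϖ m) {c : K} (hc : c ∈ 𝒪[K])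
    (h : y = x * c) : y ∈ primePow ϖ m := h ▸ mul_mem_primePow hx hc

theorem primePow_le_integers {m : ℕ} {x : K} (hx : x ∈ primePow ϖ m) : x ∈ 𝒪[K] := by
  obtain ⟨d, hd, rfl⟩ := hx
  exact mul_mem (pow_mem ϖ.2 m) hd

theorem primePow_anti {m k : ℕ} (h : m ≤ k) : primePow ϖ k ≤ primePow ϖ m := by
  rintro _ ⟨d, hd, rfl⟩
  obtain ⟨j, rfl⟩ := Nat.exists_eq_add_of_le h
  exact ⟨(ϖ : K) ^ j * d, mul_mem (pow_mem ϖ.2 j) hd, by ring⟩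

theorem fracIdeal_mono {m k : ℕ} (h : m ≤ k) : fracIdeal ϖ m ≤ fracIdeal ϖ k := by
  intro t ht
  obtain ⟨j, rfl⟩ := Nat.exists_eq_add_of_le h
  change (ϖ : K) ^ (m + j) * t ∈ 𝒪[K]
  rw [pow_add, mul_comm ((ϖ : K) ^ m), mul_assoc]
  exact mul_mem (pow_mem ϖ.2 j) ht

theorem mul_mem_integers {m : ℕ} {x t : K} (hx : x ∈ primePow ϖ m) (ht : t ∈ fracIdeal ϖ m) :
    x * t ∈ 𝒪[K] := by
  obtain ⟨d, hd, rfl⟩ := hx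
  have : (ϖ : K) ^ m * d * t = d * ((ϖ : K) ^ m * t) := by ring
  rw [this]
  exact mul_mem hd ht

theorem mul_mem_fracIdeal {m : ℕ} {c t : K} (hc : c ∈ 𝒪[K]) (ht : t ∈ fracIdeal ϖ m) :
    c * t ∈ fracIdeal ϖ m := by
  change (ϖ : K) ^ m * (c * t) ∈ 𝒪[K]
  rw [mul_left_comm]
  exact mul_mem hc ht

theorem inv_incl_mem (a : U ϖ n) : (incl a)⁻¹ ∈ 𝒪[K] := by
  rw [← incl_inv]
  exact incl_mem _

theorem incl_sub_one_mem (a : U ϖ n) : incl a - 1 ∈ primePow ϖ n := by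
  obtain ⟨c, hc⟩ := a.2
  exact ⟨c, c.2, by simpa [incl] using congrArg (fun x : 𝒪[K] => (x : K)) hc⟩

theorem incl_sub_incl_mem (a b : U ϖ n) : incl a - incl b ∈ primePow ϖ n := by
  simpa using sub_mem (incl_sub_one_mem a) (incl_sub_one_mem b)

theorem phi_mem (a : U ϖ n) : phi a ∈ primePow ϖ n := by
  rw [phi, ← incl_inv]
  exact incl_sub_incl_mem a a⁻¹

theorem phi_inv (a : U ϖ n) : phi a⁻¹ = -phi a := by
  simp [phi]

/-- The addition law of `φ`: if `η₁ = φ(α)` and `η₂ = φ(β)`, then `η₁ β + η₂ α⁻¹ = φ(αβ)`. This is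
what makes the twist a cocycle. -/
theorem phi_mul (a b : U ϖ n) : phi (a * b) = phi a * incl b + phi b * (incl a)⁻¹ := by
  have ha := incl_ne_zero a
  have hb := incl_ne_zero b
  simp only [phi, incl_mul]
  field_simp
  ring

section Uniformizer

variable (hϖ : Irreducible ϖ)
include hϖ

theorem uniformizer_ne_zero : (ϖ : K) ≠ 0 := by
  simpa using hϖ.ne_zero

theorem mem_primePow_iff {m : ℕ} {x : K} : x ∈ primePow ϖ m ↔ ((ϖ : K) ^ m)⁻¹ * x ∈ 𝒪[K] := by
  have h := pow_ne_zero m (uniformizer_ne_zero hϖ)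
  constructor
  · rintro ⟨c, hc, rfl⟩
    rwa [inv_mul_cancel_left₀ h]
  · intro hx
    exact ⟨_, hx, by rw [mul_inv_cancel_left₀ h]⟩

theorem isOpen_primePow (m : ℕ) : IsOpen (primePow ϖ m : Set K) := by
  have : (primePow ϖ m : Set K) = (fun x => ((ϖ : K) ^ m)⁻¹ * x) ⁻¹' (𝒪[K] : Set K) := by
    ext x
    exact mem_primePow_iff hϖ
  rw [this]
  exact isOpen_integers.preimage (continuous_const_mul _)

theorem isUnit_of_sub_mem {u x : 𝒪[K]} (hu : IsUnit u) (hx : (x : K) - u ∈ primePow ϖ 1) :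
    IsUnit x := by
  obtain ⟨c, hc, h⟩ := hx
  have h1 : x = u + ϖ * ⟨c, hc⟩ := by
    apply Subtype.ext
    change (x : K) = u + ϖ * c
    rw [pow_one] at h
    rw [← h]
    ring
  have h2 : u = x + -(ϖ * ⟨c, hc⟩) := by rw [h1]; ring
  rcases IsLocalRing.isUnit_or_isUnit_of_isUnit_add (h2 ▸ hu) with h3 | h3
  · exact h3
  · exact absurd (isUnit_of_mul_isUnit_left ((IsUnit.neg_iff _).1 h3)) hϖ.not_isUnit

theorem inv_mem_of_isUnit {x : 𝒪[K]} (hx : IsUnit x) : (x : K)⁻¹ ∈ 𝒪[K] := by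
  obtain ⟨u, rfl⟩ := hx
  have h : (u : 𝒪[K]) * ((u⁻¹ : 𝒪[K]ˣ) : 𝒪[K]) = 1 := u.mul_inv
  have h3 : ((u : 𝒪[K]) : K)⁻¹ = ((u⁻¹ : 𝒪[K]ˣ) : 𝒪[K]) :=
    inv_eq_of_mul_eq_one_right (congrArg (fun x : 𝒪[K] => (x : K)) h)
  rw [h3]
  exact ((u⁻¹ : 𝒪[K]ˣ) : 𝒪[K]).2

theorem exists_incl_eq (hn : 1 ≤ n) {x : K} (hx : x - 1 ∈ primePow ϖ n) :
    ∃ a : U ϖ n, incl a = x := by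
  have hxO : x ∈ 𝒪[K] := by
    simpa using add_mem (primePow_le_integers hx) (one_mem 𝒪[K])
  have hu : IsUnit (⟨x, hxO⟩ : 𝒪[K]) :=
    isUnit_of_sub_mem hϖ isUnit_one (primePow_anti hn (by simpa using hx))
  obtain ⟨u, hu⟩ := hu
  obtain ⟨c, hc, h⟩ := hx
  refine ⟨⟨u, ⟨⟨c, hc⟩, Subtype.ext ?_⟩⟩, ?_⟩
  · rw [hu]
    simpa using h
  · change ((u : 𝒪[K]) : K) = x
    rw [hu]

/-- Every element outside `𝒪` has its inverse in `ϖ𝒪`, so a character that is trivial on `𝒪 y` for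
some `y ∉ 𝒪` is trivial on `ϖ⁻¹ 𝒪`. -/
theorem mem_integers_of_character (Ψ : AddChar K Circle)
    (hΨ : ∃ x : K, (ϖ : K) * x ∈ 𝒪[K] ∧ Ψ x ≠ 1) {y : K} (hy : ∀ c ∈ 𝒪[K], Ψ (c * y) = 1) :
    y ∈ 𝒪[K] := by
  by_contra hyO
  obtain ⟨x, hx, hx1⟩ := hΨ
  have hy0 : y ≠ 0 := fun h => hyO (h ▸ zero_mem _)
  have h0 := uniformizer_ne_zero hϖ
  have hyi : y⁻¹ ∈ 𝒪[K] := by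
    have h1 : ¬ valuation K y ≤ 1 := hyO
    change valuation K y⁻¹ ≤ 1
    rw [map_inv₀]
    exact inv_le_one_of_one_le₀ (not_le.1 h1).le
  have hnu : ¬ IsUnit (⟨y⁻¹, hyi⟩ : 𝒪[K]) := fun h => hyO (by
    simpa using inv_mem_of_isUnit hϖ h)
  have hmem : (⟨y⁻¹, hyi⟩ : 𝒪[K]) ∈ IsLocalRing.maximalIdeal 𝒪[K] := hnu
  rw [hϖ.maximalIdeal_eq, Ideal.mem_span_singleton] at hmem
  obtain ⟨c, hc⟩ := hmem
  have hc' : y⁻¹ = ϖ * c := congrArg (fun x : 𝒪[K] => (x : K)) hc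
  refine hx1 ?_
  have := hy (ϖ * x * c) (mul_mem hx c.2)
  rwa [show ϖ * x * c * y = x by
    rw [mul_right_comm (ϖ : K), ← hc', mul_right_comm, inv_mul_cancel₀ hy0, one_mul]] at this

/-- `ϖᵐ 𝒪` is the annihilator of `ϖ⁻ᵐ 𝒪`. -/
theorem mem_primePow_of_character (Ψ : AddChar K Circle)
    (hΨ : ∃ x : K, (ϖ : K) * x ∈ 𝒪[K] ∧ Ψ x ≠ 1) {m : ℕ} {y : K}
    (hy : ∀ t ∈ fracIdeal ϖ m, Ψ (y * t) = 1) : y ∈ primePow ϖ m := by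
  have h0 := pow_ne_zero m (uniformizer_ne_zero hϖ)
  rw [mem_primePow_iff hϖ]
  refine mem_integers_of_character hϖ Ψ hΨ fun c hc => ?_
  rw [show c * (((ϖ : K) ^ m)⁻¹ * y) = y * (((ϖ : K) ^ m)⁻¹ * c) by ring]
  refine hy _ ?_
  change (ϖ : K) ^ m * (((ϖ : K) ^ m)⁻¹ * c) ∈ 𝒪[K]
  rwa [mul_inv_cancel_left₀ h0]

/-- `ϖ⁻ᵐ 𝒪` is the annihilator of `ϖᵐ 𝒪`. -/
theorem mem_fracIdeal_of_character (Ψ : AddChar K Circle)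
    (hΨ : ∃ x : K, (ϖ : K) * x ∈ 𝒪[K] ∧ Ψ x ≠ 1) {m : ℕ} {y : K}
    (hy : ∀ x ∈ primePow ϖ m, Ψ (x * y) = 1) : y ∈ fracIdeal ϖ m := by
  refine mem_integers_of_character hϖ Ψ hΨ fun c hc => ?_
  rw [show c * ((ϖ : K) ^ m * y) = (ϖ : K) ^ m * c * y by ring]
  exact hy _ ⟨c, hc, rfl⟩

theorem exists_primePow_subset {s : Set K} (hs : s ∈ nhds (0 : K)) :
    ∃ m, (primePow ϖ m : Set K) ⊆ s := by
  obtain ⟨γ, hγ, h⟩ := (IsValuativeTopology.hasBasis_nhds_zero' K).mem_iff.mp hs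
  obtain ⟨r, rfl⟩ := ValuativeRel.valuation_surjective γ
  have hr : r ≠ 0 := by simpa using hγ
  -- an element `r'` of `𝒪` with `v(r') ≤ v(r)`
  obtain ⟨r', hr'0, hr'⟩ : ∃ r' : 𝒪[K], r' ≠ 0 ∧ valuation K (r' : K) ≤ valuation K r := by
    by_cases hrO : r ∈ 𝒪[K]
    · exact ⟨⟨r, hrO⟩, fun h => hr (congrArg Subtype.val h), le_rfl⟩
    · refine ⟨1, one_ne_zero, ?_⟩
      have : ¬ valuation K r ≤ 1 := hrO
      simpa using (not_le.1 this).le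
  obtain ⟨m, u, hu⟩ := IsDiscreteValuationRing.eq_unit_mul_pow_irreducible hr'0 hϖ
  refine ⟨m + 1, fun x hx => h ?_⟩
  obtain ⟨c, hc, rfl⟩ := hx
  have hϖ1 : valuation K (ϖ : K) < 1 := by
    refine lt_of_le_of_ne ϖ.2 fun h => hϖ.not_isUnit ?_
    exact (Valuation.Integers.isUnit_iff_valuation_eq_one
      (Valuation.integer.integers (valuation K)) (x := ϖ)).2 h
  have hc1 : valuation K c ≤ 1 := hc
  have hv : valuation K ((ϖ : K) ^ m) = valuation K (r' : K) := by
    have h1 : (r' : K) = ((u : 𝒪[K]) : K) * (ϖ : K) ^ m := by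
      rw [hu]; push_cast; rfl
    have hu1 : valuation K ((u : 𝒪[K]) : K) = 1 := by
      have := (Valuation.Integers.isUnit_iff_valuation_eq_one
        (Valuation.integer.integers (valuation K)) (x := (u : 𝒪[K]))).1 u.isUnit
      exact this
    rw [h1, map_mul, hu1, one_mul]
  change valuation K _ < valuation K r
  refine lt_of_lt_of_le ?_ hr'
  rw [pow_succ, mul_assoc, map_mul, hv, map_mul]
  have hr'1 : 0 < valuation K (r' : K) := by
    rw [Valuation.pos_iff]
    simpa using hr'0
  have : valuation K (ϖ : K) * valuation K c < 1 :=
    (mul_le_of_le_one_right' hc1).trans_lt hϖ1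
  simpa using mul_lt_mul_of_pos_left this hr'1

section Two

variable (h2 : IsUnit (2 : 𝒪[K])) (hn : 1 ≤ n)
include h2 hn

theorem inv_mem_of_sub_two_mem {x : K} (hx : x - 2 ∈ primePow ϖ n) : x ≠ 0 ∧ x⁻¹ ∈ 𝒪[K] := by
  have hxO : x ∈ 𝒪[K] := by
    have h2O : (2 : K) ∈ 𝒪[K] := (2 : 𝒪[K]).2
    simpa using add_mem (primePow_le_integers hx) h2O
  have hu : IsUnit (⟨x, hxO⟩ : 𝒪[K]) :=
    isUnit_of_sub_mem hϖ h2 (primePow_anti hn hx)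
  refine ⟨fun h => hu.ne_zero (Subtype.ext h), inv_mem_of_isUnit hϖ hu⟩

/-- Hensel's lemma for the square root of a principal unit. -/
theorem exists_incl_sq_eq {c : K} (hc : c - 1 ∈ primePow ϖ n) :
    ∃ a : U ϖ n, incl a ^ 2 = c := by
  have hcO : c ∈ 𝒪[K] := by
    simpa using add_mem (primePow_le_integers hc) (one_mem 𝒪[K])
  let := IsTopologicalAddGroup.rightUniformSpace K
  have := isUniformAddGroup_of_addCommGroup (G := K)
  have hA : IsAdicComplete 𝓂[K] 𝒪[K] := inferInstance
  have hH : HenselianRing 𝒪[K] 𝓂[K] := inferInstance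
  let f : Polynomial 𝒪[K] := Polynomial.X ^ 2 - Polynomial.C ⟨c, hcO⟩
  have hf : f.Monic := Polynomial.monic_X_pow_sub_C _ two_ne_zero
  obtain ⟨d, hd, hc1⟩ := hc
  obtain ⟨j, rfl⟩ := Nat.exists_eq_add_of_le' hn
  have h1 : f.eval 1 ∈ 𝓂[K] := by
    rw [hϖ.maximalIdeal_eq, Ideal.mem_span_singleton]
    refine ⟨-(ϖ ^ j * ⟨d, hd⟩), Subtype.ext ?_⟩
    simp only [f, Polynomial.eval_sub, Polynomial.eval_pow, Polynomial.eval_X, Polynomial.eval_C]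
    change (1 : K) ^ 2 - c = ϖ * -(ϖ ^ j * d)
    linear_combination -hc1
  have h3 : IsUnit (Ideal.Quotient.mk 𝓂[K] (f.derivative.eval 1)) := by
    refine IsUnit.map _ ?_
    have : f.derivative.eval 1 = 2 := by
      simp [f, one_add_one_eq_two]
    rw [this]
    exact h2
  obtain ⟨a, ha, ha1⟩ := HenselianRing.is_henselian f hf 1 h1 h3
  have ha2 : (a : K) ^ 2 = c := by
    have : a ^ 2 - ⟨c, hcO⟩ = 0 := by simpa [f, Polynomial.IsRoot] using ha
    have := congrArg (fun x : 𝒪[K] => (x : K)) (sub_eq_zero.1 this)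
    simpa using this
  have ha3 : (a : K) - 1 ∈ primePow ϖ 1 := by
    change a - 1 ∈ IsLocalRing.maximalIdeal 𝒪[K] at ha1
    rw [hϖ.maximalIdeal_eq, Ideal.mem_span_singleton] at ha1
    obtain ⟨e, he⟩ := ha1
    exact ⟨e, e.2, by simpa using congrArg (fun x : 𝒪[K] => (x : K)) he⟩
  obtain ⟨h4, h5⟩ := inv_mem_of_sub_two_mem hϖ h2 le_rfl (x := (a : K) + 1)
    (by rwa [show (a : K) + 1 - 2 = a - 1 by ring])
  have h6 : (a : K) - 1 ∈ primePow ϖ (j + 1) := by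
    refine mem_primePow_of_dvd ⟨d, hd, hc1⟩ h5 ?_
    rw [eq_mul_inv_iff_mul_eq₀ h4, ← ha2]
    ring
  obtain ⟨b, hb⟩ := exists_incl_eq hϖ hn h6
  exact ⟨b, by rw [hb, ha2]⟩

theorem exists_phi_eq {y : K} (hy : y ∈ primePow ϖ n) : ∃ a : U ϖ n, phi a = y := by
  obtain ⟨h20, h2i⟩ := inv_mem_of_sub_two_mem hϖ h2 hn (x := 2) (by simp)
  -- `a = y / 2 + √(1 + y² / 4)`
  obtain ⟨d, hd⟩ := exists_incl_sq_eq hϖ h2 hn (c := 1 + (y / 2) ^ 2)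
    (mem_primePow_of_dvd hy (mul_mem (mul_mem (primePow_le_integers hy) h2i) h2i) (by
      field_simp; ring))
  have hy2 : y / 2 ∈ primePow ϖ n := by
    rw [div_eq_mul_inv]
    exact mul_mem_primePow hy h2i
  obtain ⟨a, ha⟩ := exists_incl_eq hϖ hn (x := y / 2 + incl d)
    (by rw [add_sub_assoc]; exact add_mem hy2 (incl_sub_one_mem d))
  refine ⟨a, ?_⟩
  have h3 : (incl a)⁻¹ = incl d - y / 2 := by
    refine inv_eq_of_mul_eq_one_right ?_
    rw [ha]
    linear_combination hd
  rw [phi, h3, ha]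
  field_simp
  ring

theorem incl_sub_mem_of_sq {a b : U ϖ n} {m : ℕ} (h : incl a ^ 2 - incl b ^ 2 ∈ primePow ϖ m) :
    incl a - incl b ∈ primePow ϖ m := by
  obtain ⟨h4, h5⟩ := inv_mem_of_sub_two_mem hϖ h2 hn (x := incl a + incl b) (by
    rw [show incl a + incl b - 2 = (incl a - 1) + (incl b - 1) by ring]
    exact add_mem (incl_sub_one_mem a) (incl_sub_one_mem b))
  refine mem_primePow_of_dvd h h5 ?_
  rw [eq_mul_inv_iff_mul_eq₀ h4]
  ring

/-- `φ` is an isometry, since `φ(a) - φ(b) = (a - b)(1 + 1/(ab))` and `1 + 1/(ab)` is congruent to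
the unit `2`. -/
theorem phi_sub_mem_iff {a b : U ϖ n} {m : ℕ} :
    phi a - phi b ∈ primePow ϖ m ↔ incl a - incl b ∈ primePow ϖ m := by
  have ha := incl_ne_zero a
  have hb := incl_ne_zero b
  have key : phi a - phi b = (incl a - incl b) * (1 + incl (a * b)⁻¹) := by
    simp only [phi, incl_mul, incl_inv]
    field_simp
    ring
  obtain ⟨h4, h5⟩ := inv_mem_of_sub_two_mem hϖ h2 hn (x := 1 + incl (a * b)⁻¹) (by
    rw [show 1 + incl (a * b)⁻¹ - 2 = incl (a * b)⁻¹ - 1 by ring]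
    exact incl_sub_one_mem _)
  constructor
  · intro h
    refine mem_primePow_of_dvd h h5 ?_
    rw [key, mul_inv_cancel_right₀ h4]
  · intro h
    exact mem_primePow_of_dvd h (add_mem (one_mem _) (incl_mem _)) key

/-- The map `(α, β) ↦ (φ(α) β, φ(β) α⁻¹)` reflects congruences. -/
theorem twist_reflects {a b a' b' : U ϖ n} {m : ℕ}
    (hu : phi a * incl b - phi a' * incl b' ∈ primePow ϖ m)
    (hv : phi b * (incl a)⁻¹ - phi b' * (incl a')⁻¹ ∈ primePow ϖ m) :
    incl a - incl a' ∈ primePow ϖ m ∧ incl b - incl b' ∈ primePow ϖ m := by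
  have h1 : incl (a * b) - incl (a' * b') ∈ primePow ϖ m := by
    rw [← phi_sub_mem_iff hϖ h2 hn, phi_mul, phi_mul]
    have := add_mem hu hv
    rwa [show ∀ x y z w : K, x - y + (z - w) = x + z - (y + w) by intros; ring] at this
  have ha := incl_ne_zero a
  have hb := incl_ne_zero b
  have ha' := incl_ne_zero a'
  have hb' := incl_ne_zero b'
  -- `β / α = αβ - φ(α) β`
  have h3 : incl (b * a⁻¹) - incl (b' * a'⁻¹) ∈ primePow ϖ m := by
    have := sub_mem h1 hu
    refine mem_primePow_of_dvd this (one_mem _) ?_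
    simp only [phi, incl_mul, incl_inv]
    ring
  have h4 : incl b - incl b' ∈ primePow ϖ m := by
    refine incl_sub_mem_of_sq hϖ h2 hn ?_
    have h5 := add_mem (mul_mem_primePow h1 (incl_mem (b * a⁻¹)))
      (mul_mem_primePow h3 (incl_mem (a' * b')))
    refine mem_primePow_of_dvd h5 (one_mem _) ?_
    simp only [incl_mul, incl_inv]
    field_simp
    ring
  refine ⟨?_, h4⟩
  have h5 := sub_mem (mul_mem_primePow h1 (inv_incl_mem b))
    (mul_mem_primePow h4 (mul_mem (incl_mem a') (inv_incl_mem b)))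
  refine mem_primePow_of_dvd h5 (one_mem _) ?_
  simp only [incl_mul]
  field_simp
  ring

/-- The map `(α, β) ↦ (φ(α) β, φ(β) α⁻¹)` is onto. By `phi_mul` the product `γ = αβ` is determined
by `φ(γ) = u + v`, and then `α² = γ / (γ - u)`. -/
theorem twist_surjective {u v : K} (hu : u ∈ primePow ϖ n) (hv : v ∈ primePow ϖ n) :
    ∃ a b : U ϖ n, phi a * incl b = u ∧ phi b * (incl a)⁻¹ = v := by
  obtain ⟨g, hg⟩ := exists_phi_eq hϖ h2 hn (add_mem hu hv)
  have hg0 := incl_ne_zero g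
  obtain ⟨e, he⟩ := exists_incl_eq hϖ hn (x := 1 - u * (incl g)⁻¹) (by
    refine mem_primePow_of_dvd hu (neg_mem (inv_incl_mem g)) (by ring))
  obtain ⟨d, hd⟩ := exists_incl_sq_eq hϖ h2 hn (incl_sub_one_mem e)
  have hd0 := incl_ne_zero d
  have h1 : phi d⁻¹ * incl (d * g) = u := by
    simp only [phi, incl_mul, incl_inv, inv_inv]
    have : incl d ^ 2 * incl g = incl g - u := by
      rw [hd, he]
      field_simp
    field_simp
    linear_combination -this
  refine ⟨d⁻¹, d * g, h1, ?_⟩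
  have h3 := phi_mul d⁻¹ (d * g)
  rw [inv_mul_cancel_left, hg, h1] at h3
  exact (add_left_cancel h3).symm

end Two

end Uniformizer

end Arithmetic

/-! ### Balls, lattices and their volumes -/

section Cells

variable {K : Type*} [Field K] [ValuativeRel K] [TopologicalSpace K] [IsNonarchimedeanLocalField K]
  {ϖ : 𝒪[K]} {n : ℕ}

/-- The topology of `U_n`, as a group of units, is the subspace topology, because inversion is
continuous on `Kˣ`. -/
theorem isInducing_incl : Topology.IsInducing (incl (ϖ := ϖ) (n := n)) := by
  classical
  let f : 𝒪[K] → 𝒪[K] := fun x => if h : (x : K)⁻¹ ∈ 𝒪[K] then ⟨(x : K)⁻¹, h⟩ else 0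
  have hf : ∀ u : 𝒪[K]ˣ, (f u : K) = (u : K)⁻¹ ∧ f u = (u⁻¹ : 𝒪[K]ˣ) := by
    intro u
    have h3 : ((u : 𝒪[K]) : K)⁻¹ = ((u⁻¹ : 𝒪[K]ˣ) : 𝒪[K]) :=
      inv_eq_of_mul_eq_one_right (congrArg (fun x : 𝒪[K] => (x : K)) u.mul_inv)
    have h4 : ((u : 𝒪[K]) : K)⁻¹ ∈ 𝒪[K] := h3 ▸ ((u⁻¹ : 𝒪[K]ˣ) : 𝒪[K]).2
    have h5 : f u = ⟨((u : 𝒪[K]) : K)⁻¹, h4⟩ := dif_pos h4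
    exact ⟨congrArg Subtype.val h5, h5.trans (Subtype.ext h3)⟩
  have hc : ContinuousOn f {x | IsUnit x} := by
    refine Topology.IsInducing.subtypeVal.continuousOn_iff.2 ?_
    have h1 : ContinuousOn (fun x : 𝒪[K] => (x : K)⁻¹) {x | IsUnit x} := by
      refine ContinuousOn.inv₀ continuous_subtype_val.continuousOn fun x hx h => ?_
      exact IsUnit.ne_zero hx (Subtype.ext h)
    refine h1.congr ?_
    rintro _ ⟨u, rfl⟩
    exact (hf u).1
  exact Topology.IsInducing.subtypeVal.comp
    ((Units.isEmbedding_val_mk' hc fun u => (hf u).2).isInducing.comp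
      Topology.IsInducing.subtypeVal)

theorem continuous_incl : Continuous (incl (ϖ := ϖ) (n := n)) := isInducing_incl.continuous

variable (ϖ n) in
/-- The subgroup `ϖ⁻ᵐ 𝒪 / ϖ⁻ⁿ 𝒪` of `Γ_n`, for `m ≥ n`. -/
def latticeΓ (m : ℕ) : AddSubgroup (Γ ϖ n) := (fracIdeal ϖ m).map (Γ.mk ϖ n)

theorem mk_mem_latticeΓ {m : ℕ} (hm : n ≤ m) {t : K} :
    Γ.mk ϖ n t ∈ latticeΓ ϖ n m ↔ t ∈ fracIdeal ϖ m := by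
  constructor
  · rintro ⟨s, hs, hst⟩
    have := sub_mem hs (fracIdeal_mono hm (Γ.mk_eq_mk.1 hst))
    simpa using this
  · intro h
    exact ⟨t, h, rfl⟩

theorem exists_mk_eq {m : ℕ} {s : Γ ϖ n} (hs : s ∈ latticeΓ ϖ n m) :
    ∃ t ∈ fracIdeal ϖ m, Γ.mk ϖ n t = s := hs

theorem smul_mem_latticeΓ {m : ℕ} (a : U ϖ n) {s : Γ ϖ n} (hs : s ∈ latticeΓ ϖ n m) :
    a • s ∈ latticeΓ ϖ n m := by
  obtain ⟨t, ht, rfl⟩ := hs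
  exact ⟨incl a * t, mul_mem_fracIdeal (incl_mem a) ht, rfl⟩

/-- The ball `b + ϖᵐ 𝒪` in `U_n`. -/
def ballU (m : ℕ) (b : U ϖ n) : Set (U ϖ n) := {a | incl a - incl b ∈ primePow ϖ m}

theorem mem_ballU {m : ℕ} {a b : U ϖ n} : a ∈ ballU m b ↔ incl a - incl b ∈ primePow ϖ m := Iff.rfl

theorem mem_ballU_self (m : ℕ) (b : U ϖ n) : b ∈ ballU m b := by simp [mem_ballU]

theorem ballU_eq {m : ℕ} {a b : U ϖ n} (h : a ∈ ballU m b) : ballU m a = ballU m b := by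
  ext c
  rw [mem_ballU, mem_ballU]
  rw [mem_ballU] at h
  constructor
  · intro h1
    simpa using add_mem h1 h
  · intro h1
    simpa using sub_mem h1 h

theorem ballU_anti {m k : ℕ} (h : m ≤ k) (b : U ϖ n) : ballU k b ⊆ ballU m b :=
  fun _ ha => primePow_anti h ha

/-- The residue of `a ∈ U_n` modulo `ϖᵐ`. -/
def residue (m : ℕ) (a : U ϖ n) : 𝒪[K] ⧸ Ideal.span {ϖ ^ m} := Ideal.Quotient.mk _ (a : 𝒪[K]ˣ)

theorem residue_eq_iff {m : ℕ} {a b : U ϖ n} : residue m a = residue m b ↔ a ∈ ballU m b := by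
  rw [residue, residue, Ideal.Quotient.eq, Ideal.mem_span_singleton, mem_ballU]
  constructor
  · rintro ⟨c, hc⟩
    exact ⟨c, c.2, congrArg (fun x : 𝒪[K] => (x : K)) hc⟩
  · rintro ⟨c, hc, h⟩
    exact ⟨⟨c, hc⟩, Subtype.ext h⟩

section Uniformizer

variable (hϖ : Irreducible ϖ)
include hϖ

theorem isOpen_ballU (m : ℕ) (b : U ϖ n) : IsOpen (ballU m b) :=
  (isOpen_primePow hϖ m).preimage (continuous_incl.sub continuous_const)

theorem exists_ballU_subset {s : Set (U ϖ n)} {b : U ϖ n} (hs : s ∈ nhds b) :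
    ∃ m, ballU m b ⊆ s := by
  rw [isInducing_incl.nhds_eq_comap, Filter.mem_comap] at hs
  obtain ⟨t, ht, hts⟩ := hs
  have h0 : (fun x => x + incl b) ⁻¹' t ∈ nhds (0 : K) := by
    refine (continuous_id.add continuous_const).continuousAt ?_
    simpa using ht
  obtain ⟨m, hm⟩ := exists_primePow_subset hϖ h0
  refine ⟨m, fun a ha => hts ?_⟩
  have := hm ha
  simpa using this

theorem compactSpace_U (hn : 1 ≤ n) : CompactSpace (U ϖ n) := by
  refine ⟨?_⟩
  rw [isInducing_incl.isCompact_iff, Set.image_univ]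
  have : Set.range (incl (ϖ := ϖ) (n := n)) = (fun y => 1 + (ϖ : K) ^ n * y) '' 𝒪[K] := by
    ext x
    constructor
    · rintro ⟨a, rfl⟩
      obtain ⟨c, hc, h⟩ := incl_sub_one_mem a
      exact ⟨c, hc, by simp [← h]⟩
    · rintro ⟨c, hc, rfl⟩
      exact exists_incl_eq hϖ hn ⟨c, hc, by simp⟩
  rw [this]
  exact isCompact_integers.image (continuous_const.add (continuous_const_mul _))

theorem card_quotient (m : ℕ) :
    Nat.card (𝒪[K] ⧸ Ideal.span {ϖ ^ m}) = Nat.card 𝓀[K] ^ m := by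
  have h1 : IsLocalRing.maximalIdeal 𝒪[K] = Ideal.span {ϖ} := hϖ.maximalIdeal_eq
  have h2 : IsLocalRing.maximalIdeal 𝒪[K] ≠ ⊥ := by
    rw [h1, Ne, Ideal.span_singleton_eq_bot]
    exact hϖ.ne_zero
  have h3 := cardQuot_pow_of_prime (P := IsLocalRing.maximalIdeal 𝒪[K]) (i := m) h2
  rw [Submodule.cardQuot_apply, Submodule.cardQuot_apply, h1, Ideal.span_singleton_pow] at h3
  rw [h3, ← h1]
  rfl

theorem card_residueField_pos : 0 < Nat.card 𝓀[K] := Nat.card_pos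

theorem finite_quotient (m : ℕ) : Finite (𝒪[K] ⧸ Ideal.span {ϖ ^ m}) :=
  Nat.finite_of_card_ne_zero (by
    rw [card_quotient hϖ]; exact pow_ne_zero _ (card_residueField_pos hϖ).ne')

/-- Multiplication by `ϖ⁻ᵐ` induces `𝒪 / ϖᵐ⁻ⁿ 𝒪 ≃ ϖ⁻ᵐ 𝒪 / ϖ⁻ⁿ 𝒪`. -/
theorem card_latticeΓ {m : ℕ} (hm : n ≤ m) :
    Nat.card (latticeΓ ϖ n m) = Nat.card 𝓀[K] ^ (m - n) := by
  have h0 := uniformizer_ne_zero hϖ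
  let f : 𝒪[K] →+ Γ ϖ n := (Γ.mk ϖ n).comp
    ((AddMonoidHom.mulLeft ((ϖ : K) ^ m)⁻¹).comp (𝒪[K]).subtype.toAddMonoidHom)
  have hf : ∀ x, f x = Γ.mk ϖ n (((ϖ : K) ^ m)⁻¹ * x) := fun x => rfl
  have hr : f.range = latticeΓ ϖ n m := by
    ext s
    constructor
    · rintro ⟨x, rfl⟩
      refine ⟨_, ?_, (hf x).symm⟩
      change (ϖ : K) ^ m * (((ϖ : K) ^ m)⁻¹ * x) ∈ 𝒪[K]
      rw [mul_inv_cancel_left₀ (pow_ne_zero m h0)]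
      exact x.2
    · rintro ⟨t, ht, rfl⟩
      refine ⟨⟨_, ht⟩, ?_⟩
      rw [hf]
      congr 1
      change ((ϖ : K) ^ m)⁻¹ * ((ϖ : K) ^ m * t) = t
      rw [inv_mul_cancel_left₀ (pow_ne_zero m h0)]
  have hk : f.ker = (Ideal.span {ϖ ^ (m - n)} : Ideal 𝒪[K]).toAddSubgroup := by
    ext x
    rw [AddMonoidHom.mem_ker, Submodule.mem_toAddSubgroup, Ideal.mem_span_singleton, hf,
      ← map_zero (Γ.mk ϖ n), Γ.mk_eq_mk, sub_zero]
    have e1 : (ϖ : K) ^ n * (((ϖ : K) ^ m)⁻¹ * x) = ((ϖ : K) ^ (m - n))⁻¹ * x := by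
      rw [← mul_assoc, ← Nat.sub_add_cancel hm, pow_add, mul_inv, mul_comm ((ϖ : K) ^ n),
        mul_assoc _ _ ((ϖ : K) ^ n), inv_mul_cancel₀ (pow_ne_zero n h0), mul_one, Nat.add_sub_cancel]
    change (ϖ : K) ^ n * (((ϖ : K) ^ m)⁻¹ * x) ∈ 𝒪[K] ↔ _
    rw [e1, ← mem_primePow_iff hϖ]
    constructor
    · rintro ⟨c, hc, h⟩
      exact ⟨⟨c, hc⟩, Subtype.ext h⟩
    · rintro ⟨c, rfl⟩
      exact ⟨c, c.2, rfl⟩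
  rw [← hr, ← card_quotient hϖ]
  have e := QuotientAddGroup.quotientKerEquivRange f
  rw [← Nat.card_congr e.toEquiv, hk]
  rfl

theorem finite_latticeΓ (m : ℕ) : (latticeΓ ϖ n m : Set (Γ ϖ n)).Finite := by
  have h : ∀ k, n ≤ k → (latticeΓ ϖ n k : Set (Γ ϖ n)).Finite := fun k hk =>
    @Set.toFinite _ _ (Nat.finite_of_card_ne_zero (by
      rw [SetLike.coe_sort_coe, card_latticeΓ hϖ hk]
      exact pow_ne_zero _ (card_residueField_pos hϖ).ne'))
  exact (h (max m n) (le_max_right _ _)).subset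
    (AddSubgroup.map_mono (fracIdeal_mono (le_max_left _ _)))

section Measure

variable [MeasurableSpace K] [BorelSpace K]

theorem measurableSet_ballU (m : ℕ) (b : U ϖ n) : MeasurableSet (ballU m b) :=
  (measurable_incl.sub_const _) (isOpen_primePow hϖ m).measurableSet

/-- The ring `𝒪` is the disjoint union of `qᵐ` translates of `ϖᵐ 𝒪`. -/
theorem haarK_primePow (m : ℕ) :
    (Nat.card 𝓀[K] : ℝ≥0∞) ^ m * haarK K (primePow ϖ m : Set K) = 1 := by
  have := finite_quotient hϖ m
  have := Fintype.ofFinite (𝒪[K] ⧸ Ideal.span {ϖ ^ m})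
  have h1 : haarK K (𝒪[K] : Set K) = 1 := Measure.addHaarMeasure_self
  have h2 : (𝒪[K] : Set K) = ⋃ x : 𝒪[K] ⧸ Ideal.span {ϖ ^ m},
      (fun y : K => (Quotient.out x : 𝒪[K]) + y) '' (primePow ϖ m : Set K) := by
    ext y
    rw [Set.mem_iUnion]
    constructor
    · intro hy
      refine ⟨Ideal.Quotient.mk _ ⟨y, hy⟩, y - (Quotient.out
        (Ideal.Quotient.mk (Ideal.span {ϖ ^ m}) ⟨y, hy⟩) : 𝒪[K]), ?_, by simp⟩
      have : Ideal.Quotient.mk (Ideal.span {ϖ ^ m}) (Quotient.out (Ideal.Quotient.mk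
        (Ideal.span {ϖ ^ m}) ⟨y, hy⟩)) = Ideal.Quotient.mk _ ⟨y, hy⟩ := Quotient.out_eq _
      obtain ⟨c, hc⟩ := Ideal.mem_span_singleton.1 (Ideal.Quotient.eq.1 this.symm)
      exact ⟨c, c.2, congrArg Subtype.val hc⟩
    · rintro ⟨x, z, hz, rfl⟩
      exact add_mem (Subtype.property _) (primePow_le_integers hz)
  have h3 : Pairwise (Function.onFun Disjoint fun x : 𝒪[K] ⧸ Ideal.span {ϖ ^ m} =>
      (fun y : K => (Quotient.out x : 𝒪[K]) + y) '' (primePow ϖ m : Set K)) := by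
    intro x x' hx
    refine Set.disjoint_left.2 ?_
    rintro _ ⟨y, hy, rfl⟩ ⟨y', hy', h⟩
    refine hx ?_
    rw [← Quotient.out_eq x, ← Quotient.out_eq x']
    refine Ideal.Quotient.eq.2 (Ideal.mem_span_singleton.2 ?_)
    obtain ⟨c, hc, hc'⟩ := sub_mem hy' hy
    refine ⟨⟨c, hc⟩, Subtype.ext (Eq.trans ?_ hc')⟩
    change ((Quotient.out x : 𝒪[K]) : K) - (Quotient.out x' : 𝒪[K]) = _
    have h' : ((Quotient.out x' : 𝒪[K]) : K) + y' = (Quotient.out x : 𝒪[K]) + y := h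
    linear_combination -h'
  have h4 : ∀ x : 𝒪[K] ⧸ Ideal.span {ϖ ^ m}, haarK K
      ((fun y : K => (Quotient.out x : 𝒪[K]) + y) '' (primePow ϖ m : Set K)) =
      haarK K (primePow ϖ m : Set K) := by
    intro x
    exact measure_vadd (haarK K) ((Quotient.out x : 𝒪[K]) : K) _
  have h5 := h1
  rw [h2, measure_iUnion h3 (fun x => ?_)] at h5
  · simp only [h4] at h5
    rw [tsum_fintype, Finset.sum_const, Finset.card_univ, ← Nat.card_eq_fintype_card,
      card_quotient hϖ, nsmul_eq_mul] at h5
    exact_mod_cast h5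
  · exact ((Homeomorph.addLeft _).isOpenMap _ (isOpen_primePow hϖ m)).measurableSet

theorem haarU_ballU (hn : 1 ≤ n) {m : ℕ} (hm : n ≤ m) (b : U ϖ n) :
    haarU ϖ n (ballU m b) = haarK K (primePow ϖ m : Set K) := by
  rw [haarU, measurableEmbedding_incl.comap_apply]
  have : incl '' ballU m b = (fun y : K => incl b + y) '' (primePow ϖ m : Set K) := by
    ext x
    constructor
    · rintro ⟨a, ha, rfl⟩
      exact ⟨_, ha, by simp⟩
    · rintro ⟨y, hy, rfl⟩
      obtain ⟨a, ha⟩ := exists_incl_eq hϖ hn (x := incl b + y) (by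
        rw [show incl b + y - 1 = (incl b - 1) + y by ring]
        exact add_mem (incl_sub_one_mem b) (primePow_anti hm hy))
      exact ⟨a, by rw [mem_ballU, ha]; simpa using hy, ha⟩
  rw [this]
  exact measure_vadd (haarK K) (incl b) _

end Measure

end Uniformizer

end Cells

/-! ### Total sets and elementary tensors -/

section Hilbert

variable {H : Type*} [NormedAddCommGroup H] [InnerProductSpace ℂ H] [CompleteSpace H]

/-- A set of vectors is total if its linear span is dense. -/
def IsTotal (A : Set H) : Prop := Dense (Submodule.span ℂ A : Set H)

theorem isTotal_iff {A : Set H} : IsTotal A ↔ ∀ g, (∀ a ∈ A, ⟪a, g⟫_ℂ = 0) → g = 0 := by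
  rw [IsTotal, Submodule.dense_iff_topologicalClosure_eq_top,
    Submodule.topologicalClosure_eq_top_iff, Submodule.eq_bot_iff]
  refine forall_congr' fun g => imp_congr_left ?_
  rw [Submodule.mem_orthogonal]
  constructor
  · exact fun h a ha => h a (Submodule.subset_span ha)
  · intro h u hu
    induction hu using Submodule.span_induction with
    | mem x hx => exact h x hx
    | zero => simp
    | add x y _ _ hx hy => rw [inner_add_left, hx, hy, add_zero]
    | smul c x _ hx => rw [inner_smul_left, hx, mul_zero]

theorem IsTotal.of_subset_span {A B : Set H} (hA : IsTotal A) (h : A ⊆ Submodule.span ℂ B) :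
    IsTotal B :=
  hA.mono (Submodule.span_le.2 h)

theorem IsTotal.op_ext {E : Type*} [NormedAddCommGroup E] [NormedSpace ℂ E] {A : Set H}
    (hA : IsTotal A) {S T : H →L[ℂ] E} (h : ∀ a ∈ A, S a = T a) : S = T :=
  ContinuousLinearMap.ext_on hA h

theorem IsTotal.op_ext_inner {A : Set H} (hA : IsTotal A) {S T : H →L[ℂ] H}
    (h : ∀ a ∈ A, ∀ b ∈ A, ⟪b, S a⟫_ℂ = ⟪b, T a⟫_ℂ) : S = T := by
  refine hA.op_ext fun a ha => ?_
  rw [← sub_eq_zero]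
  refine isTotal_iff.1 hA _ fun b hb => ?_
  rw [inner_sub_right, h a ha b hb, sub_self]

/-- Two total families with the same Gram matrix are related by a unitary operator. -/
theorem exists_unitary_of_gram {ι : Type*} {w w' : ι → H} (hw : IsTotal (Set.range w))
    (hw' : IsTotal (Set.range w')) (h : ∀ i j, ⟪w i, w j⟫_ℂ = ⟪w' i, w' j⟫_ℂ) :
    ∃ F : H ≃ₗᵢ[ℂ] H, ∀ i, F (w i) = w' i := by
  have hd : ∀ {u : ι → H}, IsTotal (Set.range u) →
      DenseRange (Finsupp.linearCombination ℂ u) := by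
    intro u hu
    rw [DenseRange, ← LinearMap.coe_range, Finsupp.range_linearCombination]
    exact hu
  have hin : ∀ x y : ι →₀ ℂ, ⟪Finsupp.linearCombination ℂ w' x, Finsupp.linearCombination ℂ w' y⟫_ℂ
      = ⟪Finsupp.linearCombination ℂ w x, Finsupp.linearCombination ℂ w y⟫_ℂ := by
    intro x y
    simp only [Finsupp.linearCombination_apply, Finsupp.sum_inner, Finsupp.inner_sum,
      inner_smul_left, inner_smul_right, h]
  have hn : ∀ x, ‖Finsupp.linearCombination ℂ w' x‖ = ‖Finsupp.linearCombination ℂ w x‖ := by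
    intro x
    rw [← sq_eq_sq₀ (norm_nonneg _) (norm_nonneg _)]
    have := hin x x
    rw [inner_self_eq_norm_sq_to_K, inner_self_eq_norm_sq_to_K] at this
    exact_mod_cast this
  refine ⟨LinearEquiv.extendOfIsometry (LinearEquiv.refl ℂ (ι →₀ ℂ))
    (Finsupp.linearCombination ℂ w) (Finsupp.linearCombination ℂ w') (hd hw) (hd hw') hn,
    fun i => ?_⟩
  have := LinearEquiv.extendOfIsometry_eq (LinearEquiv.refl ℂ (ι →₀ ℂ))
    (e₁ := Finsupp.linearCombination ℂ w) (e₂ := Finsupp.linearCombination ℂ w')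
    (hd hw) (hd hw') hn (Finsupp.single i 1)
  simpa using this

end Hilbert

section TensorTotal

variable {α β : Type*} [MeasurableSpace α] [MeasurableSpace β]
  {μ : Measure α} {ν : Measure β} [SigmaFinite μ] [SigmaFinite ν]

variable (ν) in
/-- The map `h ↦ f ⊗ h`. -/
def tmulLeft (f : L2 μ) : L2 ν →L[ℂ] L2 (μ.prod ν) :=
  (tmulIsom μ ν).toContinuousLinearMap ∘L TensorProduct.mkL ℂ (L2 μ) (L2 ν) f

@[simp] theorem tmulLeft_apply (f : L2 μ) (h : L2 ν) : tmulLeft ν f h = tmulFun μ ν f h := by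
  simp [tmulLeft]

variable (μ) in
/-- The map `f ↦ f ⊗ h`. -/
def tmulRight (h : L2 ν) : L2 μ →L[ℂ] L2 (μ.prod ν) :=
  (tmulIsom μ ν).toContinuousLinearMap ∘L (TensorProduct.mkL ℂ (L2 μ) (L2 ν)).flip h

@[simp] theorem tmulRight_apply (f : L2 μ) (h : L2 ν) : tmulRight μ h f = tmulFun μ ν f h := by
  simp [tmulRight]

/-- Elementary tensors of total sets are total. The first set may depend on the second factor. -/
theorem isTotal_tmulFun {B : Set (L2 ν)} {A' : L2 ν → Set (L2 μ)}
    (hB : IsTotal B) (hA : ∀ b ∈ B, IsTotal (A' b)) :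
    IsTotal {x : L2 (μ.prod ν) | ∃ b ∈ B, ∃ a ∈ A' b, x = tmulFun μ ν a b} := by
  refine isTotal_iff.2 fun g hg => eq_zero_of_inner_tmulFun μ ν g fun f h => ?_
  have h1 : ∀ b ∈ B, ∀ f, ⟪tmulFun μ ν f b, g⟫_ℂ = 0 := by
    intro b hb f
    have : innerSL ℂ g ∘L tmulRight μ b = 0 := (hA b hb).op_ext fun a ha => by
      simp [inner_eq_zero_symm.1 (hg _ ⟨b, hb, a, ha, rfl⟩)]
    have := congrArg (fun L => L f) this
    simpa [inner_eq_zero_symm] using this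
  have : innerSL ℂ g ∘L tmulLeft ν f = 0 := hB.op_ext fun b hb => by
    simp [inner_eq_zero_symm.1 (h1 b hb f)]
  have := congrArg (fun L => L h) this
  simpa [inner_eq_zero_symm] using this

theorem isTotal_image2_tmulFun {A : Set (L2 μ)} {B : Set (L2 ν)} (hA : IsTotal A)
    (hB : IsTotal B) : IsTotal (Set.image2 (tmulFun μ ν) A B) :=
  (isTotal_tmulFun hB fun _ _ => hA).of_subset_span (by
    rintro _ ⟨b, hb, a, ha, rfl⟩
    exact Submodule.subset_span ⟨a, ha, b, hb, rfl⟩)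

theorem tmulFun_mem_span {A : Set (L2 μ)} {B : Set (L2 ν)} {f : L2 μ} {h : L2 ν}
    (hf : f ∈ Submodule.span ℂ A) (hh : h ∈ Submodule.span ℂ B) :
    tmulFun μ ν f h ∈ Submodule.span ℂ (Set.image2 (tmulFun μ ν) A B) := by
  have := Submodule.apply_mem_map₂ (tmulBilin μ ν) hf hh
  rwa [Submodule.map₂_span_span] at this

theorem pull_equiv12_tmulFun {G : Type*} [Group G] [MeasurableSpace G] [MeasurableMul₂ G]
    [MeasurableInv G] (μ : Measure G) [SigmaFinite μ] [μ.IsMulLeftInvariant] (f h k : L2 μ) :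
    pull (equiv12 G) (measurePreserving_equiv12 μ) (tmulFun (μ.prod μ) μ (tmulFun μ μ f h) k) =
      tmulFun μ (μ.prod μ) f (tmulFun μ μ h k) := by
  apply Lp.ext
  have hq := (measurePreserving_equiv12 μ).quasiMeasurePreserving
  filter_upwards [coeFn_pull (equiv12 G) (measurePreserving_equiv12 μ)
      (tmulFun (μ.prod μ) μ (tmulFun μ μ f h) k),
    hq.ae (coeFn_tmulFun (μ.prod μ) μ (tmulFun μ μ f h) k),
    hq.ae (ae_fst _ _ (coeFn_tmulFun μ μ f h)),
    coeFn_tmulFun μ (μ.prod μ) f (tmulFun μ μ h k),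
    ae_snd μ _ (coeFn_tmulFun μ μ h k)] with z h1 h2 h3 h4 h5
  rw [h1, h2, h3, h4, h5]
  exact mul_assoc _ _ _

theorem leftReg_prod_tmulFun {G : Type*} [Group G] [MeasurableSpace G] [MeasurableMul₂ G]
    [MeasurableInv G] (μ : Measure G) [SigmaFinite μ] [μ.IsMulLeftInvariant] (g : G × G)
    (f h : L2 μ) :
    leftReg (μ.prod μ) g (tmulFun μ μ f h) = tmulFun μ μ (leftReg μ g.1 f) (leftReg μ g.2 h) := by
  apply Lp.ext
  filter_upwards [coeFn_leftReg (μ.prod μ) g (tmulFun μ μ f h),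
    (measurePreserving_mul_left (μ.prod μ) g⁻¹).quasiMeasurePreserving.ae (coeFn_tmulFun μ μ f h),
    coeFn_tmulFun μ μ (leftReg μ g.1 f) (leftReg μ g.2 h),
    ae_fst μ μ (coeFn_leftReg μ g.1 f), ae_snd μ μ (coeFn_leftReg μ g.2 h)] with z h1 h2 h3 h4 h5
  rw [h1, h2, h3, h4, h5]
  rfl

theorem inner_leftReg_leftReg {G : Type*} [Group G] [MeasurableSpace G] [MeasurableMul₂ G]
    [MeasurableInv G] (μ : Measure G) [SigmaFinite μ] [μ.IsMulLeftInvariant] (g : G)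
    (f h : L2 μ) : ⟪leftReg μ g f, leftReg μ g h⟫_ℂ = ⟪f, h⟫_ℂ :=
  LinearIsometryEquiv.inner_map_map _ _ _

end TensorTotal

/-! ### Waves -/

section Waves

variable {K : Type*} [Field K] [ValuativeRel K] [TopologicalSpace K] [IsNonarchimedeanLocalField K]
  {ϖ : 𝒪[K]} {n : ℕ}

open Classical in
/-- The function `(a, [t]) ↦ Ψ(b η t)` on the set of all `(a, [t])` with `a ∈ b + ϖᵐ 𝒪` and
`t ∈ ϖ⁻ᵐ 𝒪`, extended by zero. Up to a constant it is the partial Fourier transform, in the variable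
of `Γ_n`, of the indicator function of `(b + ϖᵐ 𝒪) × (b η + ϖᵐ 𝒪)`. -/
def waveFun (Ψ : AddChar K Circle) (m : ℕ) (b : U ϖ n) (η : K) (x : X ϖ n) : ℂ :=
  if x.1 ∈ ballU m b ∧ x.2 ∈ latticeΓ ϖ n m then (Ψ (incl b * η * x.2.rep) : ℂ) else 0

theorem norm_waveFun_le (Ψ : AddChar K Circle) (m : ℕ) (b : U ϖ n) (η : K) (x : X ϖ n) :
    ‖waveFun Ψ m b η x‖ ≤ 1 := by
  rw [waveFun]
  split_ifs
  · exact (Circle.norm_coe _).le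
  · rw [norm_zero]
    exact zero_le_one

theorem incl_mul_mem {m : ℕ} (b : U ϖ n) {η : K} (hη : η ∈ primePow ϖ m) :
    incl b * η ∈ primePow ϖ m := by
  rw [mul_comm]
  exact mul_mem_primePow hη (incl_mem b)

theorem incl_inv_mul_mem {m : ℕ} (b : U ϖ n) {η : K} (hη : η ∈ primePow ϖ m) :
    (incl b)⁻¹ * η ∈ primePow ϖ m := by
  rw [← incl_inv]
  exact incl_mul_mem _ hη

theorem sub_incl_mul_iff {m : ℕ} (a b c : U ϖ n) :
    incl (a * c) - incl b ∈ primePow ϖ m ↔ incl c - incl (a⁻¹ * b) ∈ primePow ϖ m := by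
  have ha := incl_ne_zero a
  constructor
  · intro h
    refine mem_primePow_of_dvd h (inv_incl_mem a) ?_
    simp only [incl_mul, incl_inv]
    field_simp
  · intro h
    refine mem_primePow_of_dvd h (incl_mem a) ?_
    simp only [incl_mul, incl_inv]
    field_simp

section Character

variable {Ψ : AddChar K Circle} (hΨ : ∀ x ∈ 𝒪[K], Ψ x = 1)
include hΨ

theorem char_congr {x y : K} (h : x - y ∈ 𝒪[K]) : Ψ x = Ψ y := by
  rw [← sub_add_cancel x y, AddChar.map_add_eq_mul, hΨ _ h, one_mul]

theorem char_rep {ξ : K} (hξ : ξ ∈ primePow ϖ n) (t : K) :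
    Ψ (ξ * (Γ.mk ϖ n t).rep) = Ψ (ξ * t) := by
  refine char_congr hΨ ?_
  rw [← mul_sub]
  exact mul_mem_integers hξ (Γ.mk_eq_mk.1 (Γ.mk_rep _))

open Classical in
theorem waveFun_mk {m : ℕ} (hm : n ≤ m) (b : U ϖ n) {η : K} (hη : η ∈ primePow ϖ n) (a : U ϖ n)
    (t : K) : waveFun Ψ m b η (X.mk a (Γ.mk ϖ n t)) =
      if incl a - incl b ∈ primePow ϖ m ∧ t ∈ fracIdeal ϖ m then (Ψ (incl b * η * t) : ℂ) else 0 := by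
  have h1 : (X.mk a (Γ.mk ϖ n t)).2 = Γ.mk ϖ n t := rfl
  have h2 : (X.mk a (Γ.mk ϖ n t)).1 = a := rfl
  rw [waveFun, h1, h2, mk_mem_latticeΓ hm, char_rep hΨ (incl_mul_mem b hη), mem_ballU]

theorem waveFun_congr {m : ℕ} (hm : n ≤ m) {b b' : U ϖ n} {η η' : K} (hη : η ∈ primePow ϖ n)
    (hη' : η' ∈ primePow ϖ n) (hb : incl b - incl b' ∈ primePow ϖ m)
    (h : η - η' ∈ primePow ϖ m) : waveFun (n := n) Ψ m b η = waveFun Ψ m b' η' := by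
  classical
  ext x
  obtain ⟨a, s⟩ := x
  obtain ⟨t, rfl⟩ := Γ.mk_surjective s
  change waveFun Ψ m b η (X.mk a (Γ.mk ϖ n t)) = waveFun Ψ m b' η' (X.mk a (Γ.mk ϖ n t))
  rw [waveFun_mk hΨ hm b hη, waveFun_mk hΨ hm b' hη']
  have h1 : incl a - incl b ∈ primePow ϖ m ↔ incl a - incl b' ∈ primePow ϖ m := by
    rw [← mem_ballU, ← mem_ballU, ballU_eq (show b ∈ ballU m b' from hb)]
  rw [h1]
  refine if_ctx_congr Iff.rfl (fun h2 => ?_) fun _ => rfl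
  rw [char_congr hΨ]
  rw [show incl b * η * t - incl b' * η' * t = ((incl b - incl b') * η + incl b' * (η - η')) * t by
    ring]
  exact mul_mem_integers (add_mem (mul_mem_primePow hb (primePow_le_integers hη))
    (incl_mul_mem b' h)) h2.2

theorem waveFun_mul {m : ℕ} (hm : n ≤ m) (b : U ϖ n) {η : K} (hη : η ∈ primePow ϖ n) (a : U ϖ n)
    {t : K} (ht : t ∈ fracIdeal ϖ m) (x : X ϖ n) :
    waveFun Ψ m b η (X.mk a (Γ.mk ϖ n t) * x) =
      Ψ (incl a * η * t) * waveFun Ψ m (a⁻¹ * b) (incl a * η) x := by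
  classical
  obtain ⟨c, s⟩ := x
  obtain ⟨s, rfl⟩ := Γ.mk_surjective s
  change waveFun Ψ m b η (X.mk a (Γ.mk ϖ n t) * X.mk c (Γ.mk ϖ n s)) =
    _ * waveFun Ψ m (a⁻¹ * b) (incl a * η) (X.mk c (Γ.mk ϖ n s))
  rw [X.mul_def, waveFun_mk hΨ hm b hη, waveFun_mk hΨ hm _ (incl_mul_mem a hη), sub_incl_mul_iff,
    AddSubgroup.add_mem_cancel_left _ (mul_mem_fracIdeal (inv_incl_mem c) ht), mul_ite, mul_zero]
  refine if_ctx_congr Iff.rfl (fun h => ?_) fun _ => rfl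
  rw [← Circle.coe_mul, ← AddChar.map_add_eq_mul, char_congr hΨ]
  have ha := incl_ne_zero a
  have hc := incl_ne_zero c
  rw [show incl b * η * ((incl c)⁻¹ * t + s) - (incl a * η * t + incl (a⁻¹ * b) * (incl a * η) * s) =
    -((incl c - incl (a⁻¹ * b)) * (incl a * η * (incl c)⁻¹) * t) by
      simp only [incl_mul, incl_inv]; field_simp; ring]
  exact neg_mem (mul_mem_integers (mul_mem_primePow h.1 (mul_mem (mul_mem (incl_mem a)
    (primePow_le_integers hη)) (inv_incl_mem c))) ht)

theorem waveFun_mul_of_notMem {m : ℕ} (hm : n ≤ m) (b b' : U ϖ n) {η η' : K}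
    (hη : η ∈ primePow ϖ n) (hη' : η' ∈ primePow ϖ n) (a : U ϖ n)
    {t : K} (ht : t ∉ fracIdeal ϖ m) (x : X ϖ n) :
    waveFun Ψ m b η (X.mk a (Γ.mk ϖ n t) * x) = 0 ∨ waveFun Ψ m b' η' x = 0 := by
  classical
  obtain ⟨c, s⟩ := x
  obtain ⟨s, rfl⟩ := Γ.mk_surjective s
  change waveFun Ψ m b η (X.mk a (Γ.mk ϖ n t) * X.mk c (Γ.mk ϖ n s)) = 0 ∨
    waveFun Ψ m b' η' (X.mk c (Γ.mk ϖ n s)) = 0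
  rw [X.mul_def, waveFun_mk hΨ hm b hη, waveFun_mk hΨ hm b' hη']
  by_cases hs : s ∈ fracIdeal ϖ m
  · left
    refine if_neg fun h => ht ?_
    have h1 := (AddSubgroup.add_mem_cancel_right _ hs).1 h.2
    have := mul_mem_fracIdeal (incl_mem c) h1
    rwa [mul_inv_cancel_left₀ (incl_ne_zero c)] at this
  · right
    exact if_neg fun h => hs h.2

theorem waveFun_shear {m : ℕ} (hm : n ≤ m) (b c : U ϖ n) {η θ : K} (hη : η ∈ primePow ϖ n)
    (hθ : θ ∈ primePow ϖ n) (x y : X ϖ n) :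
    waveFun Ψ m b η x * waveFun Ψ m c θ (x⁻¹ * y) =
      waveFun Ψ m b (η - (incl b)⁻¹ * θ) x * waveFun Ψ m (b * c) ((incl b)⁻¹ * θ) y := by
  classical
  obtain ⟨a, s⟩ := x
  obtain ⟨s, rfl⟩ := Γ.mk_surjective s
  obtain ⟨d, r⟩ := y
  obtain ⟨r, rfl⟩ := Γ.mk_surjective r
  have hinv : (X.mk a (Γ.mk ϖ n s))⁻¹ = X.mk a⁻¹ (Γ.mk ϖ n (-(incl a * s))) := by
    rw [map_neg]
    rfl
  change waveFun Ψ m b η (X.mk a (Γ.mk ϖ n s)) *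
      waveFun Ψ m c θ ((X.mk a (Γ.mk ϖ n s))⁻¹ * X.mk d (Γ.mk ϖ n r)) =
    waveFun Ψ m b (η - (incl b)⁻¹ * θ) (X.mk a (Γ.mk ϖ n s)) *
      waveFun Ψ m (b * c) ((incl b)⁻¹ * θ) (X.mk d (Γ.mk ϖ n r))
  have hbθ := incl_inv_mul_mem b hθ
  rw [hinv, X.mul_def, waveFun_mk hΨ hm b hη, waveFun_mk hΨ hm c hθ,
    waveFun_mk hΨ hm b (sub_mem hη hbθ), waveFun_mk hΨ hm _ hbθ]
  by_cases hx : incl a - incl b ∈ primePow ϖ m ∧ s ∈ fracIdeal ϖ m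
  swap
  · rw [if_neg hx, if_neg hx, zero_mul, zero_mul]
  have hab := hx.1
  have hs := hx.2
  have hs' : (incl d)⁻¹ * -(incl a * s) ∈ fracIdeal ϖ m :=
    mul_mem_fracIdeal (inv_incl_mem d) (neg_mem (mul_mem_fracIdeal (incl_mem a) hs))
  have hd : incl (a⁻¹ * d) - incl c ∈ primePow ϖ m ↔ incl d - incl (b * c) ∈ primePow ϖ m := by
    rw [sub_incl_mul_iff, inv_inv, ← mem_ballU, ← mem_ballU, ballU_eq]
    rw [mem_ballU, incl_mul, incl_mul, ← sub_mul]
    exact mul_mem_primePow hab (incl_mem c)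
  rw [AddSubgroup.add_mem_cancel_left _ hs', hd, if_pos hx, if_pos hx]
  by_cases hy : incl d - incl (b * c) ∈ primePow ϖ m ∧ r ∈ fracIdeal ϖ m
  swap
  · rw [if_neg hy, if_neg hy, mul_zero, mul_zero]
  rw [if_pos hy, if_pos hy, ← Circle.coe_mul, ← AddChar.map_add_eq_mul, ← Circle.coe_mul,
    ← AddChar.map_add_eq_mul, char_congr hΨ]
  have hb := incl_ne_zero b
  have hd0 := incl_ne_zero d
  have h1 : incl d - incl (a * c) ∈ primePow ϖ m := by
    have := sub_mem hy.1 (mul_mem_primePow hab (incl_mem c))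
    refine mem_primePow_of_dvd this (one_mem _) ?_
    simp only [incl_mul]
    ring
  have h2 := mul_mem_integers (mul_mem_primePow h1 (mul_mem (primePow_le_integers hθ)
    (inv_incl_mem d))) hs
  convert! h2 using 1
  simp only [incl_mul]
  field_simp
  ring

end Character

section Measure

variable [MeasurableSpace K] [BorelSpace K] (hϖ : Irreducible ϖ)
include hϖ

theorem measurable_waveFun (Ψ : AddChar K Circle) (m : ℕ) (b : U ϖ n) (η : K) :
    Measurable (waveFun (n := n) Ψ m b η) := by
  have h : Measurable fun s : Γ ϖ n => (Ψ (incl b * η * s.rep) : ℂ) := measurable_of_countable _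
  refine Measurable.ite ?_ (h.comp measurable_snd) measurable_const
  exact (measurable_fst (measurableSet_ballU hϖ m b)).inter
    (measurable_snd (MeasurableSet.of_discrete (s := (latticeΓ ϖ n m : Set (Γ ϖ n)))))

theorem memLp_waveFun (Ψ : AddChar K Circle) (m : ℕ) (b : U ϖ n) (η : K) :
    MemLp (waveFun (n := n) Ψ m b η) 2 (haarX ϖ n) := by
  let S : Set (X ϖ n) := ballU m b ×ˢ (latticeΓ ϖ n m : Set (Γ ϖ n))
  have hS : MeasurableSet S := (measurableSet_ballU hϖ m b).prod MeasurableSet.of_discrete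
  have hS' : haarX ϖ n S ≠ ∞ := by
    have : haarX ϖ n S = haarU ϖ n (ballU m b) * Measure.count (latticeΓ ϖ n m : Set (Γ ϖ n)) :=
      Measure.prod_prod _ _
    rw [this]
    refine ENNReal.mul_ne_top (measure_ne_top _ _) ?_
    exact (Measure.count_apply_lt_top.2 (finite_latticeΓ hϖ m)).ne
  refine (memLp_indicator_const 2 hS (1 : ℝ) (Or.inr hS')).mono
    (measurable_waveFun hϖ Ψ m b η).aestronglyMeasurable (.of_forall fun x => ?_)
  by_cases hx : x ∈ S
  · rw [Set.indicator_of_mem hx]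
    simpa using norm_waveFun_le Ψ m b η x
  · have : waveFun Ψ m b η x = 0 := if_neg hx
    rw [this]
    simp

/-- The class of `waveFun` in `L²(X_n)`. -/
def wave (Ψ : AddChar K Circle) (m : ℕ) (b : U ϖ n) (η : K) : L2 (haarX ϖ n) :=
  (memLp_waveFun hϖ Ψ m b η).toLp _

theorem coeFn_wave (Ψ : AddChar K Circle) (m : ℕ) (b : U ϖ n) (η : K) :
    wave hϖ Ψ m b η =ᵐ[haarX ϖ n] waveFun Ψ m b η := MemLp.coeFn_toLp _

theorem inner_wave_eq_integral (Ψ : AddChar K Circle) (m m' : ℕ) (b b' : U ϖ n) (η η' : K) :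
    ⟪wave hϖ Ψ m b η, wave hϖ Ψ m' b' η'⟫_ℂ =
      ∫ x, waveFun Ψ m' b' η' x * starRingEnd ℂ (waveFun Ψ m b η x) ∂haarX ϖ n := by
  rw [L2.inner_def]
  refine integral_congr_ae ?_
  filter_upwards [coeFn_wave hϖ Ψ m b η, coeFn_wave hϖ Ψ m' b' η'] with x h1 h2
  rw [h1, h2]
  rfl

variable {Ψ : AddChar K Circle} (hΨ : ∀ x ∈ 𝒪[K], Ψ x = 1)
include hΨ

theorem wave_congr {m : ℕ} (hm : n ≤ m) {b b' : U ϖ n} {η η' : K} (hη : η ∈ primePow ϖ n)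
    (hη' : η' ∈ primePow ϖ n) (hb : incl b - incl b' ∈ primePow ϖ m)
    (h : η - η' ∈ primePow ϖ m) : wave hϖ (n := n) Ψ m b η = wave hϖ Ψ m b' η' := by
  unfold wave
  simp only [waveFun_congr hΨ hm hη hη' hb h]

/-- Translations by elements of level `m` permute the waves of level `m`, up to scalars. -/
theorem leftReg_inv_wave {m : ℕ} (hm : n ≤ m) (b : U ϖ n) {η : K} (hη : η ∈ primePow ϖ n)
    (a : U ϖ n) {t : K} (ht : t ∈ fracIdeal ϖ m) :
    leftReg (haarX ϖ n) (X.mk a (Γ.mk ϖ n t))⁻¹ (wave hϖ Ψ m b η) =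
      (Ψ (incl a * η * t) : ℂ) • wave hϖ Ψ m (a⁻¹ * b) (incl a * η) := by
  apply Lp.ext
  filter_upwards [coeFn_leftReg (haarX ϖ n) (X.mk a (Γ.mk ϖ n t))⁻¹ (wave hϖ Ψ m b η),
    (measurePreserving_mul_left (haarX ϖ n) (X.mk a (Γ.mk ϖ n t))⁻¹⁻¹).quasiMeasurePreserving.ae
      (coeFn_wave hϖ Ψ m b η),
    Lp.coeFn_smul (Ψ (incl a * η * t) : ℂ) (wave hϖ Ψ m (a⁻¹ * b) (incl a * η)),
    coeFn_wave hϖ Ψ m (a⁻¹ * b) (incl a * η)] with x h1 h2 h3 h4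
  rw [h1, h2, h3, Pi.smul_apply, h4, smul_eq_mul, inv_inv, waveFun_mul hΨ hm b hη a ht]

theorem inner_leftReg_inv_wave_of_notMem {m : ℕ} (hm : n ≤ m) (b b' : U ϖ n) {η η' : K}
    (hη : η ∈ primePow ϖ n) (hη' : η' ∈ primePow ϖ n) (a : U ϖ n) {t : K}
    (ht : t ∉ fracIdeal ϖ m) :
    ⟪wave hϖ Ψ m b' η', leftReg (haarX ϖ n) (X.mk a (Γ.mk ϖ n t))⁻¹ (wave hϖ Ψ m b η)⟫_ℂ = 0 := by
  rw [L2.inner_def]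
  refine integral_eq_zero_of_ae ?_
  filter_upwards [coeFn_leftReg (haarX ϖ n) (X.mk a (Γ.mk ϖ n t))⁻¹ (wave hϖ Ψ m b η),
    (measurePreserving_mul_left (haarX ϖ n) (X.mk a (Γ.mk ϖ n t))⁻¹⁻¹).quasiMeasurePreserving.ae
      (coeFn_wave hϖ Ψ m b η),
    coeFn_wave hϖ Ψ m b' η'] with x h1 h2 h3
  rw [h1, h2, h3, inv_inv]
  rcases waveFun_mul_of_notMem hΨ hm b b' hη hη' a ht x with h | h <;> rw [h] <;> simp

/-- The unitary that implements the coproduct maps products of waves to products of waves. -/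
theorem pull_shear_wave {m : ℕ} (hm : n ≤ m) (b c : U ϖ n) {η θ : K} (hη : η ∈ primePow ϖ n)
    (hθ : θ ∈ primePow ϖ n) :
    pull (shear (X ϖ n)) (measurePreserving_shear (haarX ϖ n))
        (tmulFun _ _ (wave hϖ Ψ m b η) (wave hϖ Ψ m c θ)) =
      tmulFun _ _ (wave hϖ Ψ m b (η - (incl b)⁻¹ * θ)) (wave hϖ Ψ m (b * c) ((incl b)⁻¹ * θ)) := by
  apply Lp.ext
  have hq := (measurePreserving_shear (haarX ϖ n)).quasiMeasurePreserving
  filter_upwards [coeFn_pull (shear (X ϖ n)) (measurePreserving_shear (haarX ϖ n))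
      (tmulFun _ _ (wave hϖ Ψ m b η) (wave hϖ Ψ m c θ)),
    hq.ae (coeFn_tmulFun _ _ (wave hϖ Ψ m b η) (wave hϖ Ψ m c θ)),
    hq.ae (ae_fst _ _ (coeFn_wave hϖ Ψ m b η)), hq.ae (ae_snd _ _ (coeFn_wave hϖ Ψ m c θ)),
    coeFn_tmulFun _ _ (wave hϖ Ψ m b (η - (incl b)⁻¹ * θ)) (wave hϖ Ψ m (b * c) ((incl b)⁻¹ * θ)),
    ae_fst _ _ (coeFn_wave hϖ Ψ m b (η - (incl b)⁻¹ * θ)),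
    ae_snd _ _ (coeFn_wave hϖ Ψ m (b * c) ((incl b)⁻¹ * θ))] with z h1 h2 h3 h4 h5 h6 h7
  rw [h1, h2, h3, h4, h5, h6, h7]
  exact waveFun_shear hΨ hm b c hη hθ z.1 z.2

theorem inner_wave_of_residue_ne {m m' : ℕ} (hmm : m ≤ m') {b b' : U ϖ n} (η η' : K)
    (h : incl b - incl b' ∉ primePow ϖ m) :
    ⟪wave hϖ Ψ m b η, wave hϖ Ψ m' b' η'⟫_ℂ = 0 := by
  rw [inner_wave_eq_integral]
  refine integral_eq_zero_of_ae (.of_forall fun x => ?_)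
  by_cases h1 : x.1 ∈ ballU m b
  · have : waveFun Ψ m' b' η' x = 0 := if_neg fun h2 => h (by
      have := sub_mem (mem_ballU.1 (ballU_anti hmm b' h2.1)) (mem_ballU.1 h1)
      rwa [sub_sub_sub_cancel_left] at this)
    simp [this]
  · have : waveFun Ψ m b η x = 0 := if_neg fun h2 => h1 h2.1
    simp [this]

/-- The inner product of the waves with trivial parameters. -/
def gram (Ψ : AddChar K Circle) (m m' : ℕ) : ℂ :=
  ⟪wave hϖ (n := n) Ψ m 1 0, wave hϖ Ψ m' 1 0⟫_ℂ

variable (hΨ' : ∃ x : K, (ϖ : K) * x ∈ 𝒪[K] ∧ Ψ x ≠ 1)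
include hΨ'

/-- Waves with frequencies that are not congruent are orthogonal, because translation by `[t]`
multiplies them by different scalars for some `t`. -/
theorem inner_wave_of_freq_ne {m m' : ℕ} (hm : n ≤ m) (hmm : m ≤ m') (b b' : U ϖ n) {η η' : K}
    (hη : η ∈ primePow ϖ n) (hη' : η' ∈ primePow ϖ n) (h : η - η' ∉ primePow ϖ m) :
    ⟪wave hϖ Ψ m b η, wave hϖ Ψ m' b' η'⟫_ℂ = 0 := by
  obtain ⟨t, ht, ht1⟩ : ∃ t ∈ fracIdeal ϖ m, Ψ ((η - η') * t) ≠ 1 := by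
    by_contra! hc
    exact h (mem_primePow_of_character hϖ Ψ hΨ' hc)
  have h1 := inner_leftReg_leftReg (haarX ϖ n) (X.mk (1 : U ϖ n) (Γ.mk ϖ n t))⁻¹
    (wave hϖ Ψ m b η) (wave hϖ Ψ m' b' η')
  rw [leftReg_inv_wave hϖ hΨ hm b hη 1 ht,
    leftReg_inv_wave hϖ hΨ (hm.trans hmm) b' hη' 1 (fracIdeal_mono hmm ht)] at h1
  simp only [inv_one, one_mul, incl_one, inner_smul_left, inner_smul_right] at h1
  by_contra h0
  have h2 : (starRingEnd ℂ) (Ψ (η * t) : ℂ) * (Ψ (η' * t) : ℂ) = 1 := by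
    refine mul_right_cancel₀ h0 ?_
    rw [one_mul]
    linear_combination h1
  refine ht1 ?_
  rw [← Circle.coe_inv_eq_conj, ← Circle.coe_mul, ← AddChar.map_neg_eq_inv,
    ← AddChar.map_add_eq_mul, Circle.coe_eq_one] at h2
  rw [show (η - η') * t = -(-(η * t) + η' * t) by ring, AddChar.map_neg_eq_inv, h2, inv_one]

open Classical in
/-- The Gram matrix of the waves depends only on the levels and on congruences of the parameters
modulo the coarser level. -/
theorem inner_wave {m m' : ℕ} (hm : n ≤ m) (hmm : m ≤ m') (b b' : U ϖ n) {η η' : K}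
    (hη : η ∈ primePow ϖ n) (hη' : η' ∈ primePow ϖ n) :
    ⟪wave hϖ Ψ m b η, wave hϖ Ψ m' b' η'⟫_ℂ =
      if incl b - incl b' ∈ primePow ϖ m ∧ η - η' ∈ primePow ϖ m
        then gram hϖ (n := n) Ψ m m' else 0 := by
  split_ifs with h
  · rw [wave_congr hϖ hΨ hm hη hη' h.1 h.2]
    -- translation by `b'` moves both supports to `1`, where the phases cancel on the smaller one
    have h1 := inner_leftReg_leftReg (haarX ϖ n) (X.mk b' (Γ.mk ϖ n 0))⁻¹
      (wave hϖ Ψ m b' η') (wave hϖ Ψ m' b' η')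
    rw [leftReg_inv_wave hϖ hΨ hm b' hη' b' (zero_mem _),
      leftReg_inv_wave hϖ hΨ (hm.trans hmm) b' hη' b' (zero_mem _)] at h1
    simp only [mul_zero, AddChar.map_zero_eq_one, Circle.coe_one, one_smul, inv_mul_cancel] at h1
    rw [← h1, gram, inner_wave_eq_integral, inner_wave_eq_integral]
    congr 1 with x
    have hl : ∀ {s}, s ∈ latticeΓ ϖ n m → s ∈ latticeΓ ϖ n m' :=
      fun hs => AddSubgroup.map_mono (fracIdeal_mono hmm) hs
    by_cases h2 : x.1 ∈ ballU m' 1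
    · by_cases h3 : x.2 ∈ latticeΓ ϖ n m
      · have h4 := ballU_anti hmm 1 h2
        have h5 := hl h3
        simp only [waveFun, h2, h3, h4, h5, and_self, if_true]
        simp [Complex.mul_conj, Circle.normSq_coe]
      · simp [waveFun, h3]
    · simp [waveFun, h2]
  · rw [not_and_or] at h
    rcases h with h | h
    · exact inner_wave_of_residue_ne hϖ hΨ hmm η η' h
    · exact inner_wave_of_freq_ne hϖ hΨ hΨ' hm hmm b b' hη hη' h

end Measure

end Waves

/-! ### Totality of the waves -/

section Generic

variable {α : Type*} [MeasurableSpace α] {μ : Measure α}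

theorem coeFn_sum_smul {ι : Type*} (s : Finset ι) (c : ι → ℂ) (e : ι → L2 μ) :
    (∑ i ∈ s, c i • e i : L2 μ) =ᵐ[μ] fun x => ∑ i ∈ s, c i * e i x := by
  classical
  induction s using Finset.induction_on with
  | empty =>
    filter_upwards [Lp.coeFn_zero ℂ 2 μ] with x hx
    simpa using hx
  | insert i s hi ih =>
    rw [Finset.sum_insert hi]
    filter_upwards [Lp.coeFn_add (c i • e i) (∑ i ∈ s, c i • e i), Lp.coeFn_smul (c i) (e i), ih]
      with x h1 h2 h3
    rw [h1, Pi.add_apply, h2, h3, Finset.sum_insert hi]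
    rfl

theorem mem_span_of_ae_eq_sum {ι : Type*} (s : Finset ι) (c : ι → ℂ) (e : ι → L2 μ)
    (g : ι → α → ℂ) (he : ∀ i ∈ s, e i =ᵐ[μ] g i) {A : Set (L2 μ)}
    (hA : ∀ i ∈ s, e i ∈ Submodule.span ℂ A) {f : L2 μ}
    (hf : f =ᵐ[μ] fun x => ∑ i ∈ s, c i * g i x) :
    f ∈ Submodule.span ℂ A := by
  have h : f = ∑ i ∈ s, c i • e i := by
    apply Lp.ext
    filter_upwards [hf, coeFn_sum_smul s c e, s.eventually_all.2 he] with x h1 h2 h3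
    rw [h1, h2]
    exact Finset.sum_congr rfl fun i hi => by rw [h3 i hi]
  rw [h]
  exact Submodule.sum_mem _ fun i hi => Submodule.smul_mem _ _ (hA i hi)

theorem inner_indicatorConstLp_eq_integral {s : Set α} (hs : MeasurableSet s) (hμ : μ s ≠ ∞)
    (g : L2 μ) : ⟪indicatorConstLp 2 hs hμ (1 : ℂ), g⟫_ℂ = ∫ x in s, g x ∂μ := by
  rw [L2.inner_indicatorConstLp_eq_inner_setIntegral]
  simp

end Generic

section Span

variable {K : Type*} [Field K] [ValuativeRel K] [TopologicalSpace K] [IsNonarchimedeanLocalField K]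
  {ϖ : 𝒪[K]} {n : ℕ} [MeasurableSpace K] [BorelSpace K] (hϖ : Irreducible ϖ)
include hϖ

theorem exists_mem_fracIdeal (t : K) : ∃ m, t ∈ fracIdeal ϖ m := by
  have h : (fun x => x * t) ⁻¹' (𝒪[K] : Set K) ∈ nhds (0 : K) := by
    refine (continuous_id.mul continuous_const).continuousAt ?_
    simpa using isOpen_integers.mem_nhds (zero_mem 𝒪[K])
  obtain ⟨m, hm⟩ := exists_primePow_subset hϖ h
  exact ⟨m, hm ⟨1, one_mem _, (mul_one _).symm⟩⟩

theorem generateFrom_ballU (M : ℕ) :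
    (inferInstance : MeasurableSpace (U ϖ n)) =
      MeasurableSpace.generateFrom {s | ∃ m ≥ M, ∃ a : U ϖ n, s = ballU m a} := by
  apply le_antisymm
  · have h1 : (inferInstance : MeasurableSpace (U ϖ n)) = MeasurableSpace.comap incl (borel K) := by
      rw [← BorelSpace.measurable_eq (α := K)]
      exact measurableEmbedding_incl.comap_eq.symm
    rw [h1, borel, MeasurableSpace.comap_generateFrom]
    refine MeasurableSpace.generateFrom_le ?_
    rintro _ ⟨V, hV, rfl⟩
    have hVo : IsOpen (incl ⁻¹' V : Set (U ϖ n)) := IsOpen.preimage continuous_incl hV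
    -- an open set is the union of the countably many balls of small radius that it contains
    let I := Σ m : ℕ, 𝒪[K] ⧸ Ideal.span {ϖ ^ m}
    have : ∀ m, Finite (𝒪[K] ⧸ Ideal.span {ϖ ^ m}) := finite_quotient hϖ
    have hI : Countable I := inferInstance
    have : (incl ⁻¹' V : Set (U ϖ n)) =
        ⋃ i ∈ {i : I | M ≤ i.1 ∧ (residue i.1 ⁻¹' {i.2} : Set (U ϖ n)) ⊆ incl ⁻¹' V},
          (residue i.1 ⁻¹' {i.2} : Set (U ϖ n)) := by
      ext a
      rw [Set.mem_iUnion₂]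
      constructor
      · intro ha
        obtain ⟨m, hm⟩ := exists_ballU_subset hϖ (hVo.mem_nhds ha)
        refine ⟨⟨max m M, residue _ a⟩, ⟨le_max_right _ _, fun b hb => hm ?_⟩, rfl⟩
        exact ballU_anti (le_max_left m M) a (residue_eq_iff.1 hb)
      · rintro ⟨i, hi, ha⟩
        exact hi.2 ha
    rw [this]
    refine MeasurableSet.biUnion (Set.to_countable _) fun i hi => ?_
    by_cases hne : ∃ a : U ϖ n, residue i.1 a = i.2
    · obtain ⟨a, ha⟩ := hne
      refine MeasurableSpace.measurableSet_generateFrom ⟨i.1, hi.1, a, ?_⟩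
      ext b
      rw [← ha]
      exact residue_eq_iff
    · rw [show (residue i.1 ⁻¹' {i.2} : Set (U ϖ n)) = ∅ from
        Set.eq_empty_of_forall_notMem fun b hb => hne ⟨b, hb⟩]
      exact @MeasurableSet.empty _ (MeasurableSpace.generateFrom _)
  · refine MeasurableSpace.generateFrom_le ?_
    rintro _ ⟨m, -, a, rfl⟩
    exact measurableSet_ballU hϖ m a

theorem isPiSystem_ballU (M : ℕ) :
    IsPiSystem {s | ∃ m ≥ M, ∃ a : U ϖ n, s = ballU m a} := by
  have key : ∀ {m k : ℕ} (a b : U ϖ n), m ≤ k → (ballU m a ∩ ballU k b).Nonempty →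
      ballU m a ∩ ballU k b = ballU k b := by
    rintro m k a b h ⟨c, hc1, hc2⟩
    refine Set.inter_eq_right.2 ?_
    rw [← ballU_eq hc1, ← ballU_eq hc2]
    exact ballU_anti h c
  rintro _ ⟨m, hm, a, rfl⟩ _ ⟨k, hk, b, rfl⟩ hne
  rcases le_total m k with h | h
  · exact ⟨k, hk, b, key a b h hne⟩
  · rw [Set.inter_comm] at hne ⊢
    exact ⟨m, hm, a, key b a h hne⟩

/-- The indicator function of the ball `b + ϖᵐ 𝒪`. -/
def ballLp (m : ℕ) (b : U ϖ n) : L2 (haarU ϖ n) :=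
  indicatorConstLp 2 (measurableSet_ballU hϖ m b) (measure_ne_top _ _) 1

theorem isTotal_ballLp (M : ℕ) : IsTotal {f | ∃ m ≥ M, ∃ a : U ϖ n, f = ballLp hϖ m a} := by
  refine isTotal_iff.2 fun g hg => ?_
  have hint : Integrable g (haarU ϖ n) := (Lp.memLp g).integrable (by norm_num)
  have hball : ∀ m ≥ M, ∀ a : U ϖ n, ∫ x in ballU m a, g x ∂haarU ϖ n = 0 := by
    intro m hm a
    rw [← inner_indicatorConstLp_eq_integral (measurableSet_ballU hϖ m a) (measure_ne_top _ _)]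
    exact hg _ ⟨m, hm, a, rfl⟩
  have huniv : ∫ x, g x ∂haarU ϖ n = 0 := by
    have := finite_quotient hϖ M
    have := Fintype.ofFinite (𝒪[K] ⧸ Ideal.span {ϖ ^ M})
    have hr : ∀ q : 𝒪[K] ⧸ Ideal.span {ϖ ^ M}, MeasurableSet (residue M ⁻¹' {q} : Set (U ϖ n)) ∧
        ∫ x in (residue M ⁻¹' {q} : Set (U ϖ n)), g x ∂haarU ϖ n = 0 := by
      intro q
      by_cases hne : ∃ a : U ϖ n, residue M a = q
      · obtain ⟨a, ha⟩ := hne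
        have : (residue M ⁻¹' {q} : Set (U ϖ n)) = ballU M a := by
          ext b
          rw [← ha]
          exact residue_eq_iff
        rw [this]
        exact ⟨measurableSet_ballU hϖ M a, hball M le_rfl a⟩
      · rw [show (residue M ⁻¹' {q} : Set (U ϖ n)) = ∅ from
          Set.eq_empty_of_forall_notMem fun b hb => hne ⟨b, hb⟩]
        simp
    have h1 : (⋃ q : 𝒪[K] ⧸ Ideal.span {ϖ ^ M}, (residue M ⁻¹' {q} : Set (U ϖ n))) = Set.univ := by
      ext a
      simp
    rw [← setIntegral_univ, ← h1, integral_iUnion (fun q => (hr q).1) (fun q q' hq => ?_)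
      hint.integrableOn]
    · simp [hr]
    · exact Disjoint.preimage _ (Set.disjoint_singleton.2 hq)
  have hall : ∀ s : Set (U ϖ n), MeasurableSet s → ∫ x in s, g x ∂haarU ϖ n = 0 := by
    intro s hs
    induction s, hs using MeasurableSpace.induction_on_inter (generateFrom_ballU hϖ M)
      (isPiSystem_ballU hϖ M) with
    | empty => simp
    | basic u hu =>
      obtain ⟨m, hm, a, rfl⟩ := hu
      exact hball m hm a
    | compl u hu ih =>
      have := integral_add_compl hu hint
      rwa [ih, zero_add, huniv] at this
    | iUnion u hd hu ih =>
      rw [integral_iUnion hu hd hint.integrableOn]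
      simp [ih]
  exact Lp.eq_zero_iff_ae_eq_zero.2
    (hint.ae_eq_zero_of_forall_setIntegral_eq_zero fun s hs _ => hall s hs)

variable (Ψ : AddChar K Circle)

/-- The waves of level `m`. -/
def waveSet (m : ℕ) : Set (L2 (haarX ϖ n)) :=
  {f | ∃ b : U ϖ n, ∃ η ∈ primePow ϖ n, f = wave hϖ Ψ m b η}

variable {Ψ} (hΨ : ∀ x ∈ 𝒪[K], Ψ x = 1) (hΨ' : ∃ x : K, (ϖ : K) * x ∈ 𝒪[K] ∧ Ψ x ≠ 1)
include hΨ hΨ'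

open Classical in
/-- Orthogonality of characters: `y ↦ Ψ(ϖⁿ y z)` is a character of `𝒪 / ϖᵐ⁻ⁿ 𝒪`, trivial exactly if
`z ∈ ϖ⁻ⁿ 𝒪`. -/
theorem sum_char_eq {m : ℕ} [Fintype (𝒪[K] ⧸ Ideal.span {ϖ ^ (m - n)})] (hm : n ≤ m) {z : K}
    (hz : z ∈ fracIdeal ϖ m) :
    ∑ y : 𝒪[K] ⧸ Ideal.span {ϖ ^ (m - n)}, (Ψ ((ϖ : K) ^ n * (Quotient.out y : 𝒪[K]) * z) : ℂ) =
      if z ∈ fracIdeal ϖ n then (Nat.card 𝓀[K] : ℂ) ^ (m - n) else 0 := by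
  have hout : ∀ c : 𝒪[K], Ψ ((ϖ : K) ^ n * (Quotient.out
      (Ideal.Quotient.mk (Ideal.span {ϖ ^ (m - n)}) c) : 𝒪[K]) * z) = Ψ ((ϖ : K) ^ n * c * z) := by
    intro c
    refine char_congr hΨ ?_
    have : Ideal.Quotient.mk (Ideal.span {ϖ ^ (m - n)}) (Quotient.out (Ideal.Quotient.mk
        (Ideal.span {ϖ ^ (m - n)}) c)) = Ideal.Quotient.mk _ c := Quotient.out_eq _
    obtain ⟨d, hd⟩ := Ideal.mem_span_singleton.1 (Ideal.Quotient.eq.1 this)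
    have hd' : ((Quotient.out (Ideal.Quotient.mk (Ideal.span {ϖ ^ (m - n)}) c) : 𝒪[K]) : K) - c =
      (ϖ : K) ^ (m - n) * d := congrArg Subtype.val hd
    rw [← sub_mul, ← mul_sub, hd', ← mul_assoc, ← pow_add, Nat.add_sub_cancel' hm,
      mul_right_comm]
    exact mul_mem hz d.2
  split_ifs with h
  · have : ∀ y : 𝒪[K] ⧸ Ideal.span {ϖ ^ (m - n)},
        Ψ ((ϖ : K) ^ n * (Quotient.out y : 𝒪[K]) * z) = 1 := by
      intro y
      refine hΨ _ ?_
      rw [mul_right_comm]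
      exact mul_mem h (Subtype.property _)
    simp only [this, Circle.coe_one, Finset.sum_const, Finset.card_univ, nsmul_eq_mul, mul_one]
    rw [← Nat.card_eq_fintype_card, card_quotient hϖ]
    push_cast
    rfl
  · obtain ⟨_, ⟨c, hc, rfl⟩, hc1⟩ : ∃ x ∈ primePow ϖ n, Ψ (x * z) ≠ 1 := by
      by_contra! h1
      exact h (mem_fracIdeal_of_character hϖ Ψ hΨ' h1)
    set S := ∑ y : 𝒪[K] ⧸ Ideal.span {ϖ ^ (m - n)},
      (Ψ ((ϖ : K) ^ n * (Quotient.out y : 𝒪[K]) * z) : ℂ) with hS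
    have h2 : S = Ψ ((ϖ : K) ^ n * c * z) * S := by
      conv_lhs => rw [hS, ← Equiv.sum_comp (Equiv.addRight (Ideal.Quotient.mk _ ⟨c, hc⟩))]
      rw [hS, Finset.mul_sum]
      refine Finset.sum_congr rfl fun y _ => ?_
      obtain ⟨d, rfl⟩ := Ideal.Quotient.mk_surjective y
      rw [show Equiv.addRight (Ideal.Quotient.mk (Ideal.span {ϖ ^ (m - n)}) ⟨c, hc⟩)
        (Ideal.Quotient.mk _ d) = Ideal.Quotient.mk _ (d + ⟨c, hc⟩) from rfl, hout, hout, ← Circle.coe_mul,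
        ← AddChar.map_add_eq_mul]
      congr 2
      change (ϖ : K) ^ n * ((d : K) + c) * z = _
      ring
    by_contra h0
    have h3 : (Ψ ((ϖ : K) ^ n * c * z) : ℂ) = 1 :=
      mul_right_cancel₀ h0 (by rw [one_mul]; exact h2.symm)
    exact hc1 (Circle.coe_eq_one.1 h3)

open Classical in
/-- Fourier inversion on the finite group `ϖ⁻ᵐ 𝒪 / ϖ⁻ⁿ 𝒪`: the indicator functions of the cells
`(a + ϖᵐ 𝒪) × {s}` are combinations of waves. -/
theorem exists_cell {m : ℕ} (hm : n ≤ m) (a : U ϖ n) {s : Γ ϖ n} (hs : s ∈ latticeΓ ϖ n m) :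
    ∃ e ∈ Submodule.span ℂ (waveSet hϖ (n := n) Ψ m),
      e =ᵐ[haarX ϖ n] fun x => if x.1 ∈ ballU m a ∧ x.2 = s then 1 else 0 := by
  obtain ⟨t, ht, rfl⟩ := exists_mk_eq hs
  have := finite_quotient hϖ (m - n)
  have := Fintype.ofFinite (𝒪[K] ⧸ Ideal.span {ϖ ^ (m - n)})
  let ξ : 𝒪[K] ⧸ Ideal.span {ϖ ^ (m - n)} → K := fun y => (ϖ : K) ^ n * (Quotient.out y : 𝒪[K])
  have hξ : ∀ y, (incl a)⁻¹ * ξ y ∈ primePow ϖ n := fun y =>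
    incl_inv_mul_mem a ⟨_, Subtype.property _, rfl⟩
  let c : 𝒪[K] ⧸ Ideal.span {ϖ ^ (m - n)} → ℂ := fun y =>
    ((Nat.card 𝓀[K] : ℂ) ^ (m - n))⁻¹ * Ψ (ξ y * -t)
  let e : 𝒪[K] ⧸ Ideal.span {ϖ ^ (m - n)} → L2 (haarX ϖ n) := fun y =>
    wave hϖ Ψ m a ((incl a)⁻¹ * ξ y)
  have hq : ((Nat.card 𝓀[K] : ℂ) ^ (m - n)) ≠ 0 :=
    pow_ne_zero _ (Nat.cast_ne_zero.2 (card_residueField_pos hϖ).ne')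
  have hsum : ∀ x : X ϖ n, ∑ y, c y * waveFun Ψ m a ((incl a)⁻¹ * ξ y) x =
      if x.1 ∈ ballU m a ∧ x.2 = Γ.mk ϖ n t then 1 else 0 := by
    intro x
    obtain ⟨b, s⟩ := x
    obtain ⟨r, rfl⟩ := Γ.mk_surjective s
    change ∑ y, c y * waveFun Ψ m a ((incl a)⁻¹ * ξ y) (X.mk b (Γ.mk ϖ n r)) =
      if incl b - incl a ∈ primePow ϖ m ∧ Γ.mk ϖ n r = Γ.mk ϖ n t then 1 else 0
    simp only [fun y => waveFun_mk hΨ hm a (hξ y) b r]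
    by_cases h : incl b - incl a ∈ primePow ϖ m ∧ r ∈ fracIdeal ϖ m
    · have h1 := sum_char_eq hϖ hΨ hΨ' hm (sub_mem h.2 ht)
      simp only [h, and_self, if_true, true_and, Γ.mk_eq_mk]
      have h2 : ∀ y, c y * (Ψ (incl a * ((incl a)⁻¹ * ξ y) * r) : ℂ) =
          ((Nat.card 𝓀[K] : ℂ) ^ (m - n))⁻¹ * Ψ (ξ y * (r - t)) := by
        intro y
        simp only [c]
        rw [mul_inv_cancel_left₀ (incl_ne_zero a), mul_assoc, ← Circle.coe_mul,
          ← AddChar.map_add_eq_mul]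
        congr 3
        ring
      rw [Finset.sum_congr rfl fun y _ => h2 y, ← Finset.mul_sum, h1]
      split_ifs
      · exact inv_mul_cancel₀ hq
      · exact mul_zero _
    · simp only [h, if_false, mul_zero, Finset.sum_const_zero]
      refine (if_neg fun h' => h ⟨h'.1, ?_⟩).symm
      have := add_mem (fracIdeal_mono hm (Γ.mk_eq_mk.1 h'.2)) ht
      simpa using this
  refine ⟨∑ y, c y • e y, Submodule.sum_mem _ fun y _ => Submodule.smul_mem _ _
    (Submodule.subset_span ⟨a, _, hξ y, rfl⟩), ?_⟩
  filter_upwards [coeFn_sum_smul Finset.univ c e,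
    Finset.univ.eventually_all.2 fun y _ => coeFn_wave hϖ Ψ m a ((incl a)⁻¹ * ξ y)] with x h1 h2
  rw [h1, ← hsum]
  exact Finset.sum_congr rfl fun y hy => by rw [← h2 y hy]

/-- The waves of all levels are total in `L²(X_n)`. -/
theorem isTotal_waves : IsTotal {f | ∃ m ≥ n, f ∈ waveSet hϖ (n := n) Ψ m} := by
  classical
  let δ : Γ ϖ n → L2 (Measure.count : Measure (Γ ϖ n)) := fun s =>
    indicatorConstLp 2 (MeasurableSet.of_discrete (s := {s})) (by simp) 1
  have hδ : IsTotal (Set.range δ) := by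
    refine isTotal_iff.2 fun g hg => Lp.eq_zero_iff_ae_eq_zero.2 (.of_forall fun s => ?_)
    have := hg _ ⟨s, rfl⟩
    rw [inner_indicatorConstLp_eq_integral] at this
    simpa using this
  have hex : ∀ s : Γ ϖ n, ∃ M ≥ n, ∀ m ≥ M, s ∈ latticeΓ ϖ n m := by
    intro s
    obtain ⟨t, rfl⟩ := Γ.mk_surjective s
    obtain ⟨k, hk⟩ := exists_mem_fracIdeal hϖ t
    exact ⟨max k n, le_max_right _ _, fun m hm =>
      ⟨t, fracIdeal_mono ((le_max_left _ _).trans hm) hk, rfl⟩⟩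
  have h := isTotal_tmulFun (μ := haarU ϖ n) (ν := (Measure.count : Measure (Γ ϖ n)))
    (A' := fun b => {f | ∃ s m, ∃ a : U ϖ n, b = δ s ∧ n ≤ m ∧ s ∈ latticeΓ ϖ n m ∧
      f = ballLp hϖ m a}) hδ (by
    rintro _ ⟨s, rfl⟩
    obtain ⟨M, hM, hs⟩ := hex s
    refine IsTotal.of_subset_span (B := {f | ∃ s' m, ∃ a : U ϖ n, δ s = δ s' ∧ n ≤ m ∧
      s' ∈ latticeΓ ϖ n m ∧ f = ballLp hϖ m a}) (isTotal_ballLp hϖ M) ?_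
    rintro _ ⟨m, hm, a, rfl⟩
    refine Submodule.subset_span ?_
    exact ⟨s, m, a, rfl, le_trans hM hm, hs m hm, rfl⟩)
  refine IsTotal.of_subset_span (H := L2 (haarX ϖ n)) h ?_
  rintro _ ⟨b, hb, _, ⟨s, m, a, rfl, hm, hs, rfl⟩, rfl⟩
  obtain ⟨e, he, he'⟩ := exists_cell hϖ hΨ hΨ' hm a hs
  have : tmulFun (haarU ϖ n) Measure.count (ballLp hϖ m a) (δ s) = e := by
    apply Lp.ext
    refine Filter.EventuallyEq.trans ?_ he'.symm
    filter_upwards [coeFn_tmulFun (haarU ϖ n) Measure.count (ballLp hϖ m a) (δ s),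
      ae_fst (haarU ϖ n) (Measure.count : Measure (Γ ϖ n)) (indicatorConstLp_coeFn (p := 2)
        (hs := measurableSet_ballU hϖ m a) (hμs := measure_ne_top _ _) (c := (1 : ℂ))),
      ae_snd (haarU ϖ n) (Measure.count : Measure (Γ ϖ n)) (indicatorConstLp_coeFn (p := 2)
        (hs := MeasurableSet.of_discrete (s := {s})) (hμs := by simp) (c := (1 : ℂ)))]
      with x h1 h2 h3
    rw [h1]
    refine (congrArg₂ (· * ·) h2 h3).trans ?_
    by_cases hx1 : x.1 ∈ ballU m a <;> by_cases hx2 : x.2 = s <;> simp [hx1, hx2]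
  rw [this]
  have hsub : waveSet hϖ (n := n) Ψ m ⊆ {f | ∃ m ≥ n, f ∈ waveSet hϖ (n := n) Ψ m} :=
    fun f hf => ⟨m, hm, hf⟩
  exact Submodule.span_mono hsub he

end Span

/-! ### Bruhat test functions and integrals of waves -/

section Bruhat

variable {K : Type*} [Field K] [ValuativeRel K] [TopologicalSpace K] [IsNonarchimedeanLocalField K]
  {ϖ : 𝒪[K]} {n : ℕ} [MeasurableSpace K] [BorelSpace K] (hϖ : Irreducible ϖ)
include hϖ

/-- The points `z` and `z'` have congruent components modulo `ϖᵐ` in `U_n`, and equal ones in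
`Γ_n`. -/
def SameCell (m : ℕ) (z z' : X ϖ n × X ϖ n) : Prop :=
  (z.1.1 ∈ ballU m z'.1.1 ∧ z.1.2 = z'.1.2) ∧ z.2.1 ∈ ballU m z'.2.1 ∧ z.2.2 = z'.2.2

theorem sameCell_mem_nhds (m : ℕ) (z : X ϖ n × X ϖ n) : {w | SameCell m w z} ∈ nhds z := by
  have h : ∀ x : X ϖ n, {y : X ϖ n | y.1 ∈ ballU m x.1 ∧ y.2 = x.2} ∈ nhds x := fun x =>
    prod_mem_nhds ((isOpen_ballU hϖ m x.1).mem_nhds (mem_ballU_self m x.1))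
      ((isOpen_discrete {x.2}).mem_nhds rfl)
  exact prod_mem_nhds (h z.1) (h z.2)

theorem exists_sameCell_subset {z : X ϖ n × X ϖ n} {s : Set (X ϖ n × X ϖ n)} (hs : s ∈ nhds z) :
    ∃ m, ∀ w, SameCell m w z → w ∈ s := by
  have h : ∀ {x : X ϖ n} {t : Set (X ϖ n)}, t ∈ nhds x →
      ∃ m, ∀ y : X ϖ n, y.1 ∈ ballU m x.1 → y.2 = x.2 → y ∈ t := by
    intro x t ht
    obtain ⟨u, hu, v, hv, huv⟩ := (mem_nhds_prod_iff (X := U ϖ n) (Y := Γ ϖ n)).1 ht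
    obtain ⟨m, hm⟩ := exists_ballU_subset hϖ hu
    refine ⟨m, fun y h1 h2 => huv ⟨hm h1, ?_⟩⟩
    rw [h2]
    exact mem_of_mem_nhds hv
  obtain ⟨u, hu, v, hv, huv⟩ := mem_nhds_prod_iff.1 hs
  obtain ⟨m, hm⟩ := h hu
  obtain ⟨k, hk⟩ := h hv
  refine ⟨max m k, fun w hw => huv ⟨hm _ ?_ hw.1.2, hk _ ?_ hw.2.2⟩⟩
  · exact ballU_anti (le_max_left _ _) _ hw.1.1
  · exact ballU_anti (le_max_right _ _) _ hw.2.1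

/-- A locally constant function with compact support is constant on the cells modulo `ϖᵐ`, and
supported in `(U_n × ϖ⁻ᵐ 𝒪 / ϖ⁻ⁿ 𝒪)²`, for all large `m`. -/
theorem exists_level {f : X ϖ n × X ϖ n → ℂ} (hf : IsLocallyConstant f)
    (hc : HasCompactSupport f) :
    ∃ M, ∀ m ≥ M, (∀ z, f z ≠ 0 → z.1.2 ∈ latticeΓ ϖ n m ∧ z.2.2 ∈ latticeΓ ϖ n m) ∧
      ∀ z w, SameCell m w z → f w = f z := by
  have key : ∃ M, ∀ m ≥ M, ∀ z ∈ tsupport f, (z.1.2 ∈ latticeΓ ϖ n m ∧ z.2.2 ∈ latticeΓ ϖ n m) ∧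
      ∀ w, SameCell m w z → f w = f z := by
    refine IsCompact.induction_on (p := fun s => ∃ M, ∀ m ≥ M, ∀ z ∈ s,
      (z.1.2 ∈ latticeΓ ϖ n m ∧ z.2.2 ∈ latticeΓ ϖ n m) ∧ ∀ w, SameCell m w z → f w = f z)
      hc ⟨0, by simp⟩ ?_ ?_ ?_
    · rintro s t hst ⟨M, hM⟩
      exact ⟨M, fun m hm z hz => hM m hm z (hst hz)⟩
    · rintro s t ⟨M, hM⟩ ⟨N, hN⟩
      refine ⟨max M N, fun m hm z hz => hz.elim (hM m ?_ z) (hN m ?_ z)⟩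
      · exact (le_max_left _ _).trans hm
      · exact (le_max_right _ _).trans hm
    · intro z _
      obtain ⟨k, hk⟩ := exists_sameCell_subset hϖ ((hf.isOpen_fiber (f z)).mem_nhds rfl)
      obtain ⟨t₁, ht₁⟩ := Γ.mk_surjective z.1.2
      obtain ⟨t₂, ht₂⟩ := Γ.mk_surjective z.2.2
      obtain ⟨k₁, hk₁⟩ := exists_mem_fracIdeal hϖ t₁
      obtain ⟨k₂, hk₂⟩ := exists_mem_fracIdeal hϖ t₂
      refine ⟨_, mem_nhdsWithin_of_mem_nhds (sameCell_mem_nhds hϖ k z), max k (max k₁ k₂), ?_⟩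
      intro m hm w hw
      have hkm : k ≤ m := (le_max_left _ _).trans hm
      have hk₁m : k₁ ≤ m := ((le_max_left _ _).trans (le_max_right _ _)).trans hm
      have hk₂m : k₂ ≤ m := ((le_max_right _ _).trans (le_max_right _ _)).trans hm
      refine ⟨⟨?_, ?_⟩, fun w' hw' => ?_⟩
      · rw [hw.1.2, ← ht₁]
        exact ⟨t₁, fracIdeal_mono hk₁m hk₁, rfl⟩
      · rw [hw.2.2, ← ht₂]
        exact ⟨t₂, fracIdeal_mono hk₂m hk₂, rfl⟩
      · have h1 : f w = f z := hk w hw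
        have h2 : f w' = f z := hk w' ⟨⟨?_, hw'.1.2.trans hw.1.2⟩, ?_, hw'.2.2.trans hw.2.2⟩
        · rw [h1, h2]
        · rw [← ballU_eq hw.1.1]
          exact ballU_anti hkm _ hw'.1.1
        · rw [← ballU_eq hw.2.1]
          exact ballU_anti hkm _ hw'.2.1
  obtain ⟨M, hM⟩ := key
  refine ⟨M, fun m hm => ⟨fun z hz => (hM m hm z (subset_tsupport f hz)).1, fun z w hzw => ?_⟩⟩
  by_cases hz : z ∈ tsupport f
  · exact (hM m hm z hz).2 w hzw
  by_cases hw : w ∈ tsupport f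
  · refine ((hM m hm w hw).2 z ⟨⟨?_, hzw.1.2.symm⟩, ?_, hzw.2.2.symm⟩).symm
    · rw [ballU_eq hzw.1.1]
      exact mem_ballU_self m _
    · rw [ballU_eq hzw.2.1]
      exact mem_ballU_self m _
  · rw [image_eq_zero_of_notMem_tsupport hz, image_eq_zero_of_notMem_tsupport hw]

theorem isLocallyConstant_waveFun (Ψ : AddChar K Circle) (m : ℕ) (b : U ϖ n) (η : K) :
    IsLocallyConstant (waveFun (n := n) Ψ m b η) := by
  refine (IsLocallyConstant.iff_eventually_eq _).2 fun x => ?_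
  have h : {y : X ϖ n | y.1 ∈ ballU m x.1 ∧ y.2 = x.2} ∈ nhds x :=
    prod_mem_nhds ((isOpen_ballU hϖ m x.1).mem_nhds (mem_ballU_self m x.1))
      ((isOpen_discrete {x.2}).mem_nhds rfl)
  filter_upwards [h] with y hy
  have h1 : y.1 ∈ ballU m b ↔ x.1 ∈ ballU m b := by
    rw [← residue_eq_iff, ← residue_eq_iff, residue_eq_iff.2 hy.1]
  rw [waveFun, waveFun, h1, hy.2]

theorem isBruhat_tmulFun_wave (hn : 1 ≤ n) (Ψ : AddChar K Circle) (m m' : ℕ) (b b' : U ϖ n)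
    (η η' : K) :
    IsBruhat (tmulFun (haarX ϖ n) (haarX ϖ n) (wave hϖ Ψ m b η) (wave hϖ Ψ m' b' η')) := by
  have := compactSpace_U (n := n) hϖ hn
  refine ⟨fun z => waveFun Ψ m b η z.1 * waveFun Ψ m' b' η' z.2, ?_, ?_, ?_⟩
  · exact ((isLocallyConstant_waveFun hϖ Ψ m b η).comp_continuous continuous_fst).mul
      ((isLocallyConstant_waveFun hϖ Ψ m' b' η').comp_continuous continuous_snd)
  · have h1 : ∀ k, IsCompact {x : X ϖ n | x.2 ∈ latticeΓ ϖ n k} ∧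
        IsClosed {x : X ϖ n | x.2 ∈ latticeΓ ϖ n k} := by
      intro k
      constructor
      · have : IsCompact ((Set.univ : Set (U ϖ n)) ×ˢ (latticeΓ ϖ n k : Set (Γ ϖ n))) :=
          isCompact_univ.prod (finite_latticeΓ hϖ k).isCompact
        rwa [Set.univ_prod] at this
      · exact (isClosed_discrete (latticeΓ ϖ n k : Set (Γ ϖ n))).preimage
          (continuous_snd (X := U ϖ n))
    refine HasCompactSupport.intro' ((h1 m).1.prod (h1 m').1) ((h1 m).2.prod (h1 m').2) ?_
    intro z hz
    rw [Set.mem_prod, not_and_or] at hz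
    rcases hz with hz | hz
    · rw [show waveFun Ψ m b η z.1 = 0 from if_neg fun h => hz h.2, zero_mul]
    · rw [show waveFun Ψ m' b' η' z.2 = 0 from if_neg fun h => hz h.2, mul_zero]
  · filter_upwards [coeFn_tmulFun (haarX ϖ n) (haarX ϖ n) (wave hϖ Ψ m b η) (wave hϖ Ψ m' b' η'),
      ae_fst (haarX ϖ n) (haarX ϖ n) (coeFn_wave hϖ Ψ m b η),
      ae_snd (haarX ϖ n) (haarX ϖ n) (coeFn_wave hϖ Ψ m' b' η')] with z h1 h2 h3
    rw [h1, h2, h3]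

variable (Ψ : AddChar K Circle)

/-- The tensor products of two waves of level `m`. -/
def wavePairs (m : ℕ) : Set (L2 ((haarX ϖ n).prod (haarX ϖ n))) :=
  Set.image2 (tmulFun (haarX ϖ n) (haarX ϖ n)) (waveSet hϖ Ψ m) (waveSet hϖ Ψ m)

variable {Ψ} (hΨ : ∀ x ∈ 𝒪[K], Ψ x = 1) (hΨ' : ∃ x : K, (ϖ : K) * x ∈ 𝒪[K] ∧ Ψ x ≠ 1)
include hΨ hΨ'

open Classical in
theorem exists_residue_cell {m : ℕ} (hm : n ≤ m) (q : 𝒪[K] ⧸ Ideal.span {ϖ ^ m}) {s : Γ ϖ n}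
    (hs : s ∈ latticeΓ ϖ n m) :
    ∃ e ∈ Submodule.span ℂ (waveSet hϖ (n := n) Ψ m),
      e =ᵐ[haarX ϖ n] fun x => if residue m x.1 = q ∧ x.2 = s then 1 else 0 := by
  by_cases h : ∃ a : U ϖ n, residue m a = q
  · obtain ⟨a, rfl⟩ := h
    simp only [residue_eq_iff]
    exact exists_cell hϖ hΨ hΨ' hm a hs
  · refine ⟨0, zero_mem _, (Lp.coeFn_zero ℂ 2 _).trans (.of_forall fun x => ?_)⟩
    exact (if_neg fun h1 => h ⟨x.1, h1.1⟩).symm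

/-- Every Bruhat test function is a finite linear combination of products of waves of level `m`, for
all large `m`. -/
theorem mem_span_of_isBruhat {f : L2 ((haarX ϖ n).prod (haarX ϖ n))} (hf : IsBruhat f) :
    ∃ M, ∀ m ≥ M, n ≤ m → f ∈ Submodule.span ℂ (wavePairs hϖ (n := n) Ψ m) := by
  classical
  obtain ⟨f₀, hlc, hcs, hff⟩ := hf
  obtain ⟨M, hM⟩ := exists_level hϖ hlc hcs
  refine ⟨M, fun m hm hnm => ?_⟩
  obtain ⟨hsupp, hcell⟩ := hM m hm
  have := finite_quotient hϖ m
  have := Fintype.ofFinite (𝒪[K] ⧸ Ideal.span {ϖ ^ m})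
  let Q := 𝒪[K] ⧸ Ideal.span {ϖ ^ m}
  let π : X ϖ n × X ϖ n → (Q × Γ ϖ n) × (Q × Γ ϖ n) := fun z =>
    ((residue m z.1.1, z.1.2), (residue m z.2.1, z.2.2))
  have hπ : Function.FactorsThrough f₀ π := by
    intro z w h
    simp only [π, Prod.mk.injEq] at h
    exact hcell w z ⟨⟨residue_eq_iff.1 h.1.1, h.1.2⟩, residue_eq_iff.1 h.2.1, h.2.2⟩
  let f₁ := Function.extend π f₀ 0
  have hf₁ : ∀ z, f₁ (π z) = f₀ z := fun z => hπ.extend_apply 0 z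
  let L := (Finset.univ : Finset Q) ×ˢ (finite_latticeΓ (n := n) hϖ m).toFinset
  have hL : ∀ p ∈ L, p.2 ∈ latticeΓ ϖ n m := by
    intro p hp
    simpa [L] using hp
  choose! e he hee using fun (p : Q × Γ ϖ n) (hp : p ∈ L) =>
    exists_residue_cell hϖ hΨ hΨ' hnm p.1 (hL p hp)
  let g : Q × Γ ϖ n → X ϖ n → ℂ := fun p x => if residue m x.1 = p.1 ∧ x.2 = p.2 then 1 else 0
  refine mem_span_of_ae_eq_sum (L ×ˢ L) f₁ (fun p => tmulFun _ _ (e p.1) (e p.2))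
    (fun p z => g p.1 z.1 * g p.2 z.2) (fun p hp => ?_) (fun p hp => ?_)
    (hff.trans (.of_forall fun z => ?_))
  · rw [Finset.mem_product] at hp
    filter_upwards [coeFn_tmulFun (haarX ϖ n) (haarX ϖ n) (e p.1) (e p.2),
      ae_fst (haarX ϖ n) (haarX ϖ n) (hee p.1 hp.1),
      ae_snd (haarX ϖ n) (haarX ϖ n) (hee p.2 hp.2)] with z h1 h2 h3
    rw [h1, h2, h3]
  · rw [Finset.mem_product] at hp
    exact tmulFun_mem_span (he p.1 hp.1) (he p.2 hp.2)
  · have hg : ∀ p : (Q × Γ ϖ n) × (Q × Γ ϖ n), f₁ p * (g p.1 z.1 * g p.2 z.2) =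
        if p = π z then f₀ z else 0 := by
      intro p
      by_cases hp : p = π z
      · rw [if_pos hp, hp, hf₁]
        simp [g, π]
      · rw [if_neg hp]
        have : ¬ ((residue m z.1.1 = p.1.1 ∧ z.1.2 = p.1.2) ∧
            (residue m z.2.1 = p.2.1 ∧ z.2.2 = p.2.2)) := by
          rintro ⟨⟨h1, h2⟩, h3, h4⟩
          exact hp (by ext1 <;> ext1 <;> simp [π, *])
        by_cases h1 : residue m z.1.1 = p.1.1 ∧ z.1.2 = p.1.2
        · have h2 : ¬ (residue m z.2.1 = p.2.1 ∧ z.2.2 = p.2.2) := fun h => this ⟨h1, h⟩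
          simp only [g, h2, if_false, mul_zero]
        · simp only [g, h1, if_false, zero_mul, mul_zero]
    change f₀ z = ∑ p ∈ L ×ˢ L, f₁ p * (g p.1 z.1 * g p.2 z.2)
    rw [Finset.sum_congr rfl fun p _ => hg p, Finset.sum_ite_eq']
    split_ifs with h
    · rfl
    · by_contra h0
      refine h ?_
      have := hsupp z h0
      simp [L, π, this.1, this.2]

/-- The products of two waves of the same level are total in `L²(X_n × X_n)`. -/
theorem isTotal_wavePairs (hn : 1 ≤ n) :
    IsTotal {f | ∃ m ≥ n, f ∈ wavePairs hϖ (n := n) Ψ m} := by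
  have h := isTotal_waves hϖ (n := n) hΨ hΨ'
  refine (isTotal_image2_tmulFun h h).of_subset_span ?_
  rintro _ ⟨_, ⟨m, hm, b, η, hη, rfl⟩, _, ⟨m', hm', b', η', hη', rfl⟩, rfl⟩
  obtain ⟨M, hM⟩ := mem_span_of_isBruhat hϖ hΨ hΨ' (isBruhat_tmulFun_wave hϖ hn Ψ m m' b b' η η')
  have hsub : wavePairs hϖ (n := n) Ψ (max M n) ⊆ {f | ∃ m ≥ n, f ∈ wavePairs hϖ (n := n) Ψ m} :=
    fun f hf => ⟨_, le_max_right _ _, hf⟩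
  exact Submodule.span_mono hsub (hM _ (le_max_left _ _) (le_max_right _ _))

end Bruhat

section Integrals

variable {K : Type*} [Field K] [ValuativeRel K] [TopologicalSpace K] [IsNonarchimedeanLocalField K]
  {ϖ : 𝒪[K]} {n : ℕ} [MeasurableSpace K] [BorelSpace K] (hϖ : Irreducible ϖ)
include hϖ

theorem integrable_waveFun (Ψ : AddChar K Circle) (m : ℕ) (b : U ϖ n) (η : K) :
    Integrable (waveFun (n := n) Ψ m b η) (haarX ϖ n) := by
  have h := (memLp_waveFun hϖ Ψ m b η).integrable_mul (memLp_waveFun hϖ Ψ m b 0)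
  refine h.congr (.of_forall fun x => ?_)
  by_cases hx : x.1 ∈ ballU m b ∧ x.2 ∈ latticeΓ ϖ n m
  · simp [waveFun, hx]
  · simp [waveFun, hx]

/-- The normalization: the set `(1 + ϖᵐ 𝒪) × ϖ⁻ᵐ 𝒪 / ϖ⁻ⁿ 𝒪` has the volume `q⁻ᵐ qᵐ⁻ⁿ`. -/
theorem card_pow_mul_gram_self (hn : 1 ≤ n) (Ψ : AddChar K Circle) {m : ℕ} (hm : n ≤ m) :
    (Nat.card 𝓀[K] : ℂ) ^ n * gram hϖ (n := n) Ψ m m = 1 := by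
  let S : Set (X ϖ n) := ballU m 1 ×ˢ (latticeΓ ϖ n m : Set (Γ ϖ n))
  have hS : MeasurableSet S := (measurableSet_ballU hϖ m 1).prod MeasurableSet.of_discrete
  have hv : (Nat.card 𝓀[K] : ℝ≥0∞) ^ n * haarX ϖ n S = 1 := by
    have h1 : haarX ϖ n S = haarU ϖ n (ballU m 1) *
        Measure.count (latticeΓ ϖ n m : Set (Γ ϖ n)) := Measure.prod_prod _ _
    have h2 : Measure.count (latticeΓ ϖ n m : Set (Γ ϖ n)) =
        (Nat.card 𝓀[K] : ℝ≥0∞) ^ (m - n) := by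
      rw [Measure.count_apply_finite _ (finite_latticeΓ hϖ m), ← Nat.card_eq_card_finite_toFinset,
        SetLike.coe_sort_coe, card_latticeΓ hϖ hm]
      push_cast
      rfl
    have h3 := haarK_primePow hϖ m
    rw [h1, haarU_ballU hϖ hn hm, h2, mul_comm (haarK K _), ← mul_assoc, ← pow_add,
      Nat.add_sub_cancel' hm, h3]
  have h4 : gram hϖ (n := n) Ψ m m = ((haarX ϖ n).real S : ℂ) := by
    rw [gram, inner_wave_eq_integral]
    rw [← integral_indicator_one hS, ← integral_complex_ofReal]
    refine integral_congr_ae (.of_forall fun x => ?_)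
    by_cases hx : x.1 ∈ ballU m 1 ∧ x.2 ∈ latticeΓ ϖ n m
    · have : x ∈ S := hx
      simp [waveFun, hx, this]
    · have : x ∉ S := hx
      simp [waveFun, hx, this]
  rw [h4, Measure.real]
  have := congrArg ENNReal.toReal hv
  rw [ENNReal.toReal_mul, ENNReal.toReal_pow, ENNReal.toReal_natCast, ENNReal.toReal_one] at this
  exact_mod_cast this

variable {Ψ : AddChar K Circle} (hΨ : ∀ x ∈ 𝒪[K], Ψ x = 1)
  (hΨ' : ∃ x : K, (ϖ : K) * x ∈ 𝒪[K] ∧ Ψ x ≠ 1)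
include hΨ hΨ'

open Classical in
/-- The integral is the inner product with the wave of frequency zero on the same set. -/
theorem integral_waveFun {m : ℕ} (hm : n ≤ m) (b : U ϖ n) {η : K} (hη : η ∈ primePow ϖ n) :
    ∫ x, waveFun Ψ m b η x ∂haarX ϖ n =
      if η ∈ primePow ϖ m then gram hϖ (n := n) Ψ m m else 0 := by
  have h := inner_wave hϖ hΨ hΨ' hm le_rfl b b (zero_mem (primePow ϖ n)) hη
  rw [inner_wave_eq_integral] at h
  simp only [sub_self, zero_mem, zero_sub, neg_mem_iff, true_and] at h
  rw [← h]
  refine integral_congr_ae (.of_forall fun x => ?_)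
  by_cases hx : x.1 ∈ ballU m b ∧ x.2 ∈ latticeΓ ϖ n m
  · simp [waveFun, hx]
  · simp [waveFun, hx]

end Integrals

/-! ### The inverse of the twist -/

section Twist

variable {K : Type*} [Field K] [ValuativeRel K] [TopologicalSpace K] [IsNonarchimedeanLocalField K]
  {ϖ : 𝒪[K]} {n : ℕ}

theorem mul_sub_mul_mem {m : ℕ} {x x' y y' : K} (hx : x - x' ∈ primePow ϖ m)
    (hy : y - y' ∈ primePow ϖ m) (hyO : y ∈ 𝒪[K]) (hxO : x' ∈ 𝒪[K]) :
    x * y - x' * y' ∈ primePow ϖ m := by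
  have h := add_mem (mul_mem_primePow hx hyO) (mul_mem_primePow hy hxO)
  refine mem_primePow_of_dvd h (one_mem _) (by ring)

theorem inv_sub_inv_mem {m : ℕ} {a b : U ϖ n} (h : incl a - incl b ∈ primePow ϖ m) :
    (incl a)⁻¹ - (incl b)⁻¹ ∈ primePow ϖ m := by
  have ha := incl_ne_zero a
  have hb := incl_ne_zero b
  refine mem_primePow_of_dvd h (neg_mem (mul_mem (inv_incl_mem a) (inv_incl_mem b))) ?_
  field_simp
  ring

variable (hϖ : Irreducible ϖ) (h2 : IsUnit (2 : 𝒪[K])) (hn : 1 ≤ n)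
include hϖ h2 hn

/-- The change of variables of the twist preserves and reflects congruences modulo `ϖᵐ`. -/
theorem twist_congr_iff {m : ℕ} {b₁ b₂ a b b₁' b₂' a' b' : U ϖ n} :
    ((incl (b₁ * b⁻¹) - incl (b₁' * b'⁻¹) ∈ primePow ϖ m ∧
      phi a * incl b - phi a' * incl b' ∈ primePow ϖ m) ∧
      incl (a * b₂) - incl (a' * b₂') ∈ primePow ϖ m ∧
      phi b * (incl a)⁻¹ - phi b' * (incl a')⁻¹ ∈ primePow ϖ m) ↔
    ((incl b₁ - incl b₁' ∈ primePow ϖ m ∧ phi a - phi a' ∈ primePow ϖ m) ∧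
      incl b₂ - incl b₂' ∈ primePow ϖ m ∧ phi b - phi b' ∈ primePow ϖ m) := by
  have hφ : ∀ c : U ϖ n, phi c ∈ 𝒪[K] := fun c => primePow_le_integers (phi_mem c)
  constructor
  · rintro ⟨⟨h1, h3⟩, h4, h5⟩
    obtain ⟨ha, hb⟩ := twist_reflects hϖ h2 hn h3 h5
    refine ⟨⟨?_, (phi_sub_mem_iff hϖ h2 hn).2 ha⟩, ?_, (phi_sub_mem_iff hϖ h2 hn).2 hb⟩
    · have := mul_sub_mul_mem h1 hb (incl_mem _) (incl_mem _)
      rwa [← incl_mul, ← incl_mul, inv_mul_cancel_right, inv_mul_cancel_right] at this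
    · have := mul_sub_mul_mem h4 (inv_sub_inv_mem ha) (inv_incl_mem _) (incl_mem _)
      rwa [← incl_inv, ← incl_inv, ← incl_mul, ← incl_mul, mul_comm _ a⁻¹, mul_comm _ a'⁻¹,
        inv_mul_cancel_left, inv_mul_cancel_left] at this
  · rintro ⟨⟨h1, h3⟩, h4, h5⟩
    have ha := (phi_sub_mem_iff hϖ h2 hn).1 h3
    have hb := (phi_sub_mem_iff hϖ h2 hn).1 h5
    refine ⟨⟨?_, ?_⟩, ?_, ?_⟩
    · rw [incl_mul, incl_mul, incl_inv, incl_inv]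
      exact mul_sub_mul_mem h1 (inv_sub_inv_mem hb) (inv_incl_mem _) (incl_mem _)
    · exact mul_sub_mul_mem h3 hb (incl_mem _) (hφ _)
    · rw [incl_mul, incl_mul]
      exact mul_sub_mul_mem ha h4 (incl_mem _) (incl_mem _)
    · exact mul_sub_mul_mem h5 (inv_sub_inv_mem ha) (inv_incl_mem _) (hφ _)

variable [MeasurableSpace K] [BorelSpace K]

variable (Ψ : AddChar K Circle)

omit h2 hn in
/-- The vector `wave ⊗ wave` in `L²(X_n × X_n)`. -/
def wavePair (m : ℕ) (b₁ : U ϖ n) (η₁ : K) (b₂ : U ϖ n) (η₂ : K) :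
    L2 ((haarX ϖ n).prod (haarX ϖ n)) :=
  tmulFun (haarX ϖ n) (haarX ϖ n) (wave hϖ Ψ m b₁ η₁) (wave hϖ Ψ m b₂ η₂)

omit h2 hn in
/-- The substitution of parameters by which the inverse of the twist acts on the products of two
waves. -/
def IsInverseTwist (G : L2 ((haarX ϖ n).prod (haarX ϖ n)) →
    L2 ((haarX ϖ n).prod (haarX ϖ n))) : Prop :=
  ∀ m ≥ n, ∀ b₁ a b₂ b : U ϖ n, G (wavePair hϖ Ψ m b₁ (phi a) b₂ (phi b)) =
    wavePair hϖ Ψ m (b₁ * b⁻¹) (phi a * incl b) (a * b₂) (phi b * (incl a)⁻¹)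

variable {Ψ} (hΨ : ∀ x ∈ 𝒪[K], Ψ x = 1) (hΨ' : ∃ x : K, (ϖ : K) * x ∈ 𝒪[K] ∧ Ψ x ≠ 1)
include hΨ hΨ'

omit h2 hn in
open Classical in
theorem inner_wavePair {m m' : ℕ} (hm : n ≤ m) (hmm : m ≤ m') (b₁ b₂ b₁' b₂' : U ϖ n)
    {η₁ η₂ η₁' η₂' : K} (h₁ : η₁ ∈ primePow ϖ n) (h₂ : η₂ ∈ primePow ϖ n)
    (h₁' : η₁' ∈ primePow ϖ n) (h₂' : η₂' ∈ primePow ϖ n) :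
    ⟪wavePair hϖ Ψ m b₁ η₁ b₂ η₂, wavePair hϖ Ψ m' b₁' η₁' b₂' η₂'⟫_ℂ =
      if (incl b₁ - incl b₁' ∈ primePow ϖ m ∧ η₁ - η₁' ∈ primePow ϖ m) ∧
        (incl b₂ - incl b₂' ∈ primePow ϖ m ∧ η₂ - η₂' ∈ primePow ϖ m)
      then gram hϖ (n := n) Ψ m m' ^ 2 else 0 := by
  rw [wavePair, wavePair, inner_tmulFun, inner_wave hϖ hΨ hΨ' hm hmm b₁ b₁' h₁ h₁',
    inner_wave hϖ hΨ hΨ' hm hmm b₂ b₂' h₂ h₂', ite_zero_mul_ite_zero, pow_two]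

theorem exists_inverseTwist :
    ∃ G : L2 ((haarX ϖ n).prod (haarX ϖ n)) ≃ₗᵢ[ℂ] L2 ((haarX ϖ n).prod (haarX ϖ n)),
      IsInverseTwist hϖ Ψ G := by
  let ι := {m : ℕ // n ≤ m} × U ϖ n × U ϖ n × U ϖ n × U ϖ n
  let w : ι → L2 ((haarX ϖ n).prod (haarX ϖ n)) := fun i =>
    wavePair hϖ Ψ i.1 i.2.1 (phi i.2.2.1) i.2.2.2.1 (phi i.2.2.2.2)
  let w' : ι → L2 ((haarX ϖ n).prod (haarX ϖ n)) := fun i =>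
    wavePair hϖ Ψ i.1 (i.2.1 * i.2.2.2.2⁻¹) (phi i.2.2.1 * incl i.2.2.2.2)
      (i.2.2.1 * i.2.2.2.1) (phi i.2.2.2.2 * (incl i.2.2.1)⁻¹)
  have htot := isTotal_wavePairs hϖ (n := n) hΨ hΨ' hn
  have hw : IsTotal (Set.range w) := by
    refine htot.of_subset_span ?_
    rintro _ ⟨m, hm, _, ⟨b₁, η₁, h₁, rfl⟩, _, ⟨b₂, η₂, h₂, rfl⟩, rfl⟩
    obtain ⟨a, rfl⟩ := exists_phi_eq hϖ h2 hn h₁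
    obtain ⟨b, rfl⟩ := exists_phi_eq hϖ h2 hn h₂
    exact Submodule.subset_span ⟨(⟨m, hm⟩, b₁, a, b₂, b), rfl⟩
  have hw' : IsTotal (Set.range w') := by
    refine htot.of_subset_span ?_
    rintro _ ⟨m, hm, _, ⟨b₁, η₁, h₁, rfl⟩, _, ⟨b₂, η₂, h₂, rfl⟩, rfl⟩
    obtain ⟨a, b, rfl, rfl⟩ := twist_surjective hϖ h2 hn h₁ h₂
    refine Submodule.subset_span ⟨(⟨m, hm⟩, b₁ * b, a, a⁻¹ * b₂, b), ?_⟩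
    change wavePair hϖ Ψ m (b₁ * b * b⁻¹) _ (a * (a⁻¹ * b₂)) _ = _
    rw [mul_inv_cancel_right, mul_inv_cancel_left]
    rfl
  have hgram : ∀ i j : ι, i.1.1 ≤ j.1.1 → ⟪w i, w j⟫_ℂ = ⟪w' i, w' j⟫_ℂ := by
    classical
    rintro ⟨⟨m, hm⟩, b₁, a, b₂, b⟩ ⟨⟨m', hm'⟩, b₁', a', b₂', b'⟩ hmm
    simp only [w, w']
    rw [inner_wavePair hϖ hΨ hΨ' hm hmm _ _ _ _ (phi_mem _) (phi_mem _) (phi_mem _) (phi_mem _),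
      inner_wavePair hϖ hΨ hΨ' hm hmm _ _ _ _ (mul_mem_primePow (phi_mem _) (incl_mem _))
        (mul_mem_primePow (phi_mem _) (inv_incl_mem _))
        (mul_mem_primePow (phi_mem _) (incl_mem _))
        (mul_mem_primePow (phi_mem _) (inv_incl_mem _))]
    exact if_congr (twist_congr_iff hϖ h2 hn).symm rfl rfl
  obtain ⟨G, hG⟩ := exists_unitary_of_gram hw hw' fun i j => by
    rcases le_total i.1.1 j.1.1 with h | h
    · exact hgram i j h
    · rw [← inner_conj_symm, hgram j i h, inner_conj_symm]
  exact ⟨G, fun m hm b₁ a b₂ b => hG (⟨m, hm⟩, b₁, a, b₂, b)⟩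

omit h2 hn in
open Classical in
/-- The matrix coefficients `⟪wave, λ_{g⁻¹} wave⟫`, as functions of `g`, are waves. -/
theorem inner_leftReg_inv_wave {m : ℕ} (hm : n ≤ m) (b b' : U ϖ n) {η η' : K}
    (hη : η ∈ primePow ϖ n) (hη' : η' ∈ primePow ϖ n) (g : X ϖ n) :
    ⟪wave hϖ Ψ m b' η', leftReg (haarX ϖ n) g⁻¹ (wave hϖ Ψ m b η)⟫_ℂ =
      (if η' - incl (b * b'⁻¹) * η ∈ primePow ϖ m then gram hϖ (n := n) Ψ m m else 0) *
        waveFun Ψ m (b * b'⁻¹) η g := by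
  obtain ⟨a, s⟩ := g
  obtain ⟨t, rfl⟩ := Γ.mk_surjective s
  change ⟪wave hϖ Ψ m b' η', leftReg (haarX ϖ n) (X.mk a (Γ.mk ϖ n t))⁻¹ (wave hϖ Ψ m b η)⟫_ℂ =
    _ * waveFun Ψ m (b * b'⁻¹) η (X.mk a (Γ.mk ϖ n t))
  rw [waveFun_mk hΨ hm _ hη]
  by_cases ht : t ∈ fracIdeal ϖ m
  swap
  · rw [inner_leftReg_inv_wave_of_notMem hϖ hΨ hm b b' hη hη' a ht,
      if_neg (c := incl a - incl (b * b'⁻¹) ∈ primePow ϖ m ∧ t ∈ fracIdeal ϖ m) fun h => ht h.2,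
      mul_zero]
  rw [leftReg_inv_wave hϖ hΨ hm b hη a ht, inner_smul_right,
    inner_wave hϖ hΨ hΨ' hm le_rfl _ _ hη' (incl_mul_mem a hη)]
  have h1 : incl b' - incl (a⁻¹ * b) ∈ primePow ϖ m ↔
      incl a - incl (b * b'⁻¹) ∈ primePow ϖ m := by
    rw [← sub_incl_mul_iff, mul_comm a b', mul_comm b, ← inv_inv b', ← sub_incl_mul_iff]
  by_cases ha : incl a - incl (b * b'⁻¹) ∈ primePow ϖ m
  swap
  · simp only [h1, ha, false_and, if_false, mul_zero]
  have h3 : incl a * η - incl (b * b'⁻¹) * η ∈ primePow ϖ m := by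
    rw [← sub_mul]
    exact mul_mem_primePow ha (primePow_le_integers hη)
  have h4 : η' - incl a * η ∈ primePow ϖ m ↔ η' - incl (b * b'⁻¹) * η ∈ primePow ϖ m := by
    constructor
    · intro h
      simpa using add_mem h h3
    · intro h
      simpa using sub_mem h h3
  rw [char_congr hΨ (x := incl a * η * t) (y := incl (b * b'⁻¹) * η * t)
    (by rw [← sub_mul]; exact mul_mem_integers h3 ht), mul_comm]
  simp only [h1, h4, ha, ht, true_and, if_true]

omit hΨ' in
/-- On the support of a product of two waves the twisting function is a product of two
characters. -/
theorem kernel_mul_waveFun {m : ℕ} (hm : n ≤ m) (c₁ c₂ : U ϖ n) {η₁ η₂ : K}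
    (h₁ : η₁ ∈ primePow ϖ n) (h₂ : η₂ ∈ primePow ϖ n) (z : X ϖ n × X ϖ n) :
    kernel Ψ z * (waveFun Ψ m c₁ η₁ z.1 * waveFun Ψ m c₂ η₂ z.2) =
      waveFun Ψ m c₁ (η₁ - phi c₂ * (incl c₁)⁻¹) z.1 *
        waveFun Ψ m c₂ (η₂ + phi c₁ * (incl c₂)⁻¹) z.2 := by
  classical
  obtain ⟨⟨a₁, s₁⟩, ⟨a₂, s₂⟩⟩ := z
  obtain ⟨t₁, rfl⟩ := Γ.mk_surjective s₁
  obtain ⟨t₂, rfl⟩ := Γ.mk_surjective s₂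
  change kernel Ψ (X.mk a₁ (Γ.mk ϖ n t₁), X.mk a₂ (Γ.mk ϖ n t₂)) *
      (waveFun Ψ m c₁ η₁ (X.mk a₁ (Γ.mk ϖ n t₁)) * waveFun Ψ m c₂ η₂ (X.mk a₂ (Γ.mk ϖ n t₂))) =
    waveFun Ψ m c₁ (η₁ - phi c₂ * (incl c₁)⁻¹) (X.mk a₁ (Γ.mk ϖ n t₁)) *
        waveFun Ψ m c₂ (η₂ + phi c₁ * (incl c₂)⁻¹) (X.mk a₂ (Γ.mk ϖ n t₂))
  have k₁ : phi c₂ * (incl c₁)⁻¹ ∈ primePow ϖ n := mul_mem_primePow (phi_mem _) (inv_incl_mem _)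
  have k₂ : phi c₁ * (incl c₂)⁻¹ ∈ primePow ϖ n := mul_mem_primePow (phi_mem _) (inv_incl_mem _)
  rw [kernel_mk Ψ hΨ, waveFun_mk hΨ hm _ h₁, waveFun_mk hΨ hm _ h₂,
    waveFun_mk hΨ hm _ (sub_mem h₁ k₁), waveFun_mk hΨ hm _ (add_mem h₂ k₂)]
  by_cases hx : incl a₁ - incl c₁ ∈ primePow ϖ m ∧ t₁ ∈ fracIdeal ϖ m
  swap
  · rw [if_neg hx, if_neg hx, zero_mul, zero_mul, mul_zero]
  by_cases hy : incl a₂ - incl c₂ ∈ primePow ϖ m ∧ t₂ ∈ fracIdeal ϖ m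
  swap
  · rw [if_neg hy, if_neg hy, mul_zero, mul_zero, mul_zero]
  rw [if_pos hx, if_pos hx, if_pos hy, if_pos hy]
  simp only [← Circle.coe_mul, ← AddChar.map_add_eq_mul]
  rw [char_congr hΨ]
  have e₁ := mul_mem_integers ((phi_sub_mem_iff hϖ h2 hn).2 hx.1) hy.2
  have e₂ := mul_mem_integers ((phi_sub_mem_iff hϖ h2 hn).2 hy.1) hx.2
  have n₁ := incl_ne_zero c₁
  have n₂ := incl_ne_zero c₂
  have h := sub_mem e₁ e₂
  have e : phi a₁ * t₂ - phi a₂ * t₁ + (incl c₁ * η₁ * t₁ + incl c₂ * η₂ * t₂) -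
      (incl c₁ * (η₁ - phi c₂ * (incl c₁)⁻¹) * t₁ + incl c₂ * (η₂ + phi c₁ * (incl c₂)⁻¹) * t₂) =
      (phi a₁ - phi c₁) * t₂ - (phi a₂ - phi c₂) * t₁ := by
    generalize phi c₁ = p₁
    generalize phi c₂ = p₂
    field_simp
    ring
  rw [e]
  exact h

omit hΨ hΨ' in
/-- Two conditions for a matrix coefficient of the twist on products of waves not to vanish: the one
from `IsInverseTwist` on the left, the one from the integral formula on the right. -/
theorem twist_support_iff {m : ℕ} {b₁ b₂ b₁' b₂' a b : U ϖ n} {η₁ η₂ : K} :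
    ((incl (b₁' * b⁻¹) - incl b₁ ∈ primePow ϖ m ∧ phi a * incl b - η₁ ∈ primePow ϖ m) ∧
      (incl (a * b₂') - incl b₂ ∈ primePow ϖ m ∧ phi b * (incl a)⁻¹ - η₂ ∈ primePow ϖ m)) ↔
    ((phi a - incl (b₁ * b₁'⁻¹) * η₁ ∈ primePow ϖ m ∧
      phi b - incl (b₂ * b₂'⁻¹) * η₂ ∈ primePow ϖ m) ∧
      (η₁ - phi (b₂ * b₂'⁻¹) * (incl (b₁ * b₁'⁻¹))⁻¹ ∈ primePow ϖ m ∧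
      η₂ + phi (b₁ * b₁'⁻¹) * (incl (b₂ * b₂'⁻¹))⁻¹ ∈ primePow ϖ m)) := by
  obtain ⟨c₁, rfl⟩ : ∃ c₁, b₁ = c₁ * b₁' := ⟨b₁ * b₁'⁻¹, by simp⟩
  obtain ⟨c₂, rfl⟩ : ∃ c₂, b₂ = c₂ * b₂' := ⟨b₂ * b₂'⁻¹, by simp⟩
  simp only [mul_inv_cancel_right]
  have hφ : ∀ c : U ϖ n, phi c ∈ 𝒪[K] := fun c => primePow_le_integers (phi_mem c)
  have n₁ := incl_ne_zero c₁
  have n₂ := incl_ne_zero c₂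
  have na := incl_ne_zero a
  have nb := incl_ne_zero b
  -- in terms of `c₁ = b₁ / b₁'` and `c₂ = b₂ / b₂'` both sides say that `a ≡ c₂` and `b ≡ c₁⁻¹`,
  -- together with `η₁ ≡ φ(a) b` and `η₂ ≡ φ(b) / a`
  have i₁ : incl (b₁' * b⁻¹) - incl (c₁ * b₁') ∈ primePow ϖ m ↔
      incl b - incl c₁⁻¹ ∈ primePow ϖ m := by
    have nb' := incl_ne_zero b₁'
    constructor
    · intro h
      refine mem_primePow_of_dvd h (neg_mem (mul_mem (inv_incl_mem b₁')
        (mul_mem (incl_mem b) (inv_incl_mem c₁)))) ?_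
      simp only [incl_mul, incl_inv]
      field_simp
      ring
    · intro h
      refine mem_primePow_of_dvd h (neg_mem (mul_mem (incl_mem b₁')
        (mul_mem (inv_incl_mem b) (incl_mem c₁)))) ?_
      simp only [incl_mul, incl_inv]
      field_simp
      ring
  have i₂ : incl (a * b₂') - incl (c₂ * b₂') ∈ primePow ϖ m ↔
      incl a - incl c₂ ∈ primePow ϖ m := by
    have nb' := incl_ne_zero b₂'
    constructor
    · intro h
      refine mem_primePow_of_dvd h (inv_incl_mem b₂') ?_
      simp only [incl_mul]
      field_simp
    · intro h
      refine mem_primePow_of_dvd h (incl_mem b₂') ?_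
      simp only [incl_mul]
      ring
  rw [i₁, i₂]
  constructor
  · rintro ⟨⟨hb, h3⟩, ha, h4⟩
    have fa := (phi_sub_mem_iff hϖ h2 hn).2 ha
    have fb := (phi_sub_mem_iff hϖ h2 hn).2 hb
    rw [phi_inv] at fb
    have gb : incl b - (incl c₁)⁻¹ ∈ primePow ϖ m := by rwa [incl_inv] at hb
    refine ⟨⟨?_, ?_⟩, ?_, ?_⟩
    · -- `φ(a) - c₁ η₁ = c₁ (φ(a) b - η₁) - φ(a) c₁ (b - c₁⁻¹)`
      have := sub_mem (mul_mem_primePow h3 (incl_mem c₁))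
        (mul_mem_primePow gb (mul_mem (hφ a) (incl_mem c₁)))
      refine mem_primePow_of_dvd this (one_mem _) ?_
      generalize phi a = p
      field_simp
      ring
    · have := add_mem (mul_mem_primePow h4 (incl_mem c₂))
        (mul_mem_primePow ha (mul_mem (hφ b) (inv_incl_mem a)))
      refine mem_primePow_of_dvd this (one_mem _) ?_
      generalize phi b = p
      field_simp
      ring
    · have := sub_mem (mul_sub_mul_mem fa gb (incl_mem b) (hφ c₂)) h3
      refine mem_primePow_of_dvd this (one_mem _) ?_
      ring
    · have := sub_mem (mul_sub_mul_mem fb (inv_sub_inv_mem ha) (inv_incl_mem a)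
        (neg_mem (hφ c₁))) h4
      refine mem_primePow_of_dvd this (one_mem _) ?_
      ring
  · rintro ⟨⟨h3, h4⟩, h5, h6⟩
    have fa : phi a - phi c₂ ∈ primePow ϖ m := by
      have := add_mem h3 (mul_mem_primePow h5 (incl_mem c₁))
      refine mem_primePow_of_dvd this (one_mem _) ?_
      generalize phi a = p, phi c₂ = r
      field_simp
      ring
    have fb : phi b - phi c₁⁻¹ ∈ primePow ϖ m := by
      have := add_mem h4 (mul_mem_primePow h6 (incl_mem c₂))
      refine mem_primePow_of_dvd this (one_mem _) ?_
      rw [phi_inv]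
      generalize phi b = p, phi c₁ = r
      field_simp
      ring
    have ha := (phi_sub_mem_iff hϖ h2 hn).1 fa
    have hb := (phi_sub_mem_iff hϖ h2 hn).1 fb
    have gb : incl b - (incl c₁)⁻¹ ∈ primePow ϖ m := by rwa [incl_inv] at hb
    refine ⟨⟨hb, ?_⟩, ha, ?_⟩
    · have := add_mem (mul_mem_primePow gb (hφ a)) (mul_mem_primePow h3 (inv_incl_mem c₁))
      refine mem_primePow_of_dvd this (one_mem _) ?_
      generalize phi a = p
      field_simp
      ring
    · have := add_mem (mul_mem_primePow (inv_sub_inv_mem ha) (hφ b))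
        (mul_mem_primePow h4 (inv_incl_mem c₂))
      refine mem_primePow_of_dvd this (one_mem _) ?_
      generalize phi b = p
      field_simp
      ring

end Twist

/-! ### Matrix coefficients of the twist and membership in `W*(X_n × X_n)` -/

section Formula

variable {K : Type*} [Field K] [ValuativeRel K] [TopologicalSpace K] [IsNonarchimedeanLocalField K]
  {ϖ : 𝒪[K]} {n : ℕ} [MeasurableSpace K] [BorelSpace K]

/-- The formula for the matrix coefficient `⟪h, T f⟫` of the twist, together with the vanishing of
its integrand outside the set of all `((a₁, [t₁]), (a₂, [t₂]))` with `t₁, t₂ ∈ ϖ⁻ᵐ 𝒪`. -/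
structure TwistCoefficient (Ψ : AddChar K Circle) (m : ℕ)
    (T : L2 ((haarX ϖ n).prod (haarX ϖ n)) →L[ℂ] L2 ((haarX ϖ n).prod (haarX ϖ n)))
    (f h : L2 ((haarX ϖ n).prod (haarX ϖ n))) : Prop where
  support : ∀ z : X ϖ n × X ϖ n, ¬ (z.1.2 ∈ latticeΓ ϖ n m ∧ z.2.2 ∈ latticeΓ ϖ n m) →
    ⟪h, leftReg ((haarX ϖ n).prod (haarX ϖ n)) z⁻¹ f⟫_ℂ = 0
  integrable : Integrable (fun z : X ϖ n × X ϖ n =>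
    kernel Ψ z * ⟪h, leftReg ((haarX ϖ n).prod (haarX ϖ n)) z⁻¹ f⟫_ℂ)
    ((haarX ϖ n).prod (haarX ϖ n))
  eq : ⟪h, T f⟫_ℂ = (Nat.card 𝓀[K] : ℂ) ^ (2 * n) * ∫ z : X ϖ n × X ϖ n,
    kernel Ψ z * ⟪h, leftReg ((haarX ϖ n).prod (haarX ϖ n)) z⁻¹ f⟫_ℂ
    ∂((haarX ϖ n).prod (haarX ϖ n))

section Linear

variable {Ψ : AddChar K Circle} {m : ℕ}
  {T : L2 ((haarX ϖ n).prod (haarX ϖ n)) →L[ℂ] L2 ((haarX ϖ n).prod (haarX ϖ n))}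
  {f f' h h' : L2 ((haarX ϖ n).prod (haarX ϖ n))}

theorem TwistCoefficient.zero_left : TwistCoefficient Ψ m T 0 h :=
  ⟨by simp, by simp, by simp⟩

theorem TwistCoefficient.zero_right : TwistCoefficient Ψ m T f 0 :=
  ⟨by simp, by simp, by simp⟩

theorem TwistCoefficient.add_left (H : TwistCoefficient Ψ m T f h)
    (H' : TwistCoefficient Ψ m T f' h) : TwistCoefficient Ψ m T (f + f') h := by
  refine ⟨fun z hz => ?_, ?_, ?_⟩
  · rw [map_add, inner_add_right, H.support z hz, H'.support z hz, add_zero]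
  · simp only [map_add, inner_add_right, mul_add]
    exact H.integrable.add H'.integrable
  · simp only [map_add, inner_add_right, mul_add]
    rw [integral_add H.integrable H'.integrable, H.eq, H'.eq, mul_add]

theorem TwistCoefficient.add_right (H : TwistCoefficient Ψ m T f h)
    (H' : TwistCoefficient Ψ m T f h') : TwistCoefficient Ψ m T f (h + h') := by
  refine ⟨fun z hz => ?_, ?_, ?_⟩
  · rw [inner_add_left, H.support z hz, H'.support z hz, add_zero]
  · simp only [inner_add_left, mul_add]
    exact H.integrable.add H'.integrable
  · simp only [inner_add_left, mul_add]
    rw [integral_add H.integrable H'.integrable, H.eq, H'.eq, mul_add]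

theorem TwistCoefficient.smul_left (H : TwistCoefficient Ψ m T f h) (c : ℂ) :
    TwistCoefficient Ψ m T (c • f) h := by
  refine ⟨fun z hz => ?_, ?_, ?_⟩
  · rw [map_smul, inner_smul_right, H.support z hz, mul_zero]
  · simpa only [map_smul, inner_smul_right, mul_left_comm] using H.integrable.const_mul c
  · simp only [map_smul, inner_smul_right, mul_left_comm (kernel Ψ _) c]
    rw [integral_const_mul, H.eq, mul_left_comm]

theorem TwistCoefficient.smul_right (H : TwistCoefficient Ψ m T f h) (c : ℂ) :
    TwistCoefficient Ψ m T f (c • h) := by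
  refine ⟨fun z hz => ?_, ?_, ?_⟩
  · rw [inner_smul_left, H.support z hz, mul_zero]
  · simpa only [inner_smul_left, mul_left_comm] using H.integrable.const_mul (starRingEnd ℂ c)
  · simp only [inner_smul_left, mul_left_comm (kernel Ψ _) (starRingEnd ℂ c)]
    rw [integral_const_mul, H.eq, mul_left_comm]

theorem TwistCoefficient.of_mem_span
    {A B : Set (L2 ((haarX ϖ n).prod (haarX ϖ n)))}
    (H : ∀ f ∈ A, ∀ h ∈ B, TwistCoefficient Ψ m T f h)
    (hf : f ∈ Submodule.span ℂ A) (hh : h ∈ Submodule.span ℂ B) : TwistCoefficient Ψ m T f h := by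
  induction hf using Submodule.span_induction with
  | zero => exact .zero_left
  | add x y _ _ hx hy => exact hx.add_left hy
  | smul c x _ hx => exact hx.smul_left c
  | mem f hf =>
    induction hh using Submodule.span_induction with
    | zero => exact .zero_right
    | add x y _ _ hx hy => exact hx.add_right hy
    | smul c x _ hx => exact hx.smul_right c
    | mem h hh => exact H f hf h hh

end Linear

variable (hϖ : Irreducible ϖ) {Ψ : AddChar K Circle}

/-- The twist, as the inverse of the unitary operator `G`. -/
def twistOp (G : L2 ((haarX ϖ n).prod (haarX ϖ n)) ≃ₗᵢ[ℂ] L2 ((haarX ϖ n).prod (haarX ϖ n))) :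
    L2 ((haarX ϖ n).prod (haarX ϖ n)) →L[ℂ] L2 ((haarX ϖ n).prod (haarX ϖ n)) :=
  G.symm.toLinearIsometry.toContinuousLinearMap

@[simp] theorem twistOp_apply
    (G : L2 ((haarX ϖ n).prod (haarX ϖ n)) ≃ₗᵢ[ℂ] L2 ((haarX ϖ n).prod (haarX ϖ n)))
    (f : L2 ((haarX ϖ n).prod (haarX ϖ n))) : twistOp G f = G.symm f := rfl

theorem inner_twistOp
    (G : L2 ((haarX ϖ n).prod (haarX ϖ n)) ≃ₗᵢ[ℂ] L2 ((haarX ϖ n).prod (haarX ϖ n)))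
    (f h : L2 ((haarX ϖ n).prod (haarX ϖ n))) : ⟪h, twistOp G f⟫_ℂ = ⟪G h, f⟫_ℂ := by
  rw [twistOp_apply, ← G.inner_map_map, G.apply_symm_apply]

variable (h2 : IsUnit (2 : 𝒪[K])) (hn : 1 ≤ n) (hΨ : ∀ x ∈ 𝒪[K], Ψ x = 1)
  (hΨ' : ∃ x : K, (ϖ : K) * x ∈ 𝒪[K] ∧ Ψ x ≠ 1)
  {G : L2 ((haarX ϖ n).prod (haarX ϖ n)) ≃ₗᵢ[ℂ] L2 ((haarX ϖ n).prod (haarX ϖ n))}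
  (hG : IsInverseTwist hϖ Ψ G)
include hϖ h2 hn hΨ hΨ' hG

/-- The formula for the matrix coefficients, for two products of waves of the same level. The
integrand is a product of two waves, which integrate to a constant or to zero. -/
theorem twistCoefficient_wavePairs {m : ℕ} (hm : n ≤ m)
    {f h : L2 ((haarX ϖ n).prod (haarX ϖ n))} (hf : f ∈ wavePairs hϖ (n := n) Ψ m)
    (hh : h ∈ wavePairs hϖ (n := n) Ψ m) : TwistCoefficient Ψ m (twistOp G) f h := by
  classical
  obtain ⟨_, ⟨b₁, η₁, h₁, rfl⟩, _, ⟨b₂, η₂, h₂, rfl⟩, rfl⟩ := hf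
  obtain ⟨_, ⟨b₁', η₁', h₁', rfl⟩, _, ⟨b₂', η₂', h₂', rfl⟩, rfl⟩ := hh
  obtain ⟨a, rfl⟩ := exists_phi_eq hϖ h2 hn h₁'
  obtain ⟨b, rfl⟩ := exists_phi_eq hϖ h2 hn h₂'
  set c₁ := b₁ * b₁'⁻¹ with hc₁
  set c₂ := b₂ * b₂'⁻¹ with hc₂
  set γ := gram hϖ (n := n) Ψ m m with hγ
  let C : ℂ := (if phi a - incl c₁ * η₁ ∈ primePow ϖ m then γ else 0) *
    (if phi b - incl c₂ * η₂ ∈ primePow ϖ m then γ else 0)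
  have hcoef : ∀ z : X ϖ n × X ϖ n, ⟪tmulFun (haarX ϖ n) (haarX ϖ n) (wave hϖ Ψ m b₁' (phi a))
      (wave hϖ Ψ m b₂' (phi b)), leftReg ((haarX ϖ n).prod (haarX ϖ n)) z⁻¹
      (tmulFun (haarX ϖ n) (haarX ϖ n) (wave hϖ Ψ m b₁ η₁) (wave hϖ Ψ m b₂ η₂))⟫_ℂ =
      C * (waveFun Ψ m c₁ η₁ z.1 * waveFun Ψ m c₂ η₂ z.2) := by
    intro z
    rw [leftReg_prod_tmulFun, inner_tmulFun, Prod.fst_inv, Prod.snd_inv,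
      inner_leftReg_inv_wave hϖ hΨ hΨ' hm _ _ h₁ h₁',
      inner_leftReg_inv_wave hϖ hΨ hΨ' hm _ _ h₂ h₂']
    simp only [C]
    ring
  have k₁ : phi c₂ * (incl c₁)⁻¹ ∈ primePow ϖ n := mul_mem_primePow (phi_mem _) (inv_incl_mem _)
  have k₂ : phi c₁ * (incl c₂)⁻¹ ∈ primePow ϖ n := mul_mem_primePow (phi_mem _) (inv_incl_mem _)
  have hint : ∀ z : X ϖ n × X ϖ n, kernel Ψ z * (C * (waveFun Ψ m c₁ η₁ z.1 *
      waveFun Ψ m c₂ η₂ z.2)) = C * (waveFun Ψ m c₁ (η₁ - phi c₂ * (incl c₁)⁻¹) z.1 *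
        waveFun Ψ m c₂ (η₂ + phi c₁ * (incl c₂)⁻¹) z.2) := by
    intro z
    rw [mul_left_comm, kernel_mul_waveFun hϖ h2 hn hΨ hm c₁ c₂ h₁ h₂]
  refine ⟨fun z hz => ?_, ?_, ?_⟩
  · rw [hcoef]
    rw [not_and_or] at hz
    rcases hz with hz | hz
    · rw [show waveFun Ψ m c₁ η₁ z.1 = 0 from if_neg fun h => hz h.2, zero_mul, mul_zero]
    · rw [show waveFun Ψ m c₂ η₂ z.2 = 0 from if_neg fun h => hz h.2, mul_zero, mul_zero]
  · simp only [hcoef, hint]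
    exact ((integrable_waveFun hϖ Ψ m _ _).mul_prod (integrable_waveFun hϖ Ψ m _ _)).const_mul C
  · simp only [hcoef, hint]
    have hq := card_pow_mul_gram_self hϖ hn Ψ hm
    rw [← hγ] at hq
    rw [integral_const_mul, integral_prod_mul, integral_waveFun hϖ hΨ hΨ' hm _ (sub_mem h₁ k₁),
      integral_waveFun hϖ hΨ hΨ' hm _ (add_mem h₂ k₂), inner_twistOp]
    have hGh := hG m hm b₁' a b₂' b
    rw [wavePair] at hGh
    rw [hGh, ← wavePair, inner_wavePair hϖ hΨ hΨ' hm le_rfl _ _ _ _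
      (mul_mem_primePow (phi_mem _) (incl_mem _)) (mul_mem_primePow (phi_mem _) (inv_incl_mem _))
      h₁ h₂]
    rw [if_congr (twist_support_iff hϖ h2 hn) rfl rfl, ← hc₁, ← hc₂, ← hγ]
    simp only [C, ite_zero_mul_ite_zero]
    split_ifs with hs
    · linear_combination (-γ ^ 2 * ((Nat.card 𝓀[K] : ℂ) ^ n * γ) - γ ^ 2) * hq
    · rw [mul_zero]

theorem twistCoefficient_of_mem_span {m : ℕ} (hm : n ≤ m)
    {f h : L2 ((haarX ϖ n).prod (haarX ϖ n))}
    (hf : f ∈ Submodule.span ℂ (wavePairs hϖ (n := n) Ψ m))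
    (hh : h ∈ Submodule.span ℂ (wavePairs hϖ (n := n) Ψ m)) :
    TwistCoefficient Ψ m (twistOp G) f h :=
  .of_mem_span (fun _ hf _ hh => twistCoefficient_wavePairs hϖ h2 hn hΨ hΨ' hG hm hf hh) hf hh

theorem isTwistOperator_twistOp : IsTwistOperator Ψ (twistOp G) := by
  intro f h hf hh
  obtain ⟨M, hM⟩ := mem_span_of_isBruhat hϖ hΨ hΨ' hf
  obtain ⟨N, hN⟩ := mem_span_of_isBruhat hϖ hΨ hΨ' hh
  have hm : n ≤ max n (max M N) := le_max_left _ _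
  have H := twistCoefficient_of_mem_span hϖ h2 hn hΨ hΨ' hG hm
    (hM _ ((le_max_left _ _).trans (le_max_right _ _)) hm)
    (hN _ ((le_max_right _ _).trans (le_max_right _ _)) hm)
  exact ⟨H.integrable, H.eq⟩

theorem eq_twistOp_of_isTwistOperator
    {T : L2 ((haarX ϖ n).prod (haarX ϖ n)) →L[ℂ] L2 ((haarX ϖ n).prod (haarX ϖ n))}
    (hT : IsTwistOperator Ψ T) : T = twistOp G := by
  have hB : ∀ f, f ∈ {f | ∃ m ≥ n, f ∈ wavePairs hϖ (n := n) Ψ m} → IsBruhat f := by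
    rintro _ ⟨m, -, _, ⟨b₁, η₁, -, rfl⟩, _, ⟨b₂, η₂, -, rfl⟩, rfl⟩
    exact isBruhat_tmulFun_wave hϖ hn Ψ m m b₁ b₂ η₁ η₂
  refine (isTotal_wavePairs hϖ (n := n) hΨ hΨ' hn).op_ext_inner fun f hf h hh => ?_
  rw [(hT f h (hB f hf) (hB h hh)).2,
    (isTwistOperator_twistOp hϖ h2 hn hΨ hΨ' hG f h (hB f hf) (hB h hh)).2]

section Membership

omit hG

theorem finite_waveSet {m : ℕ} (hm : n ≤ m) : (waveSet hϖ (n := n) Ψ m).Finite := by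
  have := finite_quotient hϖ m
  let f : U ϖ n × U ϖ n → L2 (haarX ϖ n) := fun p => wave hϖ Ψ m p.1 (phi p.2)
  let r : U ϖ n × U ϖ n → (𝒪[K] ⧸ Ideal.span {ϖ ^ m}) × (𝒪[K] ⧸ Ideal.span {ϖ ^ m}) :=
    fun p => (residue m p.1, residue m p.2)
  have hf : Function.FactorsThrough f r := by
    intro p p' h
    simp only [r, Prod.mk.injEq] at h
    exact wave_congr hϖ hΨ hm (phi_mem _) (phi_mem _) (residue_eq_iff.1 h.1)
      ((phi_sub_mem_iff hϖ h2 hn).2 (residue_eq_iff.1 h.2))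
  refine (Set.finite_range (Function.extend r f 0)).subset ?_
  rintro _ ⟨b, η, hη, rfl⟩
  obtain ⟨a, rfl⟩ := exists_phi_eq hϖ h2 hn hη
  exact ⟨r (b, a), hf.extend_apply 0 (b, a)⟩

theorem finiteDimensional_span_wavePairs {m : ℕ} (hm : n ≤ m) :
    FiniteDimensional ℂ (Submodule.span ℂ (wavePairs hϖ (n := n) Ψ m)) := by
  have h := finite_waveSet hϖ h2 hn hΨ hΨ' hm
  exact FiniteDimensional.span_of_finite ℂ (h.image2 _ h)

theorem leftReg_inv_mem_span {m : ℕ} (hm : n ≤ m) {z : X ϖ n × X ϖ n}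
    (hz : z.1.2 ∈ latticeΓ ϖ n m ∧ z.2.2 ∈ latticeΓ ϖ n m)
    {f : L2 ((haarX ϖ n).prod (haarX ϖ n))}
    (hf : f ∈ Submodule.span ℂ (wavePairs hϖ (n := n) Ψ m)) :
    leftReg ((haarX ϖ n).prod (haarX ϖ n)) z⁻¹ f ∈
      Submodule.span ℂ (wavePairs hϖ (n := n) Ψ m) := by
  induction hf using Submodule.span_induction with
  | zero => rw [map_zero]; exact zero_mem _
  | add x y _ _ hx hy => rw [map_add]; exact add_mem hx hy
  | smul c x _ hx => rw [map_smul]; exact Submodule.smul_mem _ _ hx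
  | mem f hf =>
    obtain ⟨_, ⟨b₁, η₁, h₁, rfl⟩, _, ⟨b₂, η₂, h₂, rfl⟩, rfl⟩ := hf
    obtain ⟨⟨a₁, s₁⟩, ⟨a₂, s₂⟩⟩ := z
    obtain ⟨t₁, ht₁, rfl⟩ := exists_mk_eq hz.1
    obtain ⟨t₂, ht₂, rfl⟩ := exists_mk_eq hz.2
    rw [leftReg_prod_tmulFun]
    have e₁ := leftReg_inv_wave hϖ hΨ hm b₁ h₁ a₁ ht₁
    have e₂ := leftReg_inv_wave hϖ hΨ hm b₂ h₂ a₂ ht₂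
    refine tmulFun_mem_span ?_ ?_
    · exact e₁ ▸ Submodule.smul_mem _ _ (Submodule.subset_span
        ⟨_, _, incl_mul_mem a₁ h₁, rfl⟩)
    · exact e₂ ▸ Submodule.smul_mem _ _ (Submodule.subset_span
        ⟨_, _, incl_mul_mem a₂ h₂, rfl⟩)

theorem leftReg_mem_span {m : ℕ} (hm : n ≤ m) {z : X ϖ n × X ϖ n}
    (hz : z.1.2 ∈ latticeΓ ϖ n m ∧ z.2.2 ∈ latticeΓ ϖ n m)
    {f : L2 ((haarX ϖ n).prod (haarX ϖ n))}
    (hf : f ∈ Submodule.span ℂ (wavePairs hϖ (n := n) Ψ m)) :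
    leftReg ((haarX ϖ n).prod (haarX ϖ n)) z f ∈
      Submodule.span ℂ (wavePairs hϖ (n := n) Ψ m) := by
  have h := leftReg_inv_mem_span hϖ h2 hn hΨ hΨ' hm (z := z⁻¹)
    ⟨neg_mem (smul_mem_latticeΓ z.1.1 hz.1), neg_mem (smul_mem_latticeΓ z.2.1 hz.2)⟩ hf
  rwa [inv_inv] at h

include hG

theorem twist_mem_span {m : ℕ} (hm : n ≤ m) {f : L2 ((haarX ϖ n).prod (haarX ϖ n))}
    (hf : f ∈ Submodule.span ℂ (wavePairs hϖ (n := n) Ψ m)) :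
    G f ∈ Submodule.span ℂ (wavePairs hϖ (n := n) Ψ m) := by
  induction hf using Submodule.span_induction with
  | zero => rw [map_zero]; exact zero_mem _
  | add x y _ _ hx hy => rw [map_add]; exact add_mem hx hy
  | smul c x _ hx => rw [map_smul]; exact Submodule.smul_mem _ _ hx
  | mem f hf =>
    obtain ⟨_, ⟨b₁, η₁, h₁, rfl⟩, _, ⟨b₂, η₂, h₂, rfl⟩, rfl⟩ := hf
    obtain ⟨a, rfl⟩ := exists_phi_eq hϖ h2 hn h₁
    obtain ⟨b, rfl⟩ := exists_phi_eq hϖ h2 hn h₂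
    have h := hG m hm b₁ a b₂ b
    rw [wavePair] at h
    rw [h]
    exact Submodule.subset_span ⟨_, ⟨_, _, mul_mem_primePow (phi_mem _) (incl_mem _), rfl⟩, _,
      ⟨_, _, mul_mem_primePow (phi_mem _) (inv_incl_mem _), rfl⟩, rfl⟩

theorem twist_symm_mem_span {m : ℕ} (hm : n ≤ m) {f : L2 ((haarX ϖ n).prod (haarX ϖ n))}
    (hf : f ∈ Submodule.span ℂ (wavePairs hϖ (n := n) Ψ m)) :
    G.symm f ∈ Submodule.span ℂ (wavePairs hϖ (n := n) Ψ m) := by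
  induction hf using Submodule.span_induction with
  | zero => rw [map_zero]; exact zero_mem _
  | add x y _ _ hx hy => rw [map_add]; exact add_mem hx hy
  | smul c x _ hx => rw [map_smul]; exact Submodule.smul_mem _ _ hx
  | mem f hf =>
    obtain ⟨_, ⟨b₁, η₁, h₁, rfl⟩, _, ⟨b₂, η₂, h₂, rfl⟩, rfl⟩ := hf
    obtain ⟨a, b, rfl, rfl⟩ := twist_surjective hϖ h2 hn h₁ h₂
    have h := hG m hm (b₁ * b) a (a⁻¹ * b₂) b
    rw [mul_inv_cancel_right, mul_inv_cancel_left, wavePair, wavePair] at h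
    rw [← h, G.symm_apply_apply]
    exact Submodule.subset_span ⟨_, ⟨_, _, phi_mem _, rfl⟩, _, ⟨_, _, phi_mem _, rfl⟩, rfl⟩

/-- The integrand of the matrix coefficient `⟪h, F f⟫`, restricted to `t₁, t₂ ∈ ϖ⁻ᵐ 𝒪`. -/
def levelIntegrand (Ψ : AddChar K Circle) (m : ℕ) (f h : L2 ((haarX ϖ n).prod (haarX ϖ n)))
    (z : X ϖ n × X ϖ n) : ℂ :=
  {z : X ϖ n × X ϖ n | z.1.2 ∈ latticeΓ ϖ n m ∧ z.2.2 ∈ latticeΓ ϖ n m}.indicator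
    (fun z => kernel Ψ z * ⟪h, leftReg ((haarX ϖ n).prod (haarX ϖ n)) z⁻¹ f⟫_ℂ) z

theorem inner_twistOp_of_both {m : ℕ} (hm : n ≤ m)
    {f h : L2 ((haarX ϖ n).prod (haarX ϖ n))}
    (hf : f ∈ Submodule.span ℂ (wavePairs hϖ (n := n) Ψ m))
    (hh : h ∈ Submodule.span ℂ (wavePairs hϖ (n := n) Ψ m)) :
    ⟪h, twistOp G f⟫_ℂ = (Nat.card 𝓀[K] : ℂ) ^ (2 * n) *
      ∫ z, levelIntegrand Ψ m f h z ∂((haarX ϖ n).prod (haarX ϖ n)) := by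
  classical
  have H := twistCoefficient_of_mem_span hϖ h2 hn hΨ hΨ' hG hm hf hh
  rw [H.eq]
  congr 2 with z
  rw [levelIntegrand, Set.indicator_apply]
  split_ifs with hz
  · rfl
  · rw [H.support z hz, mul_zero]

/-- The formula holds for arbitrary `h` when `f` has level `m`, because the operators involved
preserve the vectors of level `m`, so that only the component of `h` of level `m` matters. -/
theorem inner_twistOp_of_left {m : ℕ} (hm : n ≤ m)
    {f : L2 ((haarX ϖ n).prod (haarX ϖ n))}
    (hf : f ∈ Submodule.span ℂ (wavePairs hϖ (n := n) Ψ m))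
    (h : L2 ((haarX ϖ n).prod (haarX ϖ n))) :
    ⟪h, twistOp G f⟫_ℂ = (Nat.card 𝓀[K] : ℂ) ^ (2 * n) *
      ∫ z, levelIntegrand Ψ m f h z ∂((haarX ϖ n).prod (haarX ϖ n)) := by
  classical
  have := finiteDimensional_span_wavePairs hϖ h2 hn hΨ hΨ' hm
  obtain ⟨p, hp, r, hr, rfl⟩ :=
    (Submodule.span ℂ (wavePairs hϖ (n := n) Ψ m)).exists_add_mem_mem_orthogonal h
  rw [Submodule.mem_orthogonal'] at hr
  rw [inner_add_left, twistOp_apply, hr _ (twist_symm_mem_span hϖ h2 hn hΨ hΨ' hG hm hf), add_zero,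
    ← twistOp_apply, inner_twistOp_of_both hϖ h2 hn hΨ hΨ' hG hm hf hp]
  congr 2 with z
  rw [levelIntegrand, levelIntegrand, Set.indicator_apply, Set.indicator_apply]
  split_ifs with hz
  · rw [inner_add_left, hr _ (leftReg_inv_mem_span hϖ h2 hn hΨ hΨ' hm hz hf), add_zero]
  · rfl

theorem inner_twistOp_of_right {m : ℕ} (hm : n ≤ m)
    {h : L2 ((haarX ϖ n).prod (haarX ϖ n))}
    (hh : h ∈ Submodule.span ℂ (wavePairs hϖ (n := n) Ψ m))
    (f : L2 ((haarX ϖ n).prod (haarX ϖ n))) :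
    ⟪h, twistOp G f⟫_ℂ = (Nat.card 𝓀[K] : ℂ) ^ (2 * n) *
      ∫ z, levelIntegrand Ψ m f h z ∂((haarX ϖ n).prod (haarX ϖ n)) := by
  classical
  have := finiteDimensional_span_wavePairs hϖ h2 hn hΨ hΨ' hm
  obtain ⟨p, hp, r, hr, rfl⟩ :=
    (Submodule.span ℂ (wavePairs hϖ (n := n) Ψ m)).exists_add_mem_mem_orthogonal f
  rw [Submodule.mem_orthogonal] at hr
  rw [map_add, inner_add_right, inner_twistOp G r,
    hr _ (twist_mem_span hϖ h2 hn hΨ hΨ' hG hm hh), add_zero,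
    inner_twistOp_of_both hϖ h2 hn hΨ hΨ' hG hm hp hh]
  congr 2 with z
  rw [levelIntegrand, levelIntegrand, Set.indicator_apply, Set.indicator_apply]
  split_ifs with hz
  · rw [map_add, inner_add_right, ← star_leftReg, ContinuousLinearMap.star_eq_adjoint,
      ContinuousLinearMap.adjoint_inner_right _ h r,
      hr _ (leftReg_mem_span hϖ h2 hn hΨ hΨ' hm hz hh), add_zero]
  · rfl

theorem twistOp_mem_groupVN : twistOp G ∈ groupVN ((haarX ϖ n).prod (haarX ϖ n)) := by
  classical
  rw [mem_groupVN_iff]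
  intro S hS
  have hB : ∀ f, f ∈ {f | ∃ m ≥ n, f ∈ wavePairs hϖ (n := n) Ψ m} → IsBruhat f := by
    rintro _ ⟨m, -, _, ⟨b₁, η₁, -, rfl⟩, _, ⟨b₂, η₂, -, rfl⟩, rfl⟩
    exact isBruhat_tmulFun_wave hϖ hn Ψ m m b₁ b₂ η₁ η₂
  refine (isTotal_wavePairs hϖ (n := n) hΨ hΨ' hn).op_ext_inner fun f hf h hh => ?_
  obtain ⟨M, hM⟩ := mem_span_of_isBruhat hϖ hΨ hΨ' (hB f hf)
  obtain ⟨N, hN⟩ := mem_span_of_isBruhat hϖ hΨ hΨ' (hB h hh)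
  have hm : n ≤ max n (max M N) := le_max_left _ _
  have hf' := hM _ ((le_max_left _ _).trans (le_max_right _ _)) hm
  have hh' := hN _ ((le_max_right _ _).trans (le_max_right _ _)) hm
  change ⟪h, S (twistOp G f)⟫_ℂ = ⟪h, twistOp G (S f)⟫_ℂ
  rw [← ContinuousLinearMap.adjoint_inner_left, inner_twistOp_of_left hϖ h2 hn hΨ hΨ' hG hm hf',
    inner_twistOp_of_right hϖ h2 hn hΨ hΨ' hG hm hh']
  congr 2 with z
  rw [levelIntegrand, levelIntegrand, Set.indicator_apply, Set.indicator_apply]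
  split_ifs with hz
  · rw [ContinuousLinearMap.adjoint_inner_left]
    have := congrArg (fun L => L f) (hS z⁻¹)
    change S (leftReg _ z⁻¹ f) = leftReg _ z⁻¹ (S f) at this
    rw [this]
  · rfl

end Membership

end Formula

/-! ### The cocycle relation -/

section Cocycle

variable {K : Type*} [Field K] [ValuativeRel K] [TopologicalSpace K] [IsNonarchimedeanLocalField K]
  {ϖ : 𝒪[K]} {n : ℕ} [MeasurableSpace K] [BorelSpace K]

variable (hϖ : Irreducible ϖ) {Ψ : AddChar K Circle}

/-- The product of three waves of level `m`, as an element of `L²(X_n × (X_n × X_n))`. -/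
def waveTriple (Ψ : AddChar K Circle) (m : ℕ) (b₁ : U ϖ n) (η₁ : K) (b₂ : U ϖ n) (η₂ : K)
    (b₃ : U ϖ n) (η₃ : K) : L2 ((haarX ϖ n).prod ((haarX ϖ n).prod (haarX ϖ n))) :=
  tmulFun _ _ (wave hϖ Ψ m b₁ η₁) (wavePair hϖ Ψ m b₂ η₂ b₃ η₃)

theorem pull_equiv12_wavePair (m : ℕ) (b₁ : U ϖ n) (η₁ : K) (b₂ : U ϖ n) (η₂ : K)
    (b₃ : U ϖ n) (η₃ : K) :
    pull (equiv12 (X ϖ n)) (measurePreserving_equiv12 (haarX ϖ n))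
      (tmulFun _ _ (wavePair hϖ Ψ m b₁ η₁ b₂ η₂) (wave hϖ Ψ m b₃ η₃)) =
      waveTriple hϖ Ψ m b₁ η₁ b₂ η₂ b₃ η₃ :=
  pull_equiv12_tmulFun _ _ _ _

variable (hΨ : ∀ x ∈ 𝒪[K], Ψ x = 1)

section Total

variable (hΨ' : ∃ x : K, (ϖ : K) * x ∈ 𝒪[K] ∧ Ψ x ≠ 1) (hn : 1 ≤ n)
include hΨ hΨ' hn

/-- A wave of level `m` is a combination of waves of any sufficiently high level. This follows from
the statement for pairs by integrating out the second variable. -/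
theorem wave_mem_span {m : ℕ} (hm : n ≤ m) (b : U ϖ n) (η : K) :
    ∃ M, ∀ k ≥ M, n ≤ k → wave hϖ Ψ m b η ∈ Submodule.span ℂ (waveSet hϖ (n := n) Ψ k) := by
  obtain ⟨M, hM⟩ := mem_span_of_isBruhat hϖ hΨ hΨ' (isBruhat_tmulFun_wave hϖ hn Ψ m m b 1 η 0)
  refine ⟨M, fun k hk hnk => ?_⟩
  let g := wave hϖ (n := n) Ψ m 1 0
  let C : L2 ((haarX ϖ n).prod (haarX ϖ n)) →L[ℂ] L2 (haarX ϖ n) :=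
    ContinuousLinearMap.adjoint (tmulRight (haarX ϖ n) g)
  have hC : ∀ f h, C (tmulFun _ _ f h) = ⟪g, h⟫_ℂ • f := by
    intro f h
    refine ext_inner_left ℂ fun v => ?_
    rw [ContinuousLinearMap.adjoint_inner_right, tmulRight_apply, inner_tmulFun, inner_smul_right,
      mul_comm]
  have hg : ⟪g, g⟫_ℂ ≠ 0 := right_ne_zero_of_mul_eq_one (card_pow_mul_gram_self hϖ hn Ψ hm)
  have hmap : ∀ x ∈ Submodule.span ℂ (wavePairs hϖ (n := n) Ψ k),
      C x ∈ Submodule.span ℂ (waveSet hϖ (n := n) Ψ k) := by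
    intro x hx
    induction hx using Submodule.span_induction with
    | zero => rw [map_zero]; exact zero_mem _
    | add x y _ _ hx hy => rw [map_add]; exact add_mem hx hy
    | smul c x _ hx => rw [map_smul]; exact Submodule.smul_mem _ _ hx
    | mem x hx =>
      obtain ⟨f, hf, h, -, rfl⟩ := hx
      rw [hC]
      exact Submodule.smul_mem _ _ (Submodule.subset_span hf)
  have h := hmap _ (hM k hk hnk)
  rwa [hC, Submodule.smul_mem_iff _ hg] at h

theorem isTotal_waveTriples (h2 : IsUnit (2 : 𝒪[K])) :
    IsTotal {f | ∃ m ≥ n, ∃ b₁ α b₂ β b₃ γ : U ϖ n,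
      f = waveTriple hϖ Ψ m b₁ (phi α) b₂ (phi β) b₃ (phi γ)} := by
  have h := isTotal_waves hϖ (n := n) hΨ hΨ'
  refine (isTotal_image2_tmulFun h (isTotal_image2_tmulFun h h)).of_subset_span ?_
  rintro _ ⟨_, ⟨m₁, hm₁, b₁, η₁, -, rfl⟩, _, ⟨_, ⟨m₂, hm₂, b₂, η₂, -, rfl⟩, _,
    ⟨m₃, hm₃, b₃, η₃, -, rfl⟩, rfl⟩, rfl⟩
  obtain ⟨M₁, H₁⟩ := wave_mem_span hϖ hΨ hΨ' hn hm₁ b₁ η₁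
  obtain ⟨M₂, H₂⟩ := wave_mem_span hϖ hΨ hΨ' hn hm₂ b₂ η₂
  obtain ⟨M₃, H₃⟩ := wave_mem_span hϖ hΨ hΨ' hn hm₃ b₃ η₃
  obtain ⟨k, hk₁, hk₂, hk₃, hnk⟩ : ∃ k, M₁ ≤ k ∧ M₂ ≤ k ∧ M₃ ≤ k ∧ n ≤ k :=
    ⟨M₁ + M₂ + M₃ + n, by omega, by omega, by omega, by omega⟩
  refine Submodule.span_mono ?_ (tmulFun_mem_span (H₁ k hk₁ hnk)
    (tmulFun_mem_span (H₂ k hk₂ hnk) (H₃ k hk₃ hnk)))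
  rintro _ ⟨_, ⟨b₁, η₁, h₁, rfl⟩, _, ⟨_, ⟨b₂, η₂, h₂, rfl⟩, _, ⟨b₃, η₃, h₃, rfl⟩, rfl⟩, rfl⟩
  obtain ⟨α, rfl⟩ := exists_phi_eq hϖ h2 hn h₁
  obtain ⟨β, rfl⟩ := exists_phi_eq hϖ h2 hn h₂
  obtain ⟨γ, rfl⟩ := exists_phi_eq hϖ h2 hn h₃
  exact ⟨k, hnk, b₁, α, b₂, β, b₃, γ, rfl⟩

end Total

section Action

variable {S : W ((haarX ϖ n).prod (haarX ϖ n))} (hS : IsInverseTwist hϖ Ψ S.1)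
  {m : ℕ} (hm : n ≤ m)
include hΨ hS hm

omit hΨ in
theorem oneTensor_waveTriple (b₁ : U ϖ n) (η₁ : K) (b₂ β b₃ γ : U ϖ n) :
    (oneTensor (haarX ϖ n) S).1 (waveTriple hϖ Ψ m b₁ η₁ b₂ (phi β) b₃ (phi γ)) =
      waveTriple hϖ Ψ m b₁ η₁ (b₂ * γ⁻¹) (phi β * incl γ) (β * b₃) (phi γ * (incl β)⁻¹) := by
  rw [oneTensor_apply, waveTriple, opTensor_tmulFun, hS m hm]
  rfl

omit hΨ in
theorem tensorOne_waveTriple (b₁ α b₂ β b₃ : U ϖ n) (η₃ : K) :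
    (tensorOne (haarX ϖ n) S).1 (waveTriple hϖ Ψ m b₁ (phi α) b₂ (phi β) b₃ η₃) =
      waveTriple hϖ Ψ m (b₁ * β⁻¹) (phi α * incl β) (α * b₂) (phi β * (incl α)⁻¹) b₃ η₃ := by
  rw [← pull_equiv12_wavePair]
  refine (implement_pull _ _ S.1 _).trans ?_
  rw [opTensor_tmulFun, hS m hm]
  exact pull_equiv12_wavePair hϖ _ _ _ _ _ _ _

/-- Two waves in the second and third variables are the image under the shear of a wave of
frequency `η₂ + η₃` and a wave in the quotient of the variables, on which `Id ⊗ Δ̂` is trivial. -/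
theorem idTensorCoproduct_waveTriple (b₁ α b₂ b₃ δ : U ϖ n) {η₂ η₃ : K}
    (h₃ : η₃ ∈ primePow ϖ n) (hδ : phi δ = η₂ + η₃) :
    (idTensorCoproduct (haarX ϖ n) S).1 (waveTriple hϖ Ψ m b₁ (phi α) b₂ η₂ b₃ η₃) =
      waveTriple hϖ Ψ m (b₁ * δ⁻¹) (phi α * incl δ) (α * b₂) (η₂ * (incl α)⁻¹)
        (α * b₃) (η₃ * (incl α)⁻¹) := by
  have hsplit : ∀ (c : U ϖ n) (ξ : K), waveTriple hϖ Ψ m c ξ b₂ η₂ b₃ η₃ =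
      pull (equivIdΔ (X ϖ n)) (measurePreserving_equivIdΔ (haarX ϖ n))
        (tmulFun _ _ (wavePair hϖ Ψ m c ξ b₂ (phi δ))
          (wave hϖ Ψ m (b₂⁻¹ * b₃) (incl b₂ * η₃))) := by
    intro c ξ
    rw [wavePair, pull_equivIdΔ, pull_shear_wave hϖ hΨ hm _ _ (phi_mem _) (incl_mul_mem _ h₃),
      inv_mul_cancel_left₀ (incl_ne_zero b₂), mul_inv_cancel_left, hδ, add_sub_cancel_right]
    rfl
  have ha := incl_ne_zero α
  have hb := incl_ne_zero b₂
  rw [hsplit]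
  refine (implement_pull _ _ S.1 _).trans ?_
  rw [opTensor_tmulFun, hS m hm, one_apply_eq_self, wavePair, pull_equivIdΔ,
    pull_shear_wave hϖ hΨ hm _ _ (mul_mem_primePow (phi_mem _) (inv_incl_mem _))
      (incl_mul_mem _ h₃)]
  have e₁ : (incl (α * b₂))⁻¹ * (incl b₂ * η₃) = η₃ * (incl α)⁻¹ := by
    rw [incl_mul]; field_simp
  have e₂ : phi δ * (incl α)⁻¹ - η₃ * (incl α)⁻¹ = η₂ * (incl α)⁻¹ := by
    rw [hδ]; ring
  have e₃ : α * b₂ * (b₂⁻¹ * b₃) = α * b₃ := by group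
  rw [e₁, e₂, e₃]
  rfl

/-- The analogue of `idTensorCoproduct_waveTriple` for the first and second variables. -/
theorem coproductTensorId_waveTriple (b₁ b₂ b₃ γ δ : U ϖ n) {η₁ η₂ : K}
    (h₂ : η₂ ∈ primePow ϖ n) (hδ : phi δ = η₁ + η₂) :
    (coproductTensorId (haarX ϖ n) S).1 (waveTriple hϖ Ψ m b₁ η₁ b₂ η₂ b₃ (phi γ)) =
      waveTriple hϖ Ψ m (b₁ * γ⁻¹) (η₁ * incl γ) (b₂ * γ⁻¹) (η₂ * incl γ)
        (δ * b₃) (phi γ * (incl δ)⁻¹) := by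
  have hsplit : waveTriple hϖ Ψ m b₁ η₁ b₂ η₂ b₃ (phi γ) =
      pull (equivΔId (X ϖ n)) (measurePreserving_equivΔId (haarX ϖ n))
        (tmulFun _ _ (wavePair hϖ Ψ m b₁ (phi δ) b₃ (phi γ))
          (wave hϖ Ψ m (b₁⁻¹ * b₂) (incl b₁ * η₂))) := by
    rw [wavePair, pull_equivΔId, pull_shear_wave hϖ hΨ hm _ _ (phi_mem _) (incl_mul_mem _ h₂),
      inv_mul_cancel_left₀ (incl_ne_zero b₁), mul_inv_cancel_left, hδ, add_sub_cancel_right]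
    exact (pull_equiv12_wavePair hϖ _ _ _ _ _ _ _).symm
  have hc := incl_ne_zero γ
  have hb := incl_ne_zero b₁
  rw [hsplit]
  refine (implement_pull _ _ S.1 _).trans ?_
  rw [opTensor_tmulFun, hS m hm, one_apply_eq_self, wavePair, pull_equivΔId,
    pull_shear_wave hϖ hΨ hm _ _ (mul_mem_primePow (phi_mem _) (incl_mem _))
      (incl_mul_mem _ h₂)]
  have e₁ : (incl (b₁ * γ⁻¹))⁻¹ * (incl b₁ * η₂) = η₂ * incl γ := by
    rw [incl_mul, incl_inv]; field_simp
  have e₂ : phi δ * incl γ - η₂ * incl γ = η₁ * incl γ := by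
    rw [hδ]; ring
  have e₃ : b₁ * γ⁻¹ * (b₁⁻¹ * b₂) = b₂ * γ⁻¹ := by
    rw [mul_comm b₁, mul_assoc, mul_inv_cancel_left, mul_comm]
  rw [e₁, e₂, e₃]
  exact pull_equiv12_wavePair hϖ _ _ _ _ _ _ _

end Action

/-- The cocycle relation for the inverse of the twist. Both sides map the product of the waves
`⟨b₁, φ(α)⟩`, `⟨b₂, φ(β)⟩`, `⟨b₃, φ(γ)⟩` to the product of the waves `⟨b₁/(βγ), φ(α)βγ⟩`,
`⟨αb₂/γ, φ(β)γ/α⟩`, `⟨αβb₃, φ(γ)/(αβ)⟩`. -/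
theorem inverseTwist_cocycle (h2 : IsUnit (2 : 𝒪[K])) (hn : 1 ≤ n) (hΨ : ∀ x ∈ 𝒪[K], Ψ x = 1)
    (hΨ' : ∃ x : K, (ϖ : K) * x ∈ 𝒪[K] ∧ Ψ x ≠ 1)
    {S : W ((haarX ϖ n).prod (haarX ϖ n))} (hS : IsInverseTwist hϖ Ψ S.1) :
    idTensorCoproduct (haarX ϖ n) S * oneTensor (haarX ϖ n) S =
      coproductTensorId (haarX ϖ n) S * tensorOne (haarX ϖ n) S := by
  refine Subtype.ext ((isTotal_waveTriples hϖ hΨ hΨ' hn h2).op_ext ?_)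
  rintro _ ⟨m, hm, b₁, α, b₂, β, b₃, γ, rfl⟩
  change (idTensorCoproduct (haarX ϖ n) S).1 ((oneTensor (haarX ϖ n) S).1 _) =
    (coproductTensorId (haarX ϖ n) S).1 ((tensorOne (haarX ϖ n) S).1 _)
  rw [oneTensor_waveTriple hϖ hS hm, tensorOne_waveTriple hϖ hS hm,
    idTensorCoproduct_waveTriple hϖ hΨ hS hm b₁ α _ _ (β * γ)
      (mul_mem_primePow (phi_mem _) (inv_incl_mem _)) (phi_mul β γ),
    coproductTensorId_waveTriple hϖ hΨ hS hm _ _ b₃ γ (α * β)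
      (mul_mem_primePow (phi_mem _) (inv_incl_mem _)) (phi_mul α β)]
  rw [mul_inv β γ, ← mul_assoc b₁, incl_mul, ← mul_assoc (phi α), ← mul_assoc α b₂,
    ← mul_assoc α β, mul_right_comm (phi β), incl_mul, mul_inv (incl α), mul_comm (incl α)⁻¹,
    ← mul_assoc (phi γ)]

end Cocycle

end

end DualCocycle

theorem mainTheorem4 {K : Type*} [Field K] [ValuativeRel K] [TopologicalSpace K]
    [IsNonarchimedeanLocalField K] [MeasurableSpace K] [BorelSpace K]
    (h2 : IsUnit (2 : 𝒪[K]))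
    (ϖ : 𝒪[K]) (hϖ : Irreducible ϖ) (n : ℕ) (hn : 1 ≤ n)
    (Ψ : AddChar K Circle) (hΨ_cont : Continuous Ψ) (hΨ_triv : ∀ x ∈ 𝒪[K], Ψ x = 1)
    (hΨ_nontriv : ∃ x : K, (ϖ : K) * x ∈ 𝒪[K] ∧ Ψ x ≠ 1) :
    ∃ F : DualCocycle.W ((DualCocycle.haarX ϖ n).prod (DualCocycle.haarX ϖ n)),
      (∀ T : DualCocycle.L2 ((DualCocycle.haarX ϖ n).prod (DualCocycle.haarX ϖ n)) →L[ℂ]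
          DualCocycle.L2 ((DualCocycle.haarX ϖ n).prod (DualCocycle.haarX ϖ n)),
        DualCocycle.IsTwistOperator Ψ T ↔ T = F.1) ∧
      F ∈ unitary (DualCocycle.W ((DualCocycle.haarX ϖ n).prod (DualCocycle.haarX ϖ n))) ∧
      DualCocycle.oneTensor (DualCocycle.haarX ϖ n) F *
          DualCocycle.idTensorCoproduct (DualCocycle.haarX ϖ n) F =
        DualCocycle.tensorOne (DualCocycle.haarX ϖ n) F *
          DualCocycle.coproductTensorId (DualCocycle.haarX ϖ n) F := by
  obtain ⟨G, hG⟩ := DualCocycle.exists_inverseTwist hϖ h2 hn hΨ_triv hΨ_nontriv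
  let F : DualCocycle.W ((DualCocycle.haarX ϖ n).prod (DualCocycle.haarX ϖ n)) :=
    ⟨DualCocycle.twistOp G, DualCocycle.twistOp_mem_groupVN hϖ h2 hn hΨ_triv hΨ_nontriv hG⟩
  have hstar : ∀ f, (star F).1 f = G f := fun f => ext_inner_right ℂ fun h => by
    change inner ℂ (ContinuousLinearMap.adjoint (DualCocycle.twistOp G) f) h = _
    rw [ContinuousLinearMap.adjoint_inner_left, DualCocycle.inner_twistOp]
  refine ⟨F, fun T => ⟨fun hT => DualCocycle.eq_twistOp_of_isTwistOperator hϖ h2 hn hΨ_triv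
    hΨ_nontriv hG hT, ?_⟩, ?_, star_injective ?_⟩
  · rintro rfl
    exact DualCocycle.isTwistOperator_twistOp hϖ h2 hn hΨ_triv hΨ_nontriv hG
  · refine Unitary.mem_iff.2 ⟨Subtype.ext (ContinuousLinearMap.ext fun f => ?_),
      Subtype.ext (ContinuousLinearMap.ext fun f => ?_)⟩
    · change (star F).1 (G.symm f) = f
      rw [hstar, G.apply_symm_apply]
    · change G.symm ((star F).1 f) = f
      rw [hstar, G.symm_apply_apply]
  · rw [star_mul, star_mul, ← map_star, ← map_star, ← map_star, ← map_star]
    refine DualCocycle.inverseTwist_cocycle hϖ h2 hn hΨ_triv hΨ_nontriv fun m hm b₁ a b₂ b => ?_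
    rw [hstar]
    exact hG m hm b₁ a b₂ b
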